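/- Let $dS_3=\{x\in\mathbb R^{1,3}: -x_0^2+x_1^2+x_2^2+x_3^2=1\}$ be the unit hyperboloid with the induced Lorentzian metric $h_{ab}$, in coordinates $-d\tau^2+\cosh^2\tau\,(d\theta^2+\sin^2\theta\,d\phi^2)$, let $\mathcal D_a$ be its Levi-Civita connection, $\square=\mathcal D^a\mathcal D_a$, $\epsilon_{abc}$ its volume form with $\epsilon_{\tau\theta\phi}=\cosh^2\tau\sin\theta$, and $(\operatorname{curl}T)_{ab}=\epsilon_a{}^{cd}\mathcal D_cT_{db}$. All fields are real and smooth ($C^\infty$) on the whole of $dS_3$. Let $f_{1}=\cos\theta$, $f_{2}=\sin\theta\cos\phi$, $f_{3}=\sin\theta\sin\phi$ and put $$\zeta_0=\sinh\tau,\quad \zeta_k=\cosh\tau\, f_k,\qquad \hat\zeta_0=\frac{\cosh2\tau}{\cosh\tau},\quad \hat\zeta_k=\Big(2\sinh\tau+\frac{\tanh\tau}{\cosh\tau}\Big)f_k\qquad(k=1,2,3).$$ For a solution of $\square\Phi+3\Phi=0$, the part of the spherical harmonic expansion of $\Phi$ along $1$ (respectively along $f_k$) is $a_0\zeta_0+b_0\hat\zeta_0$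 (respectively $a_k\zeta_k+b_k\hat\zeta_k$) with constants $a_i,b_i$; we say that $\Phi$ does not contain the four harmonics $\hat\zeta_i$ if $b_0=b_1=b_2=b_3=0$. Let $\Phi$ be a scalar on $dS_3$ with $\square\Phi+3\Phi=0$ that does not contain the four harmonics $\hat\zeta_i$. Then: 1. The tensor $T_{ab}=\mathcal D_a\mathcal D_b\Phi+h_{ab}\Phi$ is symmetric, traceless, divergence-free and curl-free. 2. There is a symmetric, traceless and divergence-free tensor $P_{ab}$ with $T_{ab}=\epsilon_a{}^{cd}\mathcal D_cP_{db}$. 3. If $P_{ab}$ is any such tensor, then a tensor $P'_{ab}$ is also symmetric, traceless and divergence-free with $T=\operatorname{curl}P'$ if and only if $P'_{ab}=P_{ab}+\mathcal D_a\mathcal D_b\omega+h_{ab}\omega$ for some scalar $\omega$ with $\square\omega+3\omega=0$. -/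

import Mathlib

open scoped ContDiff

noncomputable section

namespace DeSitter

/-- The diagonal entries of the Minkowski metric `diag (-1, 1, 1, 1)` on `ℝ⁴`; multiplication by
`sgn a` raises or lowers the index `a`. -/
def sgn (a : Fin 4) : ℝ := if a = 0 then -1 else 1

/-- The Minkowski product on `ℝ⁴`. -/
def mink (x y : Fin 4 → ℝ) : ℝ := ∑ a, sgn a * x a * y a

/-- Three-dimensional de Sitter space: the unit hyperboloid `-x₀² + x₁² + x₂² + x₃² = 1`. -/
def dS3 : Set (Fin 4 → ℝ) := {x | mink x x = 1}

/-- The open cone of spacelike vectors, an open neighbourhood of the hyperboloid. -/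
def spacelike : Set (Fin 4 → ℝ) := {x | 0 < mink x x}

theorem normalize_mem {x : Fin 4 → ℝ} (hx : 0 < mink x x) :
    (Real.sqrt (mink x x))⁻¹ • x ∈ dS3 := by
  have key : mink ((Real.sqrt (mink x x))⁻¹ • x) ((Real.sqrt (mink x x))⁻¹ • x)
      = (Real.sqrt (mink x x))⁻¹ * (Real.sqrt (mink x x))⁻¹ * mink x x := by
    generalize (Real.sqrt (mink x x))⁻¹ = c
    simp only [mink, Pi.smul_apply, smul_eq_mul, Finset.mul_sum]
    exact Finset.sum_congr rfl fun a _ => by ring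
  have h0 : Real.sqrt (mink x x) ≠ 0 := (Real.sqrt_pos.mpr hx).ne'
  have hs : mink x x = Real.sqrt (mink x x) * Real.sqrt (mink x x) :=
    (Real.mul_self_sqrt hx.le).symm
  show mink _ _ = 1
  rw [key]
  conv_lhs => rw [show (Real.sqrt (mink x x))⁻¹ * (Real.sqrt (mink x x))⁻¹ * mink x x
    = (Real.sqrt (mink x x))⁻¹ * (Real.sqrt (mink x x))⁻¹ *
      (Real.sqrt (mink x x) * Real.sqrt (mink x x)) by rw [← hs]]
  field_simp

open Classical in
/-- The extension of a field on the hyperboloid to the cone of spacelike vectors that is constant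
along rays, `x ↦ f (x / √(x·x))` (and `0` off the cone, where it plays no role). -/
def radialExt {F : Type*} [Zero F] (f : dS3 → F) (x : Fin 4 → ℝ) : F :=
  if hx : 0 < mink x x then f ⟨_, normalize_mem hx⟩ else 0

/-- Smoothness on the hyperboloid: since `x ↦ x / √(x·x)` is a smooth retraction of the spacelike
cone onto it, this is smoothness of the radially constant extension. -/
def Smooth {F : Type*} [NormedAddCommGroup F] [NormedSpace ℝ F] (f : dS3 → F) : Prop :=
  ContDiffOn ℝ ∞ (radialExt f) spacelike

/-- The flat partial derivative `∂_a` of the radially constant extension, at a point of the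
hyperboloid. -/
def pd (f : dS3 → ℝ) (x : dS3) (a : Fin 4) : ℝ :=
  fderiv ℝ (radialExt f) x (Pi.single a 1)

/-- The orthogonal projector `δ_a^b - x_a x^b` onto the tangent space of the hyperboloid. -/
def proj (x : dS3) (a b : Fin 4) : ℝ :=
  (if a = b then 1 else 0) - sgn a * x.1 a * x.1 b

/-! A covariant tensor on the tangent space `x^⊥` at `x` is represented by its components in `ℝ⁴`,
extended so that it vanishes when any slot is contracted with the normal `x`. The Levi-Civita
connection of the induced metric is the flat derivative with every index projected to the tangent
space (Gauss formula). -/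

/-- `D_a f`. -/
def grad (f : dS3 → ℝ) (x : dS3) (a : Fin 4) : ℝ := ∑ a', proj x a a' * pd f x a'

/-- `D_a v_b`. -/
def covDeriv₁ (v : dS3 → Fin 4 → ℝ) (x : dS3) (a b : Fin 4) : ℝ :=
  ∑ a', ∑ b', proj x a a' * proj x b b' * pd (fun y => v y b') x a'

/-- `D_a T_bc`. -/
def covDeriv₂ (T : dS3 → Fin 4 → Fin 4 → ℝ) (x : dS3) (a b c : Fin 4) : ℝ :=
  ∑ a', ∑ b', ∑ c', proj x a a' * proj x b b' * proj x c c' * pd (fun y => T y b' c') x a'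

/-- The metric `h_ab` induced on the hyperboloid by the Minkowski metric. -/
def metric (x : dS3) (a b : Fin 4) : ℝ :=
  (if a = b then sgn a else 0) - (sgn a * x.1 a) * (sgn b * x.1 b)

/-- The volume form `ε_abc`: its value on tangent vectors `u, v, w` is `det (u, v, w, x)`. In the
coordinates of `point` below, `ε_τθφ = cosh² τ sin θ`. -/
def vol (x : dS3) (a b c : Fin 4) : ℝ :=
  Matrix.det (Matrix.of ![Pi.single a 1, Pi.single b 1, Pi.single c 1, x.1])

/-- The trace `h^{ab} T_ab` of a tangential tensor. -/
def trace (T : Fin 4 → Fin 4 → ℝ) : ℝ := ∑ a, sgn a * T a a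

/-- The Hessian `D_a D_b f`. -/
def hess (f : dS3 → ℝ) : dS3 → Fin 4 → Fin 4 → ℝ := covDeriv₁ (grad f)

/-- The wave operator `□ f = h^{ab} D_a D_b f`. -/
def box (f : dS3 → ℝ) (x : dS3) : ℝ := trace (hess f x)

/-- The divergence `D^b T_ab`. -/
def div (T : dS3 → Fin 4 → Fin 4 → ℝ) (x : dS3) (a : Fin 4) : ℝ :=
  ∑ b, sgn b * covDeriv₂ T x b a b

/-- `(curl T)_ab = ε_a^{cd} D_c T_db`. -/
def curl (T : dS3 → Fin 4 → Fin 4 → ℝ) (x : dS3) (a b : Fin 4) : ℝ :=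
  ∑ c, ∑ d, vol x a c d * sgn c * sgn d * covDeriv₂ T x c d b

/-- The tensor `D_a D_b f + h_ab f` with scalar potential `f`. -/
def scalarTensor (f : dS3 → ℝ) (x : dS3) (a b : Fin 4) : ℝ :=
  hess f x a b + metric x a b * f x

/-- Smooth symmetric, traceless and divergence-free covariant 2-tensor fields on the
hyperboloid. -/
structure IsSDT (T : dS3 → Fin 4 → Fin 4 → ℝ) : Prop where
  smooth : Smooth T
  tangent : ∀ x : dS3, ∀ a, ∑ b, T x a b * x.1 b = 0
  symm : ∀ x a b, T x a b = T x b a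
  traceless : ∀ x, trace (T x) = 0
  divFree : ∀ x a, div T x a = 0

/-- The point of the hyperboloid with coordinates `(τ, θ, φ)`, in which the induced metric is
`-dτ² + cosh² τ (dθ² + sin² θ dφ²)`. -/
def point (τ θ φ : ℝ) : dS3 :=
  ⟨![Real.sinh τ, Real.cosh τ * (Real.sin θ * Real.cos φ),
      Real.cosh τ * (Real.sin θ * Real.sin φ), Real.cosh τ * Real.cos θ], by
    show mink _ _ = 1
    simp [mink, sgn, Fin.sum_univ_four]
    linear_combination Real.cosh_sq τ + Real.cosh τ ^ 2 * Real.sin_sq_add_cos_sq θ +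
      Real.cosh τ ^ 2 * Real.sin θ ^ 2 * Real.sin_sq_add_cos_sq φ⟩

/-- The spherical harmonics with `l = 0` (index `0`) and `l = 1` (indices `1, 2, 3`). -/
def harm (i : Fin 4) (θ φ : ℝ) : ℝ :=
  ![1, Real.cos θ, Real.sin θ * Real.cos φ, Real.sin θ * Real.sin φ] i

/-- The reciprocal of the integral of `harm i ^ 2` over the unit sphere. -/
def harmNormalization (i : Fin 4) : ℝ := if i = 0 then 1 / (4 * Real.pi) else 3 / (4 * Real.pi)

/-- The coefficient function of `harm i` in the expansion of `f` into spherical harmonics. -/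
def harmCoeff (f : dS3 → ℝ) (i : Fin 4) (τ : ℝ) : ℝ :=
  harmNormalization i * ∫ θ in (0 : ℝ)..Real.pi, ∫ φ in (0 : ℝ)..(2 * Real.pi),
    f (point τ θ φ) * harm i θ φ * Real.sin θ

/-- The time dependence of the odd harmonics `ζ₀ = sinh τ` and `ζ_k = cosh τ f_k`. -/
def zetaProfile (i : Fin 4) (τ : ℝ) : ℝ := if i = 0 then Real.sinh τ else Real.cosh τ

/-- The time dependence of the even harmonics `ζ̂₀ = cosh 2τ / cosh τ` and
`ζ̂_k = (2 sinh τ + tanh τ / cosh τ) f_k`. -/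
def zetaHatProfile (i : Fin 4) (τ : ℝ) : ℝ :=
  if i = 0 then Real.cosh (2 * τ) / Real.cosh τ
  else 2 * Real.sinh τ + Real.tanh τ / Real.cosh τ

/-- The harmonic `ζ̂_i` occurs, with a nonzero coefficient `b`, in the harmonic expansion of the
solution `f` of `□ f + 3 f = 0`; the `harm i` part of such an `f` is a combination of `ζ_i` and
`ζ̂_i`. -/
def ContainsZetaHat (f : dS3 → ℝ) (i : Fin 4) : Prop :=
  ∃ a b : ℝ, b ≠ 0 ∧ ∀ τ, harmCoeff f i τ = a * zetaProfile i τ + b * zetaHatProfile i τ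

end DeSitter

end

/-! ### Integrals depending smoothly on a parameter, and the Poincaré lemma. -/

section

open MeasureTheory Set

/-! Fields on the hyperboloid are traded for homogeneous fields on the cone of spacelike vectors. If
a scalar is extended to F with degree one, then D_a D_b + h_ab becomes the flat Hessian ∂_a∂_b F and
□ + 3 becomes the flat wave operator (`scalarTensor_restrict`, `box_restrict`). If a symmetric
tangential tensor is extended with degree -1, its curl and, when it is traceless, its divergence are
computed by flat derivatives (`ConeTensor.curl_restrict`, `ConeTensor.div_restrict`). The first
claim is then the commutation of partial derivatives.

For the third claim let S be curl-free. Homogeneity kills the radial part of ∂_c S_db - ∂_d S_cb, so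
every column of S is a closed 1-form on the cone. The cone has the homotopy type of a 2-sphere, so
these forms are exact (`exists_potential_on_spacelike`): S_ab = ∂_a V_b, and F = ∑ x_b V_b is a
scalar potential (`ConeTensor.exists_scalar_potential`). Vanishing trace becomes the wave equation
for F.

For the second claim fix b and put V = ∂_b F, of degree zero. Then □V = 0 on the hyperboloid, so the
dual of dV is a closed 2-form, and the column P_·b has to be a potential of it. The obstruction is
the flux through the sphere, which is the time derivative of the spherical mean of V. On the spheres
|x⃗| = 1, x₀ = t this mean is α_b + β_b t (`exists_affine_mean`), and β_b is, up to a nonzero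
factor, the coefficient of one of the ζ̂ (`exists_const_mean`). If these are absent, the constants
α_b are removed by subtracting from F a linear function, which leaves the Hessian unchanged
(`exists_meanZero`).

With all means zero there is an explicit potential. Let L_a be the generators of spatial rotations
(L_0 = 0) and solve ∑ L_i L_i Z_b = ∂_0∂_b F on each sphere; then also (x·x) ∂_0 Z_b = ∂_b F. Put
P_ab = L_a Z_b + ∂_a(∑ x_c L_b Z_c). The first term already has the required curl; the gradient does
not change it and makes P tangential. Symmetry, tracelessness and vanishing divergence follow
(`CurlData.curl_eq`, `CurlData.isSDT`).

The spherical Laplacian is inverted by averaging over unit quaternions with the Green function (π -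
χ) cot χ of the 3-sphere (`angLap_greenAvg_of_meanZero`). The weight is a class function, so the
average commutes with every L_i; it also commutes with ∂_0 and preserves smoothness and homogeneity.
Hence no convergence of harmonic expansions enters. -/

theorem exists_bound_of_continuousOn_uIcc_prod {E F : Type} [NormedAddCommGroup E] [NormedSpace ℝ E]
    [FiniteDimensional ℝ E] [NormedAddCommGroup F] {a b : ℝ} {U : Set E} (hU : IsOpen U)
    {O : Set (ℝ × E)} (hsub : ∀ s ∈ uIcc a b, ∀ x ∈ U, (s, x) ∈ O)
    {g : ℝ × E → F} (hg : ContinuousOn g O) {x : E} (hx : x ∈ U) :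
    ∃ ε > 0, ∃ C, Metric.ball x ε ⊆ U ∧ ∀ s ∈ uIcc a b, ∀ y ∈ Metric.ball x ε, ‖g (s, y)‖ ≤ C := by
  have : ProperSpace E := FiniteDimensional.proper ℝ E
  obtain ⟨ε, hε, hball⟩ := Metric.nhds_basis_closedBall.mem_iff.1 (hU.mem_nhds hx)
  have hK : IsCompact (uIcc a b ×ˢ Metric.closedBall x ε) :=
    isCompact_uIcc.prod (isCompact_closedBall x ε)
  obtain ⟨C, hC⟩ := hK.exists_bound_of_continuousOn
    (hg.mono (fun p hp => hsub p.1 hp.1 p.2 (hball hp.2)))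
  exact ⟨ε, hε, C, Metric.ball_subset_closedBall.trans hball,
    fun s hs y hy => hC (s, y) ⟨hs, Metric.ball_subset_closedBall hy⟩⟩

/-- Differentiation under the integral sign, for an integrand that is `C¹` jointly. -/
theorem hasFDerivAt_intervalIntegral_of_contDiffOn {E F : Type} [NormedAddCommGroup E]
    [NormedSpace ℝ E] [FiniteDimensional ℝ E] [NormedAddCommGroup F] [NormedSpace ℝ F]
    [CompleteSpace F] {a b : ℝ} {U : Set E}
    (hU : IsOpen U) {O : Set (ℝ × E)} (hO : IsOpen O) (hsub : ∀ s ∈ uIcc a b, ∀ x ∈ U, (s, x) ∈ O)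
    {f : ℝ × E → F} (hf : ContDiffOn ℝ 1 f O) {x : E} (hx : x ∈ U) :
    HasFDerivAt (fun y => ∫ s in a..b, f (s, y))
      (∫ s in a..b, (fderiv ℝ f (s, x)).comp (ContinuousLinearMap.inr ℝ ℝ E)) x := by
  have hf' : ContinuousOn (fderiv ℝ f) O := hf.continuousOn_fderiv_of_isOpen hO le_rfl
  have hg : ContinuousOn (fun p => (fderiv ℝ f p).comp (ContinuousLinearMap.inr ℝ ℝ E)) O :=
    hf'.clm_comp continuousOn_const
  obtain ⟨ε, hε, C, hball, hC⟩ := exists_bound_of_continuousOn_uIcc_prod hU hsub hg hx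
  have hsl : ∀ y ∈ U, ContinuousOn (fun s : ℝ => (s, y)) (uIcc a b) := fun y _ =>
    (Continuous.prodMk continuous_id continuous_const).continuousOn
  have hm : ∀ y ∈ U, ∀ (G : Type) [NormedAddCommGroup G] (g : ℝ × E → G), ContinuousOn g O →
      ContinuousOn (fun s => g (s, y)) (uIcc a b) := fun y hy G _ g hg =>
    hg.comp (hsl y hy) (fun s hs => hsub s hs y hy)
  refine intervalIntegral.hasFDerivAt_integral_of_dominated_of_fderiv_le (bound := fun _ => C)
    (F' := fun y s => (fderiv ℝ f (s, y)).comp (ContinuousLinearMap.inr ℝ ℝ E))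
    (Metric.ball_mem_nhds x hε) ?_ ?_ ?_ ?_ ?_ ?_
  · filter_upwards [hU.mem_nhds hx] with y hy
    exact ((hm y hy F f hf.continuousOn).mono uIoc_subset_uIcc).aestronglyMeasurable
      measurableSet_uIoc
  · exact (hm x hx F f hf.continuousOn).intervalIntegrable
  · exact ((hm x hx _ _ hg).mono uIoc_subset_uIcc).aestronglyMeasurable measurableSet_uIoc
  · exact ae_of_all _ fun s hs y hy => hC s (uIoc_subset_uIcc hs) y hy
  · exact intervalIntegrable_const
  · refine ae_of_all _ fun s hs y hy => ?_
    have h1 : HasFDerivAt f (fderiv ℝ f (s, y)) (s, y) :=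
      ((hf.differentiableOn one_ne_zero).differentiableAt
        (hO.mem_nhds (hsub s (uIoc_subset_uIcc hs) y (hball hy)))).hasFDerivAt
    exact h1.comp y (hasFDerivAt_prodMk_right s y)

/-- The derivative is again a parametric integral, but with values in `E →L[ℝ] F`; the target space
therefore has to vary inside the induction on `n`. -/
theorem contDiffOn_intervalIntegral_nat {E : Type} [NormedAddCommGroup E]
    [NormedSpace ℝ E] [FiniteDimensional ℝ E] {a b : ℝ} {U : Set E}
    (hU : IsOpen U) {O : Set (ℝ × E)} (hO : IsOpen O) (hsub : ∀ s ∈ uIcc a b, ∀ x ∈ U, (s, x) ∈ O)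
    (n : ℕ) : ∀ {F : Type} [NormedAddCommGroup F] [NormedSpace ℝ F] [CompleteSpace F]
    {f : ℝ × E → F}, ContDiffOn ℝ ∞ f O →
    ContDiffOn ℝ n (fun y => ∫ s in a..b, f (s, y)) U := by
  induction n with
  | zero =>
    intro F _ _ _ f hf
    refine contDiffOn_zero.2 fun x hx => ?_
    exact (hasFDerivAt_intervalIntegral_of_contDiffOn hU hO hsub (hf.of_le (by simp))
      hx).continuousAt.continuousWithinAt
  | succ n ih =>
    intro F _ _ _ f hf
    have hd : ∀ x ∈ U, HasFDerivAt (fun y => ∫ s in a..b, f (s, y))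
      (∫ s in a..b, (fderiv ℝ f (s, x)).comp (ContinuousLinearMap.inr ℝ ℝ E)) x := fun x hx =>
      hasFDerivAt_intervalIntegral_of_contDiffOn hU hO hsub (hf.of_le (by simp)) hx
    push_cast
    rw [contDiffOn_succ_iff_fderiv_of_isOpen hU]
    refine ⟨fun x hx => (hd x hx).differentiableAt.differentiableWithinAt, by simp, ?_⟩
    have hg : ContDiffOn ℝ ∞ (fun p => (fderiv ℝ f p).comp (ContinuousLinearMap.inr ℝ ℝ E)) O :=
      (hf.fderiv_of_isOpen hO (by simp)).clm_comp contDiffOn_const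
    exact (ih hg).congr fun x hx => (hd x hx).fderiv

theorem contDiffOn_intervalIntegral {E F : Type} [NormedAddCommGroup E]
    [NormedSpace ℝ E] [FiniteDimensional ℝ E] [NormedAddCommGroup F] [NormedSpace ℝ F]
    [CompleteSpace F] {a b : ℝ} {U : Set E}
    (hU : IsOpen U) {O : Set (ℝ × E)} (hO : IsOpen O) (hsub : ∀ s ∈ uIcc a b, ∀ x ∈ U, (s, x) ∈ O)
    {f : ℝ × E → F} (hf : ContDiffOn ℝ ∞ f O) :
    ContDiffOn ℝ ∞ (fun y => ∫ s in a..b, f (s, y)) U :=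
  contDiffOn_infty.2 fun n => contDiffOn_intervalIntegral_nat hU hO hsub n hf

/-- The Poincaré lemma for smooth 1-forms on a star-shaped open set. -/
theorem exists_hasFDerivAt_of_starConvex {E : Type} [NormedAddCommGroup E]
    [NormedSpace ℝ E] [FiniteDimensional ℝ E] {U : Set E} (hU : IsOpen U) {p : E}
    (hp : StarConvex ℝ p U) {α : E → E →L[ℝ] ℝ} (hα : ContDiffOn ℝ ∞ α U)
    (hsymm : ∀ x ∈ U, ∀ u v, fderiv ℝ α x u v = fderiv ℝ α x v u) :
    ∃ V : E → ℝ, ∀ x ∈ U, HasFDerivAt V (α x) x := by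
  set m : ℝ × E → E := fun q => p + q.1 • (q.2 - p) with hm
  have hmc : ContDiff ℝ ∞ m := by fun_prop
  have hO : IsOpen (m ⁻¹' U) := hU.preimage hmc.continuous
  have hsub : ∀ s ∈ uIcc (0 : ℝ) 1, ∀ x ∈ U, (s, x) ∈ m ⁻¹' U := by
    intro s hs x hx
    rw [uIcc_of_le zero_le_one] at hs
    exact hp.add_smul_sub_mem hx hs.1 hs.2
  have hf : ContDiffOn ℝ ∞ (fun q : ℝ × E => α (m q) (q.2 - p)) (m ⁻¹' U) := by
    refine (hα.comp hmc.contDiffOn (fun _ h => h)).clm_apply ?_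
    fun_prop
  refine ⟨fun x => ∫ s in (0 : ℝ)..1, α (m (s, x)) (x - p), fun x hx => ?_⟩
  have h1 := hasFDerivAt_intervalIntegral_of_contDiffOn hU hO hsub (hf.of_le (by simp)) hx
  refine h1.congr_fderiv ?_
  have hαd : ∀ y ∈ U, HasFDerivAt α (fderiv ℝ α y) y := fun y hy =>
    ((hα.differentiableOn (by simp)).differentiableAt (hU.mem_nhds hy)).hasFDerivAt
  have hmd : ∀ s : ℝ, HasDerivAt (fun s => m (s, x)) (x - p) s := by
    intro s
    simpa [hm] using (((hasDerivAt_id s).smul_const (x - p)).const_add p)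
  -- Closedness enters here: it exchanges the two arguments of dα, which turns the x-derivative of
  -- the integrand into d/ds of s · α(p + s(x - p)). The integral then telescopes to α(x).
  have hline : ∀ s ∈ uIcc (0 : ℝ) 1, HasDerivAt (fun s => s • α (m (s, x)))
      ((fderiv ℝ (fun q : ℝ × E => α (m q) (q.2 - p)) (s, x)).comp
        (ContinuousLinearMap.inr ℝ ℝ E)) s := by
    intro s hs
    have hin := hsub s hs x hx
    have h2 : HasDerivAt (fun s => α (m (s, x))) (fderiv ℝ α (m (s, x)) (x - p)) s :=
      (hαd _ hin).comp_hasDerivAt s (hmd s)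
    have h3 := (hasDerivAt_id s).smul h2
    refine h3.congr_deriv ?_
    have hms : HasFDerivAt (fun y => m (s, y)) (s • ContinuousLinearMap.id ℝ E) x := by
      simpa [hm] using (((hasFDerivAt_id x).sub_const p).const_smul s).const_add p
    have h4 : HasFDerivAt (fun y => α (m (s, y)) (y - p)) _ x :=
      ((hαd _ hin).comp x hms).clm_apply ((hasFDerivAt_id x).sub_const p)
    have h5 : HasFDerivAt (fun q : ℝ × E => α (m q) (q.2 - p)) _ (s, x) :=
      ((hf.differentiableOn (by simp)).differentiableAt (hO.mem_nhds hin)).hasFDerivAt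
    have h6 := h5.comp x (hasFDerivAt_prodMk_right s x)
    have h7 := h6.unique h4
    rw [h7]
    ext v
    simp [hsymm _ hin v x, hsymm _ hin v p, add_comm]
  have hint : ContinuousOn (fun s : ℝ => (fderiv ℝ (fun q : ℝ × E => α (m q) (q.2 - p))
      (s, x)).comp (ContinuousLinearMap.inr ℝ ℝ E)) (uIcc (0 : ℝ) 1) := by
    refine ContinuousOn.clm_comp ?_ continuousOn_const
    exact (hf.continuousOn_fderiv_of_isOpen hO (by simp)).comp
      (Continuous.prodMk continuous_id continuous_const).continuousOn (fun s hs => hsub s hs x hx)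
  rw [intervalIntegral.integral_eq_sub_of_hasDerivAt hline hint.intervalIntegrable]
  simp [hm]

namespace DeSitter

/-! ### Calculus on the spacelike cone -/

theorem continuous_mink : Continuous fun x : Fin 4 → ℝ => mink x x := by
  unfold mink; fun_prop

theorem isOpen_spacelike : IsOpen spacelike := isOpen_lt continuous_const continuous_mink

theorem mink_smul (c : ℝ) (x : Fin 4 → ℝ) : mink (c • x) (c • x) = c ^ 2 * mink x x := by
  simp only [mink, Pi.smul_apply, smul_eq_mul, Finset.mul_sum]
  exact Finset.sum_congr rfl fun a _ => by ring

theorem smul_mem_spacelike {x : Fin 4 → ℝ} (hx : x ∈ spacelike) {c : ℝ} (hc : 0 < c) :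
    c • x ∈ spacelike := by
  show 0 < mink (c • x) (c • x)
  rw [mink_smul]
  exact mul_pos (pow_pos hc 2) hx

theorem mink_self (x : Fin 4 → ℝ) :
    mink x x = -x 0 ^ 2 + x 1 ^ 2 + x 2 ^ 2 + x 3 ^ 2 := by
  simp [mink, sgn, Fin.sum_univ_four]; ring

theorem mem_spacelike_of_mem {x : Fin 4 → ℝ} (hx : x ∈ dS3) : x ∈ spacelike := by
  show 0 < mink x x
  rw [show mink x x = 1 from hx]; exact one_pos

/-- Smoothness on the spacelike cone. -/
def ConeSmooth (f : (Fin 4 → ℝ) → ℝ) : Prop := ContDiffOn ℝ ∞ f spacelike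

/-- The partial derivative `∂_a f`. -/
noncomputable def D (a : Fin 4) (f : (Fin 4 → ℝ) → ℝ) (x : Fin 4 → ℝ) : ℝ :=
  fderiv ℝ f x (Pi.single a 1)

theorem fderiv_eq_sum_D (f : (Fin 4 → ℝ) → ℝ) (x v : Fin 4 → ℝ) :
    fderiv ℝ f x v = ∑ a, v a * D a f x := by
  conv_lhs => rw [pi_eq_sum_univ v]
  simp only [map_sum, map_smul, smul_eq_mul, D]
  refine Finset.sum_congr rfl fun a _ => ?_
  congr 2
  ext b
  simp [Pi.single_apply, eq_comm]

namespace ConeSmooth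

variable {f g : (Fin 4 → ℝ) → ℝ} {x : Fin 4 → ℝ}

theorem differentiableAt (hf : ConeSmooth f) (hx : x ∈ spacelike) : DifferentiableAt ℝ f x :=
  (ContDiffOn.differentiableOn hf (by simp)).differentiableAt (isOpen_spacelike.mem_nhds hx)

theorem contDiffAt (hf : ConeSmooth f) (hx : x ∈ spacelike) : ContDiffAt ℝ ∞ f x :=
  ContDiffOn.contDiffAt hf (isOpen_spacelike.mem_nhds hx)

theorem add (hf : ConeSmooth f) (hg : ConeSmooth g) : ConeSmooth fun y => f y + g y :=
  ContDiffOn.add hf hg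

theorem sub (hf : ConeSmooth f) (hg : ConeSmooth g) : ConeSmooth fun y => f y - g y :=
  ContDiffOn.sub hf hg

theorem mul (hf : ConeSmooth f) (hg : ConeSmooth g) : ConeSmooth fun y => f y * g y :=
  ContDiffOn.mul hf hg

theorem const (c : ℝ) : ConeSmooth fun _ => c := contDiffOn_const

theorem const_mul (c : ℝ) (hf : ConeSmooth f) : ConeSmooth fun y => c * f y :=
  (const c).mul hf

theorem coord (b : Fin 4) : ConeSmooth fun y => y b := by
  unfold ConeSmooth; fun_prop

theorem sum {ι : Type} {s : Finset ι} {F : ι → (Fin 4 → ℝ) → ℝ} (hF : ∀ i ∈ s, ConeSmooth (F i)) :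
    ConeSmooth fun y => ∑ i ∈ s, F i y := ContDiffOn.sum hF

theorem D (hf : ConeSmooth f) (a : Fin 4) : ConeSmooth (D a f) :=
  (ContDiffOn.fderiv_of_isOpen hf isOpen_spacelike (by simp)).clm_apply contDiffOn_const

theorem congr (hf : ConeSmooth f) (h : ∀ y ∈ spacelike, g y = f y) : ConeSmooth g :=
  ContDiffOn.congr hf h

end ConeSmooth

section Rules

variable {f g : (Fin 4 → ℝ) → ℝ} {x : Fin 4 → ℝ}

theorem D_add (hf : ConeSmooth f) (hg : ConeSmooth g) (hx : x ∈ spacelike) (a : Fin 4) :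
    D a (fun y => f y + g y) x = D a f x + D a g x := by
  simp [D, fderiv_fun_add (hf.differentiableAt hx) (hg.differentiableAt hx)]

theorem D_sub (hf : ConeSmooth f) (hg : ConeSmooth g) (hx : x ∈ spacelike) (a : Fin 4) :
    D a (fun y => f y - g y) x = D a f x - D a g x := by
  simp [D, fderiv_fun_sub (hf.differentiableAt hx) (hg.differentiableAt hx)]

theorem D_mul (hf : ConeSmooth f) (hg : ConeSmooth g) (hx : x ∈ spacelike) (a : Fin 4) :
    D a (fun y => f y * g y) x = D a f x * g x + f x * D a g x := by
  simp [D, fderiv_fun_mul (hf.differentiableAt hx) (hg.differentiableAt hx)]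
  ring

theorem D_const (c : ℝ) (a : Fin 4) : D a (fun _ => c) x = 0 := by simp [D]

theorem D_const_mul (c : ℝ) (hf : ConeSmooth f) (hx : x ∈ spacelike) (a : Fin 4) :
    D a (fun y => c * f y) x = c * D a f x := by
  rw [D_mul (ConeSmooth.const c) hf hx, D_const]; ring

theorem D_coord (a b : Fin 4) : D a (fun y => y b) x = if a = b then 1 else 0 := by
  have : fderiv ℝ (fun y : Fin 4 → ℝ => y b) x = ContinuousLinearMap.proj b :=
    (ContinuousLinearMap.proj (R := ℝ) (φ := fun _ : Fin 4 => ℝ) b).fderiv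
  simp [D, this, Pi.single_apply, eq_comm]

theorem D_coord_mul (hf : ConeSmooth f) (hx : x ∈ spacelike) (a b : Fin 4) :
    D a (fun y => y b * f y) x = (if a = b then f x else 0) + x b * D a f x := by
  rw [D_mul (ConeSmooth.coord b) hf hx, D_coord]
  split_ifs <;> simp

theorem D_sum {ι : Type} {s : Finset ι} {F : ι → (Fin 4 → ℝ) → ℝ}
    (hF : ∀ i ∈ s, ConeSmooth (F i)) (hx : x ∈ spacelike) (a : Fin 4) :
    D a (fun y => ∑ i ∈ s, F i y) x = ∑ i ∈ s, D a (F i) x := by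
  simp [D, fderiv_fun_sum fun i hi => (hF i hi).differentiableAt hx]

theorem D_congr (h : ∀ y ∈ spacelike, f y = g y) (hx : x ∈ spacelike) (a : Fin 4) :
    D a f x = D a g x := by
  unfold D
  rw [Filter.EventuallyEq.fderiv_eq]
  filter_upwards [isOpen_spacelike.mem_nhds hx] with y hy using h y hy

theorem D_comm (hf : ConeSmooth f) (hx : x ∈ spacelike) (a b : Fin 4) :
    D a (D b f) x = D b (D a f) x := by
  have hd : DifferentiableAt ℝ (fderiv ℝ f) x :=
    ((ContDiffOn.fderiv_of_isOpen hf isOpen_spacelike (m := ∞) (by simp)).differentiableOn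
      (by simp)).differentiableAt (isOpen_spacelike.mem_nhds hx)
  have h : ∀ a b, D a (D b f) x = fderiv ℝ (fderiv ℝ f) x (Pi.single a 1) (Pi.single b 1) := by
    intro a b
    show fderiv ℝ (fun y => fderiv ℝ f y (Pi.single b 1)) x (Pi.single a 1) = _
    rw [fderiv_clm_apply hd (differentiableAt_const _)]
    simp
  rw [h, h]
  exact ((hf.contDiffAt hx).isSymmSndFDerivAt (by
    simpa using WithTop.coe_le_coe.2 (le_top : (2 : ℕ∞) ≤ ⊤))) _ _

end Rules

/-- Homogeneity of degree `k` on the spacelike cone. -/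
def HomDeg (k : ℤ) (f : (Fin 4 → ℝ) → ℝ) : Prop :=
  ∀ x ∈ spacelike, ∀ c : ℝ, 0 < c → f (c • x) = c ^ k * f x

theorem HomDeg.euler {k : ℤ} {f : (Fin 4 → ℝ) → ℝ} (h : HomDeg k f) (hf : ConeSmooth f)
    {x : Fin 4 → ℝ} (hx : x ∈ spacelike) : ∑ a, x a * D a f x = k * f x := by
  rw [← fderiv_eq_sum_D]
  have h1 : HasDerivAt (fun c : ℝ => f (c • x)) (fderiv ℝ f x x) 1 := by
    have h2 : HasFDerivAt f (fderiv ℝ f x) ((1 : ℝ) • x) := by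
      rw [one_smul]; exact (hf.differentiableAt hx).hasFDerivAt
    have h3 : HasDerivAt (fun c : ℝ => c • x) x 1 := by
      simpa using (hasDerivAt_id (1 : ℝ)).smul_const x
    exact h2.comp_hasDerivAt 1 h3
  have h2 : HasDerivAt (fun c : ℝ => c ^ k * f x) (k * f x) 1 := by
    simpa using (hasDerivAt_zpow k (1 : ℝ) (Or.inl one_ne_zero)).mul_const (f x)
  refine h1.unique (h2.congr_of_eventuallyEq ?_)
  filter_upwards [lt_mem_nhds (one_pos : (0 : ℝ) < 1)] with c hc using h x hx c hc

theorem HomDeg.D {k : ℤ} {f : (Fin 4 → ℝ) → ℝ} (h : HomDeg k f) (hf : ConeSmooth f) (a : Fin 4) :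
    HomDeg (k - 1) (D a f) := by
  intro x hx c hc
  have h1 : HasFDerivAt (fun y => f (c • y)) (c • fderiv ℝ f (c • x)) x := by
    have h2 := (hf.differentiableAt (smul_mem_spacelike hx hc)).hasFDerivAt
    have h3 : HasFDerivAt (fun y : Fin 4 → ℝ => c • y) (c • ContinuousLinearMap.id ℝ _) x :=
      (hasFDerivAt_id x).const_smul c
    have h4 := h2.comp x h3
    refine h4.congr_fderiv ?_
    ext v; simp
  have h2 : HasFDerivAt (fun y => c ^ k * f y) (c ^ k • fderiv ℝ f x) x :=
    (hf.differentiableAt hx).hasFDerivAt.const_mul _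
  have h3 := h1.unique (h2.congr_of_eventuallyEq (by
    filter_upwards [isOpen_spacelike.mem_nhds hx] with y hy using h y hy c hc))
  have h4 := congrArg (fun l => l (Pi.single a 1)) h3
  simp only [smul_apply, smul_eq_mul] at h4
  show fderiv ℝ f (c • x) (Pi.single a 1) = c ^ (k - 1) * fderiv ℝ f x (Pi.single a 1)
  rw [zpow_sub₀ hc.ne', zpow_one]
  field_simp
  linarith

theorem HomDeg.mul {k l : ℤ} {f g : (Fin 4 → ℝ) → ℝ} (hf : HomDeg k f) (hg : HomDeg l g) :
    HomDeg (k + l) fun y => f y * g y := by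
  intro x hx c hc
  simp only [hf x hx c hc, hg x hx c hc, zpow_add₀ hc.ne']
  ring

theorem HomDeg.sub {k : ℤ} {f g : (Fin 4 → ℝ) → ℝ} (hf : HomDeg k f) (hg : HomDeg k g) :
    HomDeg k fun y => f y - g y := by
  intro x hx c hc
  simp only [hf x hx c hc, hg x hx c hc]
  ring

theorem HomDeg.sum {ι : Type} {s : Finset ι} {k : ℤ} {F : ι → (Fin 4 → ℝ) → ℝ}
    (hF : ∀ i ∈ s, HomDeg k (F i)) : HomDeg k fun y => ∑ i ∈ s, F i y := by
  intro x hx c hc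
  rw [Finset.mul_sum]
  exact Finset.sum_congr rfl fun i hi => hF i hi x hx c hc

theorem HomDeg.add {k : ℤ} {f g : (Fin 4 → ℝ) → ℝ} (hf : HomDeg k f) (hg : HomDeg k g) :
    HomDeg k fun y => f y + g y := by
  intro x hx c hc
  simp only [hf x hx c hc, hg x hx c hc]
  ring

theorem HomDeg.const_mul {k : ℤ} {f : (Fin 4 → ℝ) → ℝ} (a : ℝ) (hf : HomDeg k f) :
    HomDeg k fun y => a * f y := by
  intro x hx c hc
  simp only [hf x hx c hc]
  ring

theorem HomDeg.coord (b : Fin 4) : HomDeg 1 fun y => y b := by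
  intro x _ c _
  simp

/-- The radial function `√(x·x)`. -/
noncomputable def rad (x : Fin 4 → ℝ) : ℝ := Real.sqrt (mink x x)

theorem rad_pos {x : Fin 4 → ℝ} (hx : x ∈ spacelike) : 0 < rad x := Real.sqrt_pos.mpr hx

theorem rad_sq {x : Fin 4 → ℝ} (hx : x ∈ spacelike) : rad x ^ 2 = mink x x :=
  Real.sq_sqrt (le_of_lt hx)

theorem rad_eq_one {x : Fin 4 → ℝ} (hx : x ∈ dS3) : rad x = 1 := by
  simp [rad, show mink x x = 1 from hx]

theorem rad_smul {c : ℝ} (hc : 0 < c) (x : Fin 4 → ℝ) : rad (c • x) = c * rad x := by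
  rw [rad, mink_smul, Real.sqrt_mul (sq_nonneg c), Real.sqrt_sq hc.le, rad]

theorem contDiff_mink : ContDiff ℝ ∞ fun x : Fin 4 → ℝ => mink x x := by
  unfold mink; fun_prop

theorem coneSmooth_rad : ConeSmooth rad :=
  ContDiffOn.sqrt contDiff_mink.contDiffOn (fun _ hx => ne_of_gt hx)

theorem coneSmooth_rad_inv : ConeSmooth fun y => (rad y)⁻¹ :=
  ContDiffOn.inv coneSmooth_rad fun _ hx => (rad_pos hx).ne'

theorem homDeg_rad : HomDeg 1 rad := fun x _ c hc => by rw [rad_smul hc, zpow_one]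

theorem homDeg_rad_inv : HomDeg (-1) fun y => (rad y)⁻¹ := fun x _ c hc => by
  show (rad (c • x))⁻¹ = _
  rw [rad_smul hc, mul_inv, zpow_neg_one]

theorem D_mink (a : Fin 4) {x : Fin 4 → ℝ} (hx : x ∈ spacelike) :
    D a (fun y => mink y y) x = 2 * (sgn a * x a) := by
  unfold mink
  have h : ∀ b : Fin 4, ConeSmooth fun y => sgn b * y b * y b := fun b =>
    ((ConeSmooth.coord b).const_mul (sgn b)).mul (ConeSmooth.coord b)
  rw [D_sum (fun b _ => h b) hx]
  have : ∀ b : Fin 4, D a (fun y => sgn b * y b * y b) x =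
      if a = b then 2 * (sgn a * x a) else 0 := by
    intro b
    rw [D_mul ((ConeSmooth.coord b).const_mul (sgn b)) (ConeSmooth.coord b) hx,
      D_const_mul _ (ConeSmooth.coord b) hx, D_coord]
    split_ifs with hab
    · subst hab; ring
    · ring
  simp [this]

theorem D_rad (a : Fin 4) {x : Fin 4 → ℝ} (hx : x ∈ spacelike) :
    D a rad x = sgn a * x a * (rad x)⁻¹ := by
  have h := D_congr (f := fun y => rad y * rad y) (g := fun y => mink y y)
    (fun y hy => by rw [← rad_sq hy, sq]) hx a
  rw [D_mul coneSmooth_rad coneSmooth_rad hx, D_mink a hx] at h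
  have := (rad_pos hx).ne'
  field_simp
  linarith

theorem D_rad_inv (a : Fin 4) {x : Fin 4 → ℝ} (hx : x ∈ spacelike) :
    D a (fun y => (rad y)⁻¹) x = -(sgn a * x a) * (rad x)⁻¹ ^ 3 := by
  have h := D_congr (f := fun y => rad y * (rad y)⁻¹) (g := fun _ => 1)
    (fun y hy => mul_inv_cancel₀ (rad_pos hy).ne') hx a
  rw [D_mul coneSmooth_rad coneSmooth_rad_inv hx, D_const, D_rad a hx] at h
  have := (rad_pos hx).ne'
  field_simp at h ⊢
  linarith

/-! ### Fields on the hyperboloid and homogeneous fields on the cone -/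

theorem radialExt_apply {F : Type*} [Zero F] (f : dS3 → F) {x : Fin 4 → ℝ} (hx : x ∈ spacelike) :
    radialExt f x = f ⟨(rad x)⁻¹ • x, normalize_mem hx⟩ := dif_pos hx

theorem radialExt_of_mem {F : Type*} [Zero F] (f : dS3 → F) (x : dS3) :
    radialExt f x.1 = f x := by
  rw [radialExt_apply f (mem_spacelike_of_mem x.2)]
  congr 1
  ext a
  simp [rad_eq_one x.2]

theorem homDeg_radialExt (f : dS3 → ℝ) : HomDeg 0 (radialExt f) := by
  intro x hx c hc
  rw [radialExt_apply f hx, radialExt_apply f (smul_mem_spacelike hx hc), zpow_zero, one_mul]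
  congr 2
  rw [rad_smul hc, smul_smul]
  congr 1
  have := (rad_pos hx).ne'
  field_simp

theorem radialExt_restrict (g : (Fin 4 → ℝ) → ℝ) {x : Fin 4 → ℝ} (hx : x ∈ spacelike) :
    radialExt (fun y : dS3 => g y.1) x = g ((rad x)⁻¹ • x) := radialExt_apply _ hx

theorem contDiffOn_normalize : ContDiffOn ℝ ∞ (fun x => (rad x)⁻¹ • x) spacelike :=
  ContDiffOn.smul coneSmooth_rad_inv contDiffOn_id

theorem smooth_restrict {g : (Fin 4 → ℝ) → ℝ} (hg : ConeSmooth g) :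
    ConeSmooth (radialExt fun y : dS3 => g y.1) :=
  ConeSmooth.congr (f := fun x => g ((rad x)⁻¹ • x))
    (ContDiffOn.comp hg contDiffOn_normalize
      fun _ hx => mem_spacelike_of_mem (normalize_mem hx))
    fun _ hx => radialExt_restrict g hx

theorem smooth_tensor_iff (T : dS3 → Fin 4 → Fin 4 → ℝ) :
    Smooth T ↔ ∀ a b, ConeSmooth (radialExt fun y => T y a b) := by
  have h : ∀ a b x, radialExt T x a b = radialExt (fun y => T y a b) x := by
    intro a b x
    unfold radialExt
    split_ifs <;> rfl
  unfold Smooth ConeSmooth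
  rw [contDiffOn_pi]
  refine forall_congr' fun a => ?_
  rw [contDiffOn_pi]
  simp only [h]

theorem sum_proj (x : dS3) (a : Fin 4) (Y : Fin 4 → ℝ) :
    ∑ a', proj x a a' * Y a' = Y a - sgn a * x.1 a * ∑ c, x.1 c * Y c := by
  simp only [proj, sub_mul, Finset.sum_sub_distrib, ite_mul, one_mul, zero_mul,
    Finset.sum_ite_eq, Finset.mem_univ, if_true, Finset.mul_sum, mul_assoc]

theorem sgn_mul_self (a : Fin 4) : sgn a * sgn a = 1 := by
  unfold sgn; split_ifs <;> norm_num

theorem sum_sgn_sq (x : dS3) : ∑ c, x.1 c * (sgn c * x.1 c) = 1 := by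
  have h : mink x.1 x.1 = 1 := x.2
  rw [← h, mink]
  exact Finset.sum_congr rfl fun c _ => by ring

theorem sum_sgn_sq_mul (x : dS3) (k : ℝ) : ∑ c, x.1 c * (sgn c * x.1 c * k) = k := by
  conv_rhs => rw [← one_mul k, ← sum_sgn_sq x, Finset.sum_mul]
  exact Finset.sum_congr rfl fun c _ => by ring

/-- The degree-zero extension is g composed with x ↦ x / √(x·x), whose differential at a point of
the hyperboloid is the projection along x. -/
theorem pd_restrict {g : (Fin 4 → ℝ) → ℝ} (hg : ConeSmooth g) (x : dS3) (a : Fin 4) :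
    pd (fun y => g y.1) x a = D a g x.1 - sgn a * x.1 a * ∑ c, x.1 c * D c g x.1 := by
  have hx := mem_spacelike_of_mem x.2
  have hr : HasFDerivAt (fun y => (rad y)⁻¹) (fderiv ℝ (fun y => (rad y)⁻¹) x.1) x.1 :=
    (coneSmooth_rad_inv.differentiableAt hx).hasFDerivAt
  have hN : HasFDerivAt (fun y => (rad y)⁻¹ • y) _ x.1 := hr.smul (hasFDerivAt_id x.1)
  have hg' : HasFDerivAt g (fderiv ℝ g x.1) ((rad x.1)⁻¹ • x.1) := by
    simpa [rad_eq_one x.2] using (hg.differentiableAt hx).hasFDerivAt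
  have h := HasFDerivAt.comp (g := g) (f := fun y => (rad y)⁻¹ • y) x.1 hg' hN
  have h' : HasFDerivAt (radialExt fun y : dS3 => g y.1) _ x.1 :=
    h.congr_of_eventuallyEq (by
      filter_upwards [isOpen_spacelike.mem_nhds hx] with y hy using radialExt_restrict g hy)
  have hD : fderiv ℝ (fun y => (rad y)⁻¹) x.1 (Pi.single a 1) = -(sgn a * x.1 a) := by
    have := D_rad_inv a hx
    rw [rad_eq_one x.2] at this
    simpa [D] using this
  rw [pd, h'.fderiv, ← fderiv_eq_sum_D]
  simp [rad_eq_one x.2, hD, D]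
  ring

/-- `ε_a^{cd} X_cd` at a point of the hyperboloid. -/
noncomputable def hodge (x : dS3) (a : Fin 4) (X : Fin 4 → Fin 4 → ℝ) : ℝ :=
  ∑ c, ∑ d, vol x a c d * sgn c * sgn d * X c d

/-- Only the antisymmetric part of `X` enters. The explicit components reduce later identities for
the curl to polynomial ones. -/
theorem hodge_eq (x : dS3) (a : Fin 4) (X : Fin 4 → Fin 4 → ℝ) :
    hodge x a X = ![
      x.1 1 * (X 2 3 - X 3 2) + x.1 2 * (X 3 1 - X 1 3) + x.1 3 * (X 1 2 - X 2 1),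
      x.1 3 * (X 0 2 - X 2 0) - x.1 2 * (X 0 3 - X 3 0) - x.1 0 * (X 2 3 - X 3 2),
      x.1 1 * (X 0 3 - X 3 0) - x.1 3 * (X 0 1 - X 1 0) - x.1 0 * (X 3 1 - X 1 3),
      x.1 2 * (X 0 1 - X 1 0) - x.1 1 * (X 0 2 - X 2 0) - x.1 0 * (X 1 2 - X 2 1)] a := by
  have hd : ∀ M : Matrix (Fin 4) (Fin 4) ℝ, M.det =
      M 0 0 * (M 1 1 * (M 2 2 * M 3 3 - M 2 3 * M 3 2) - M 1 2 * (M 2 1 * M 3 3 - M 2 3 * M 3 1)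
        + M 1 3 * (M 2 1 * M 3 2 - M 2 2 * M 3 1))
      - M 0 1 * (M 1 0 * (M 2 2 * M 3 3 - M 2 3 * M 3 2) - M 1 2 * (M 2 0 * M 3 3 - M 2 3 * M 3 0)
        + M 1 3 * (M 2 0 * M 3 2 - M 2 2 * M 3 0))
      + M 0 2 * (M 1 0 * (M 2 1 * M 3 3 - M 2 3 * M 3 1) - M 1 1 * (M 2 0 * M 3 3 - M 2 3 * M 3 0)
        + M 1 3 * (M 2 0 * M 3 1 - M 2 1 * M 3 0))
      - M 0 3 * (M 1 0 * (M 2 1 * M 3 2 - M 2 2 * M 3 1) - M 1 1 * (M 2 0 * M 3 2 - M 2 2 * M 3 0)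
        + M 1 2 * (M 2 0 * M 3 1 - M 2 1 * M 3 0)) := by
    intro M
    rw [Matrix.det_succ_row_zero]
    simp [Matrix.det_fin_three, Fin.sum_univ_succ, Fin.succAbove]
    ring
  unfold hodge vol
  simp only [hd]
  fin_cases a <;> simp [Fin.sum_univ_four, sgn] <;> ring

/-- A symmetric tangential tensor field on the hyperboloid, extended to the cone with
homogeneity `-1`. -/
structure ConeTensor (S : Fin 4 → Fin 4 → (Fin 4 → ℝ) → ℝ) : Prop where
  smooth : ∀ a b, ConeSmooth (S a b)
  hom : ∀ a b, HomDeg (-1) (S a b)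
  tangent : ∀ x ∈ spacelike, ∀ a, ∑ b, x b * S a b x = 0
  symm : ∀ x ∈ spacelike, ∀ a b, S a b x = S b a x

/-- The restriction of a field on the cone to the hyperboloid. -/
def restrict (S : Fin 4 → Fin 4 → (Fin 4 → ℝ) → ℝ) (x : dS3) (a b : Fin 4) : ℝ := S a b x.1

namespace ConeTensor

variable {S : Fin 4 → Fin 4 → (Fin 4 → ℝ) → ℝ}

theorem euler (h : ConeTensor S) {x : Fin 4 → ℝ} (hx : x ∈ spacelike) (a b : Fin 4) :
    ∑ c, x c * D c (S a b) x = -S a b x := by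
  rw [(h.hom a b).euler (h.smooth a b) hx]; simp

theorem tangent_D (h : ConeTensor S) {x : Fin 4 → ℝ} (hx : x ∈ spacelike) (c a : Fin 4) :
    ∑ b, x b * D c (S a b) x = -S a c x := by
  have h1 := D_congr (f := fun y => ∑ b, y b * S a b y) (g := fun _ => 0)
    (fun y hy => h.tangent y hy a) hx c
  rw [D_const, D_sum (fun b _ => (ConeSmooth.coord b).mul (h.smooth a b)) hx] at h1
  simp only [D_coord_mul (h.smooth a _) hx, Finset.sum_add_distrib, Finset.sum_ite_eq,
    Finset.mem_univ, if_true] at h1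
  linarith

theorem symm_D (h : ConeTensor S) {x : Fin 4 → ℝ} (hx : x ∈ spacelike) (c a b : Fin 4) :
    D c (S a b) x = D c (S b a) x :=
  D_congr (fun y hy => h.symm y hy a b) hx c

/-- The radial contractions produced by the three projectors are evaluated by Euler's relation in
degree -1 and by the differentiated tangency condition; only corrections linear in x survive. -/
theorem covDeriv₂_restrict (h : ConeTensor S) (x : dS3) (a b c : Fin 4) :
    covDeriv₂ (restrict S) x a b c = D a (S b c) x.1 + sgn a * x.1 a * S b c x.1
      + sgn b * x.1 b * S a c x.1 + sgn c * x.1 c * S b a x.1 := by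
  have hx := mem_spacelike_of_mem x.2
  have hpd : ∀ a b c, pd (fun y => restrict S y b c) x a
      = D a (S b c) x.1 + sgn a * x.1 a * S b c x.1 := by
    intro a b c
    show pd (fun y => S b c y.1) x a = _
    rw [pd_restrict (h.smooth b c), h.euler hx]
    ring
  have e : covDeriv₂ (restrict S) x a b c = ∑ a', proj x a a' * ∑ b', proj x b b' *
      ∑ c', proj x c c' * pd (fun y => restrict S y b' c') x a' := by
    simp only [covDeriv₂, Finset.mul_sum, mul_assoc]
  have ht : ∀ d, ∑ e, x.1 e * S e d x.1 = 0 := by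
    intro d
    rw [← h.tangent x.1 hx d]
    exact Finset.sum_congr rfl fun e _ => by rw [h.symm x.1 hx e d]
  have h1 : ∀ a' b', ∑ c', proj x c c' * pd (fun y => restrict S y b' c') x a' =
      D a' (S b' c) x.1 + sgn a' * x.1 a' * S b' c x.1 + sgn c * x.1 c * S b' a' x.1 := by
    intro a' b'
    rw [sum_proj]
    simp only [hpd, mul_add, Finset.sum_add_distrib, h.tangent_D hx]
    have : ∑ d, x.1 d * (sgn a' * x.1 a' * S b' d x.1)
        = sgn a' * x.1 a' * ∑ d, x.1 d * S b' d x.1 := by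
      rw [Finset.mul_sum]; exact Finset.sum_congr rfl fun d _ => by ring
    rw [this, h.tangent x.1 hx]
    ring
  have h2 : ∀ a', ∑ b', proj x b b' *
      (D a' (S b' c) x.1 + sgn a' * x.1 a' * S b' c x.1 + sgn c * x.1 c * S b' a' x.1) =
      D a' (S b c) x.1 + sgn a' * x.1 a' * S b c x.1 + sgn c * x.1 c * S b a' x.1
        + sgn b * x.1 b * S a' c x.1 := by
    intro a'
    rw [sum_proj]
    simp only [mul_add, Finset.sum_add_distrib]
    have t1 : ∑ d, x.1 d * D a' (S d c) x.1 = - S a' c x.1 := by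
      rw [h.symm x.1 hx a' c, ← h.tangent_D hx]
      exact Finset.sum_congr rfl fun d _ => by rw [h.symm_D hx]
    have t2 : ∑ d, x.1 d * (sgn a' * x.1 a' * S d c x.1)
        = sgn a' * x.1 a' * ∑ d, x.1 d * S d c x.1 := by
      rw [Finset.mul_sum]; exact Finset.sum_congr rfl fun d _ => by ring
    have t3 : ∑ d, x.1 d * (sgn c * x.1 c * S d a' x.1)
        = sgn c * x.1 c * ∑ d, x.1 d * S d a' x.1 := by
      rw [Finset.mul_sum]; exact Finset.sum_congr rfl fun d _ => by ring
    rw [t1, t2, t3, ht, ht]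
    ring
  rw [e]
  simp only [h1, h2]
  rw [sum_proj]
  simp only [mul_add, Finset.sum_add_distrib, h.euler hx]
  have t1 : ∑ d, x.1 d * (sgn d * x.1 d * S b c x.1) = S b c x.1 := by
    exact sum_sgn_sq_mul x _
  have t2 : ∑ d, x.1 d * (sgn c * x.1 c * S b d x.1)
      = sgn c * x.1 c * ∑ d, x.1 d * S b d x.1 := by
    rw [Finset.mul_sum]; exact Finset.sum_congr rfl fun d _ => by ring
  have t3 : ∑ d, x.1 d * (sgn b * x.1 b * S d c x.1)
      = sgn b * x.1 b * ∑ d, x.1 d * S d c x.1 := by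
    rw [Finset.mul_sum]; exact Finset.sum_congr rfl fun d _ => by ring
  rw [t1, t2, t3, ht, h.tangent x.1 hx]
  ring

/-- The corrections in the covariant derivative drop out: ε contracted with x vanishes, and the
remaining one contracts ε with a symmetric tensor. -/
theorem curl_restrict (h : ConeTensor S) (x : dS3) (a b : Fin 4) :
    curl (restrict S) x a b = hodge x a fun c d => D c (S d b) x.1 := by
  have hx := mem_spacelike_of_mem x.2
  show hodge x a (fun c d => covDeriv₂ (restrict S) x c d b) = _
  simp only [h.covDeriv₂_restrict]
  rw [hodge_eq, hodge_eq]
  have s := h.symm x.1 hx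
  fin_cases a <;> simp [sgn, s 1 0, s 2 0, s 3 0, s 2 1, s 3 1, s 3 2] <;> ring

theorem div_restrict (h : ConeTensor S) (x : dS3) (a : Fin 4) :
    div (restrict S) x a = ∑ b, sgn b * D b (S a b) x.1
      + sgn a * x.1 a * ∑ b, sgn b * S b b x.1 := by
  have hx := mem_spacelike_of_mem x.2
  have t := h.tangent x.1 hx a
  unfold div
  have e : ∀ b, sgn b * covDeriv₂ (restrict S) x b a b = sgn b * D b (S a b) x.1
      + sgn a * x.1 a * (sgn b * S b b x.1) + 2 * (x.1 b * S a b x.1) := by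
    intro b
    rw [h.covDeriv₂_restrict]
    linear_combination 2 * x.1 b * S a b x.1 * sgn_mul_self b
  simp only [e, Finset.sum_add_distrib, ← Finset.mul_sum, t]
  ring

theorem isSDT_restrict (h : ConeTensor S) (htr : ∀ x : dS3, ∑ b, sgn b * S b b x.1 = 0)
    (hdiv : ∀ x : dS3, ∀ a, ∑ b, sgn b * D b (S a b) x.1 = 0) : IsSDT (restrict S) where
  smooth := (smooth_tensor_iff _).2 fun a b => smooth_restrict (h.smooth a b)
  tangent x a := by
    rw [← h.tangent x.1 (mem_spacelike_of_mem x.2) a]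
    exact Finset.sum_congr rfl fun b _ => mul_comm _ _
  symm x a b := h.symm x.1 (mem_spacelike_of_mem x.2) a b
  traceless x := htr x
  divFree x a := by rw [h.div_restrict, hdiv, htr]; simp

end ConeTensor

/-- The homogeneous extension to the cone of a tensor field on the hyperboloid. -/
noncomputable def lift (T : dS3 → Fin 4 → Fin 4 → ℝ) (a b : Fin 4) (x : Fin 4 → ℝ) : ℝ :=
  (rad x)⁻¹ * radialExt (fun y => T y a b) x

theorem restrict_lift (T : dS3 → Fin 4 → Fin 4 → ℝ) : restrict (lift T) = T := by
  funext x a b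
  simp [restrict, lift, radialExt_of_mem, rad_eq_one x.2]

theorem coneTensor_lift {T : dS3 → Fin 4 → Fin 4 → ℝ} (hT : Smooth T)
    (ht : ∀ x : dS3, ∀ a, ∑ b, T x a b * x.1 b = 0) (hs : ∀ x a b, T x a b = T x b a) :
    ConeTensor (lift T) where
  smooth a b := coneSmooth_rad_inv.mul ((smooth_tensor_iff T).1 hT a b)
  hom a b := by
    have : HomDeg (-1 + 0) (lift T a b) :=
      homDeg_rad_inv.mul (homDeg_radialExt fun y => T y a b)
    simpa using this
  tangent x hx a := by
    rw [← ht ⟨(rad x)⁻¹ • x, normalize_mem hx⟩ a]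
    refine Finset.sum_congr rfl fun b _ => ?_
    rw [lift, radialExt_apply _ hx]
    simp only [Pi.smul_apply, smul_eq_mul]
    ring
  symm x hx a b := by
    simp only [lift, radialExt_apply _ hx, hs _ a b]

/-! ### Scalar potentials -/

variable {F : (Fin 4 → ℝ) → ℝ}

/-- Tangency is Euler's relation for the first derivatives, which have degree zero. -/
theorem coneTensor_hessian (hF : ConeSmooth F) (h1 : HomDeg 1 F) :
    ConeTensor fun a b => D a (D b F) where
  smooth a b := (hF.D b).D a
  hom a b := by simpa using (h1.D hF b).D (hF.D b) a
  tangent x hx a := by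
    have h := (h1.D hF a).euler (hF.D a) hx
    simp only [sub_self, Int.cast_zero, zero_mul] at h
    rw [← h]
    exact Finset.sum_congr rfl fun b _ => by rw [D_comm hF hx]
  symm x hx a b := D_comm hF hx a b

/-- Degree one is singled out twice: it makes the flat Hessian annihilate x, and it makes the radial
derivative in the Gauss formula contribute exactly h_ab F. -/
theorem scalarTensor_restrict (hF : ConeSmooth F) (h1 : HomDeg 1 F) :
    scalarTensor (fun x => F x.1) = restrict fun a b => D a (D b F) := by
  funext x a b
  have hx := mem_spacelike_of_mem x.2
  have hH := coneTensor_hessian hF h1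
  have hpd : ∀ (y : dS3) b, pd (fun x => F x.1) y b = D b F y.1 - sgn b * (y.1 b * F y.1) := by
    intro y b
    rw [pd_restrict hF, h1.euler hF (mem_spacelike_of_mem y.2)]
    push_cast; ring
  have hgrad : ∀ b, (fun y => grad (fun x => F x.1) y b)
      = fun y : dS3 => (fun z => D b F z - sgn b * (z b * F z)) y.1 := by
    intro b
    funext y
    rw [grad, sum_proj]
    simp only [hpd, mul_sub, Finset.sum_sub_distrib]
    have := h1.euler hF (mem_spacelike_of_mem y.2)
    rw [this]
    have t : ∑ c, y.1 c * (sgn c * (y.1 c * F y.1)) = F y.1 := by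
      simpa only [mul_assoc] using sum_sgn_sq_mul y (F y.1)
    rw [t]
    push_cast; ring
  have hGs : ∀ b, ConeSmooth fun z => D b F z - sgn b * (z b * F z) := fun b =>
    (hF.D b).sub (((ConeSmooth.coord b).mul hF).const_mul _)
  have hDG : ∀ a b, D a (fun z => D b F z - sgn b * (z b * F z)) x.1
      = D a (D b F) x.1 - (if a = b then sgn b * F x.1 else 0) - sgn b * x.1 b * D a F x.1 := by
    intro a b
    rw [D_sub (hF.D b) (((ConeSmooth.coord b).mul hF).const_mul _) hx,
      D_const_mul _ ((ConeSmooth.coord b).mul hF) hx, D_coord_mul hF hx]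
    split_ifs <;> ring
  have e : hess (fun x => F x.1) x a b = ∑ a', proj x a a' * ∑ b', proj x b b' *
      pd (fun y => grad (fun x => F x.1) y b') x a' := by
    simp only [hess, covDeriv₁, Finset.mul_sum, mul_assoc]
  have tan := hH.tangent x.1 hx
  have hE := h1.euler hF hx
  have p2 : ∀ a' b', pd (fun y => grad (fun x => F x.1) y b') x a'
      = D a' (D b' F) x.1 - (if a' = b' then sgn b' * F x.1 else 0) - sgn b' * x.1 b' * D a' F x.1
        + sgn a' * x.1 a' * (2 * (sgn b' * x.1 b' * F x.1)) := by
    intro a' b'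
    rw [hgrad, pd_restrict (hGs b')]
    simp only [hDG, mul_sub, Finset.sum_sub_distrib]
    have t1 : ∑ c, x.1 c * D c (D b' F) x.1 = 0 := by
      rw [← tan b']
      exact Finset.sum_congr rfl fun b _ => by rw [D_comm hF hx]
    have t2 : ∑ c, x.1 c * (if c = b' then sgn b' * F x.1 else 0) = sgn b' * x.1 b' * F x.1 := by
      simp; ring
    have t3 : ∑ c, x.1 c * (sgn b' * x.1 b' * D c F x.1) = sgn b' * x.1 b' * F x.1 := by
      have : ∑ c, x.1 c * (sgn b' * x.1 b' * D c F x.1)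
          = sgn b' * x.1 b' * ∑ c, x.1 c * D c F x.1 := by
        rw [Finset.mul_sum]; exact Finset.sum_congr rfl fun d _ => by ring
      rw [this, hE]; push_cast; ring
    rw [t1, t2, t3]
    ring
  have p3 : ∀ a', ∑ b', proj x b b' * pd (fun y => grad (fun x => F x.1) y b') x a' =
      D a' (D b F) x.1 - (if a' = b then sgn b * F x.1 else 0)
        + sgn b * x.1 b * (x.1 a' * sgn a' * F x.1) := by
    intro a'
    rw [sum_proj]
    simp only [p2, mul_sub, mul_add, Finset.sum_sub_distrib, Finset.sum_add_distrib]
    have t2 : ∑ c, x.1 c * (if a' = c then sgn c * F x.1 else 0) = x.1 a' * sgn a' * F x.1 := by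
      simp [mul_assoc]
    have t3 : ∑ c, x.1 c * (sgn c * x.1 c * D a' F x.1) = D a' F x.1 := by
      exact sum_sgn_sq_mul x _
    have t4 : ∑ c, x.1 c * (sgn a' * x.1 a' * (2 * (sgn c * x.1 c * F x.1)))
        = sgn a' * x.1 a' * (2 * F x.1) := by
      have : ∑ c, x.1 c * (sgn a' * x.1 a' * (2 * (sgn c * x.1 c * F x.1)))
          = sgn a' * x.1 a' * (2 * ∑ c, x.1 c * (sgn c * x.1 c * F x.1)) := by
        simp only [Finset.mul_sum]; exact Finset.sum_congr rfl fun d _ => by ring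
      rw [this, sum_sgn_sq_mul]
    rw [t2, t3, t4, tan a']
    ring
  show hess (fun x => F x.1) x a b + metric x a b * F x.1 = D a (D b F) x.1
  rw [e]
  simp only [p3]
  rw [sum_proj]
  simp only [mul_sub, mul_add, Finset.sum_sub_distrib, Finset.sum_add_distrib]
  have t1 : ∑ c, x.1 c * D c (D b F) x.1 = 0 := by
    rw [← tan b]
    exact Finset.sum_congr rfl fun d _ => by rw [D_comm hF hx]
  have t2 : ∑ c, x.1 c * (if c = b then sgn b * F x.1 else 0) = sgn b * x.1 b * F x.1 := by
    simp; ring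
  have t3 : ∑ c, x.1 c * (sgn b * x.1 b * (x.1 c * sgn c * F x.1)) = sgn b * x.1 b * F x.1 := by
    have : ∑ c, x.1 c * (sgn b * x.1 b * (x.1 c * sgn c * F x.1))
        = sgn b * x.1 b * F x.1 * ∑ c, x.1 c * (sgn c * x.1 c) := by
      rw [Finset.mul_sum]; exact Finset.sum_congr rfl fun d _ => by ring
    rw [this, sum_sgn_sq]; ring
  rw [t1, t2, t3, metric]
  split_ifs with hab
  · subst hab; ring
  · ring

/-- The flat wave operator. -/
noncomputable def wave (f : (Fin 4 → ℝ) → ℝ) (x : Fin 4 → ℝ) : ℝ := ∑ a, sgn a * D a (D a f) x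

theorem trace_metric (x : dS3) : trace (metric x) = 3 := by
  have h : mink x.1 x.1 = 1 := x.2
  rw [mink_self] at h
  simp [trace, metric, sgn, Fin.sum_univ_four]
  linarith

theorem box_restrict (hF : ConeSmooth F) (h1 : HomDeg 1 F) (x : dS3) :
    box (fun x => F x.1) x + 3 * F x.1 = wave F x.1 := by
  have h : trace (scalarTensor (fun x => F x.1) x) = wave F x.1 := by
    rw [scalarTensor_restrict hF h1]; rfl
  rw [← h, ← trace_metric x, box]
  simp only [trace, scalarTensor, Finset.sum_mul, ← Finset.sum_add_distrib]
  exact Finset.sum_congr rfl fun a _ => by ring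

/-- The homogeneous extension of degree one of a function on the hyperboloid. -/
noncomputable def lift₁ (f : dS3 → ℝ) (x : Fin 4 → ℝ) : ℝ := rad x * radialExt f x

theorem coneSmooth_lift₁ {f : dS3 → ℝ} (hf : Smooth f) : ConeSmooth (lift₁ f) :=
  coneSmooth_rad.mul hf

theorem homDeg_lift₁ (f : dS3 → ℝ) : HomDeg 1 (lift₁ f) := by
  have : HomDeg (1 + 0) (lift₁ f) := homDeg_rad.mul (homDeg_radialExt f)
  simpa using this

theorem restrict_lift₁ (f : dS3 → ℝ) : (fun x : dS3 => lift₁ f x.1) = f := by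
  funext x
  simp [lift₁, radialExt_of_mem, rad_eq_one x.2]

theorem eq_zero_of_homDeg {f : (Fin 4 → ℝ) → ℝ} {k : ℤ} (hf : HomDeg k f)
    (h : ∀ x : dS3, f x.1 = 0) : ∀ x ∈ spacelike, f x = 0 := by
  intro x hx
  have e : x = rad x • ((rad x)⁻¹ • x) := by
    rw [smul_smul, mul_inv_cancel₀ (rad_pos hx).ne', one_smul]
  have hN : (rad x)⁻¹ • x ∈ dS3 := normalize_mem hx
  rw [e, hf _ (mem_spacelike_of_mem hN) _ (rad_pos hx), h ⟨_, hN⟩, mul_zero]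

theorem homDeg_wave {k : ℤ} (hF : ConeSmooth F) (h1 : HomDeg k F) : HomDeg (k - 2) (wave F) := by
  unfold wave
  refine HomDeg.sum fun a _ => HomDeg.const_mul _ ?_
  have := (h1.D hF a).D (hF.D a) a
  rwa [show k - 2 = k - 1 - 1 by ring]

/-- A solution of `□f + 3f = 0` extends to a homogeneous solution of the flat wave equation. -/
theorem wave_lift₁ {f : dS3 → ℝ} (hf : Smooth f) (hb : ∀ x, box f x + 3 * f x = 0) :
    ∀ x ∈ spacelike, wave (lift₁ f) x = 0 := by
  refine eq_zero_of_homDeg (homDeg_wave (coneSmooth_lift₁ hf) (homDeg_lift₁ f)) fun x => ?_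
  rw [← box_restrict (coneSmooth_lift₁ hf) (homDeg_lift₁ f), restrict_lift₁]
  have := hb x
  rwa [← congrFun (restrict_lift₁ f) x] at this

theorem D_wave (hF : ConeSmooth F) {x : Fin 4 → ℝ} (hx : x ∈ spacelike) (b : Fin 4) :
    D b (wave F) x = wave (D b F) x := by
  unfold wave
  rw [D_sum (fun a _ => ((hF.D a).D a).const_mul _) hx]
  refine Finset.sum_congr rfl fun a _ => ?_
  rw [D_const_mul _ ((hF.D a).D a) hx, D_comm (hF.D a) hx b a]
  congr 1
  exact D_congr (fun y hy => D_comm hF hy b a) hx a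

/-- On the cone the trace is the flat wave operator of F, and the divergence is the gradient of that
trace; both vanish. -/
theorem isSDT_scalarTensor {f : dS3 → ℝ} (hf : Smooth f) (hb : ∀ x, box f x + 3 * f x = 0) :
    IsSDT (scalarTensor f) := by
  have hF := coneSmooth_lift₁ hf
  have h1 := homDeg_lift₁ f
  have hw := wave_lift₁ hf hb
  rw [← restrict_lift₁ f, scalarTensor_restrict hF h1]
  refine (coneTensor_hessian hF h1).isSDT_restrict
    (fun x => hw x.1 (mem_spacelike_of_mem x.2)) fun x a => ?_
  have hx := mem_spacelike_of_mem x.2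
  have h := D_wave hF hx a
  rw [D_congr (g := fun _ => 0) hw hx, D_const] at h
  rw [h, wave]
  refine Finset.sum_congr rfl fun b _ => ?_
  congr 1
  exact D_congr (fun y hy => D_comm hF hy a b) hx b

theorem curl_scalarTensor {f : dS3 → ℝ} (hf : Smooth f) : curl (scalarTensor f) = 0 := by
  have hF := coneSmooth_lift₁ hf
  have h1 := homDeg_lift₁ f
  rw [← restrict_lift₁ f, scalarTensor_restrict hF h1]
  funext x a b
  have hx := mem_spacelike_of_mem x.2
  rw [(coneTensor_hessian hF h1).curl_restrict, hodge_eq]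
  have c : ∀ c d, D c (D d (D b (lift₁ f))) x.1 = D d (D c (D b (lift₁ f))) x.1 := fun c d =>
    D_comm (hF.D b) hx c d
  fin_cases a <;> simp [c 1 0, c 2 0, c 3 0, c 2 1, c 3 1, c 3 2]

/-! ### Curl-free symmetric tensors have a scalar potential -/

/-- An antisymmetric tensor annihilated by the position vector and with vanishing dual is zero. -/
theorem antisymm_eq_zero_of_hodge_eq_zero (x : dS3) (X : Fin 4 → Fin 4 → ℝ)
    (hr : ∀ d, ∑ c, x.1 c * (X c d - X d c) = 0) (hh : ∀ a, hodge x a X = 0) (c d : Fin 4) :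
    X c d - X d c = 0 := by
  have hm : mink x.1 x.1 = 1 := x.2
  rw [mink_self] at hm
  have r0 := hr 0
  have r1 := hr 1
  have r2 := hr 2
  have r3 := hr 3
  have h0 := hh 0
  have h1 := hh 1
  have h2 := hh 2
  have h3 := hh 3
  rw [hodge_eq] at h0 h1 h2 h3
  simp only [Fin.sum_univ_four, sub_self, mul_zero, Matrix.cons_val] at r0 r1 r2 r3 h0 h1 h2 h3
  have e01 : X 0 1 - X 1 0 = 0 := by
    linear_combination (-x.1 1) * r0 - x.1 0 * r1 + x.1 2 * h3 - x.1 3 * h2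
      - (X 0 1 - X 1 0) * hm
  have e02 : X 0 2 - X 2 0 = 0 := by
    linear_combination (-x.1 2) * r0 - x.1 0 * r2 + x.1 3 * h1 - x.1 1 * h3
      - (X 0 2 - X 2 0) * hm
  have e03 : X 0 3 - X 3 0 = 0 := by
    linear_combination (-x.1 3) * r0 - x.1 0 * r3 + x.1 1 * h2 - x.1 2 * h1
      - (X 0 3 - X 3 0) * hm
  have e12 : X 1 2 - X 2 1 = 0 := by
    linear_combination (-x.1 2) * r1 + x.1 1 * r2 + x.1 0 * h3 + x.1 3 * h0
      - (X 1 2 - X 2 1) * hm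
  have e13 : X 1 3 - X 3 1 = 0 := by
    linear_combination (-x.1 3) * r1 + x.1 1 * r3 - x.1 0 * h2 - x.1 2 * h0
      - (X 1 3 - X 3 1) * hm
  have e23 : X 2 3 - X 3 2 = 0 := by
    linear_combination (-x.1 3) * r2 + x.1 2 * r3 + x.1 0 * h1 + x.1 1 * h0
      - (X 2 3 - X 3 2) * hm
  fin_cases c <;> fin_cases d <;> simp <;> linarith

/-- This fixes the degree -1: Euler's relation gives -S_db, the differentiated tangency condition
gives +S_bd, and the two cancel by symmetry. -/
theorem ConeTensor.radial_D_sub {S : Fin 4 → Fin 4 → (Fin 4 → ℝ) → ℝ} (h : ConeTensor S)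
    {x : Fin 4 → ℝ} (hx : x ∈ spacelike) (d b : Fin 4) :
    ∑ c, x c * (D c (S d b) x - D d (S c b) x) = 0 := by
  simp only [mul_sub, Finset.sum_sub_distrib, h.euler hx]
  have : ∑ c, x c * D d (S c b) x = -S b d x := by
    rw [← h.tangent_D hx]
    exact Finset.sum_congr rfl fun c _ => by rw [h.symm_D hx]
  rw [this, h.symm x hx]; ring

/-- At a point of the hyperboloid the antisymmetrized derivative has vanishing radial part, and its
dual is the curl, so it is zero; homogeneity carries this to the whole cone. -/
theorem ConeTensor.closed_of_curl_eq_zero {S : Fin 4 → Fin 4 → (Fin 4 → ℝ) → ℝ} (h : ConeTensor S)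
    (hc : curl (restrict S) = 0) {x : Fin 4 → ℝ} (hx : x ∈ spacelike) (c d b : Fin 4) :
    D c (S d b) x = D d (S c b) x := by
  have hom : HomDeg (-1 - 1) fun y => D c (S d b) y - D d (S c b) y :=
    ((h.hom d b).D (h.smooth d b) c).sub ((h.hom c b).D (h.smooth c b) d)
  refine sub_eq_zero.1 (eq_zero_of_homDeg hom (fun x => ?_) x hx)
  refine antisymm_eq_zero_of_hodge_eq_zero x (fun c d => D c (S d b) x.1)
    (fun d => h.radial_D_sub (mem_spacelike_of_mem x.2) d b) (fun a => ?_) c d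
  rw [← h.curl_restrict, hc]; rfl

/-- The part of the cone that is star-shaped about `σ e₁`. -/
def halfCone (σ : ℝ) : Set (Fin 4 → ℝ) :=
  {x | 0 < σ * x 1 ∧ 0 < mink x x} ∪ {x | x 0 ^ 2 < x 2 ^ 2 + x 3 ^ 2}

theorem isOpen_halfCone (σ : ℝ) : IsOpen (halfCone σ) := by
  have h : IsOpen {x : Fin 4 → ℝ | 0 < σ * x 1} := isOpen_lt continuous_const (by fun_prop)
  exact (h.inter isOpen_spacelike).union (isOpen_lt (by fun_prop) (by fun_prop))

theorem halfCone_subset (σ : ℝ) : halfCone σ ⊆ spacelike := by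
  rintro x (⟨_, h⟩ | h)
  · exact h
  · show 0 < mink x x
    rw [mink_self]
    have : x 0 ^ 2 < x 2 ^ 2 + x 3 ^ 2 := h
    nlinarith [sq_nonneg (x 1)]

/-- On the first piece the cross term in the Minkowski square along the segment is a nonnegative
multiple of σ y₁. The second condition does not involve x₁ and is merely rescaled. -/
theorem starConvex_halfCone {σ : ℝ} (hσ : σ ^ 2 = 1) :
    StarConvex ℝ (Pi.single 1 σ) (halfCone σ) := by
  intro y hy a b ha hb hab
  have e0 : (a • Pi.single 1 σ + b • y : Fin 4 → ℝ) 0 = b * y 0 := by simp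
  have e1 : (a • Pi.single 1 σ + b • y : Fin 4 → ℝ) 1 = a * σ + b * y 1 := by simp
  have e2 : (a • Pi.single 1 σ + b • y : Fin 4 → ℝ) 2 = b * y 2 := by simp
  have e3 : (a • Pi.single 1 σ + b • y : Fin 4 → ℝ) 3 = b * y 3 := by simp
  have hm : mink (a • Pi.single 1 σ + b • y : Fin 4 → ℝ) (a • Pi.single 1 σ + b • y)
      = a ^ 2 + 2 * (a * b) * (σ * y 1) + b ^ 2 * mink y y := by
    rw [mink_self, mink_self, e0, e1, e2, e3]
    linear_combination a ^ 2 * hσ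
  -- The endpoint b = 0 is the vertex, which lies only in the first piece, whichever piece contains
  -- y.
  rcases hb.eq_or_lt with rfl | hb
  · left
    obtain rfl : a = 1 := by linarith
    refine ⟨?_, ?_⟩
    · show 0 < σ * _
      rw [e1]; nlinarith
    · rw [hm]; norm_num
  rcases hy with ⟨h1, h2⟩ | h
  · left
    refine ⟨?_, ?_⟩
    · show 0 < σ * _
      rw [e1]
      have : 0 < b * (σ * y 1) := mul_pos hb h1
      nlinarith
    · rw [hm]
      have : 0 < b ^ 2 * mink y y := mul_pos (pow_pos hb 2) h2
      have : 0 ≤ a * b * (σ * y 1) := mul_nonneg (mul_nonneg ha hb.le) h1.le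
      nlinarith [sq_nonneg a]
  · right
    show (a • Pi.single 1 σ + b • y : Fin 4 → ℝ) 0 ^ 2 < _
    rw [e0, e2, e3]
    have h' : y 0 ^ 2 < y 2 ^ 2 + y 3 ^ 2 := h
    have := mul_lt_mul_of_pos_left h' (pow_pos hb 2)
    linarith

/-- This is the overlap of the two half cones. Polar coordinates in the (x₂, x₃)-plane, together
with the ratio of x₀ to the radius, exhibit it as the image of a product of intervals. -/
theorem isPreconnected_sideCone :
    IsPreconnected {x : Fin 4 → ℝ | x 0 ^ 2 < x 2 ^ 2 + x 3 ^ 2} := by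
  let m : ℝ × ℝ × ℝ × ℝ → Fin 4 → ℝ := fun p =>
    ![p.2.2.1 * p.2.1, p.1, p.2.2.1 * Real.cos p.2.2.2, p.2.2.1 * Real.sin p.2.2.2]
  have hm : Continuous m := by
    refine continuous_pi fun i => ?_
    fin_cases i <;> simp [m] <;> fun_prop
  have hs : IsPreconnected (univ ×ˢ Ioo (-1) 1 ×ˢ Ioi 0 ×ˢ univ : Set (ℝ × ℝ × ℝ × ℝ)) :=
    isPreconnected_univ.prod (isPreconnected_Ioo.prod (isPreconnected_Ioi.prod isPreconnected_univ))
  have := hs.image m hm.continuousOn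
  convert this using 1
  ext x
  constructor
  · intro hx
    have hx : x 0 ^ 2 < x 2 ^ 2 + x 3 ^ 2 := hx
    set z : ℂ := ⟨x 2, x 3⟩ with hz
    have hn : ‖z‖ ^ 2 = x 2 ^ 2 + x 3 ^ 2 := by
      rw [Complex.sq_norm, Complex.normSq_mk]; ring
    have hpos : 0 < ‖z‖ := by
      rcases (norm_nonneg z).eq_or_lt with h | h
      · rw [← h] at hn; nlinarith [sq_nonneg (x 0)]
      · exact h
    have hc : ‖z‖ * Real.cos z.arg = x 2 := Complex.norm_mul_cos_arg z
    have hsn : ‖z‖ * Real.sin z.arg = x 3 := Complex.norm_mul_sin_arg z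
    have habs : |x 0| < ‖z‖ := abs_lt_of_sq_lt_sq (by rw [hn]; exact hx) hpos.le
    refine ⟨(x 1, x 0 / ‖z‖, ‖z‖, z.arg), ⟨trivial, ?_, hpos, trivial⟩, ?_⟩
    · rw [abs_lt] at habs
      constructor
      · show -1 < x 0 / ‖z‖
        rw [lt_div_iff₀ hpos]; linarith
      · show x 0 / ‖z‖ < 1
        rw [div_lt_iff₀ hpos]; linarith
    · ext i
      fin_cases i
      · simp [m]; field_simp
      · simp [m]
      · simpa [m] using hc
      · simpa [m] using hsn
  · rintro ⟨⟨a, s, ρ, φ⟩, ⟨-, hs, hρ, -⟩, rfl⟩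
    have hρ : 0 < ρ := hρ
    have hs : -1 < s ∧ s < 1 := hs
    show (ρ * s) ^ 2 < (ρ * Real.cos φ) ^ 2 + (ρ * Real.sin φ) ^ 2
    have h1 : (ρ * Real.cos φ) ^ 2 + (ρ * Real.sin φ) ^ 2 = ρ ^ 2 := by
      linear_combination ρ ^ 2 * Real.sin_sq_add_cos_sq φ
    rw [h1, mul_pow]
    have : s ^ 2 < 1 := by nlinarith
    nlinarith [pow_pos hρ 2]

/-- Closed 1-forms on the spacelike cone are exact. -/
theorem exists_potential_on_spacelike {α : (Fin 4 → ℝ) → (Fin 4 → ℝ) →L[ℝ] ℝ}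
    (hα : ContDiffOn ℝ ∞ α spacelike)
    (hsymm : ∀ x ∈ spacelike, ∀ u v, fderiv ℝ α x u v = fderiv ℝ α x v u) :
    ∃ V : (Fin 4 → ℝ) → ℝ, ∀ x ∈ spacelike, HasFDerivAt V (α x) x := by
  have key : ∀ σ : ℝ, σ ^ 2 = 1 → ∃ V : (Fin 4 → ℝ) → ℝ, ∀ x ∈ halfCone σ,
      HasFDerivAt V (α x) x := fun σ hσ =>
    exists_hasFDerivAt_of_starConvex (isOpen_halfCone σ) (starConvex_halfCone hσ)
      (hα.mono (halfCone_subset σ)) fun x hx => hsymm x (halfCone_subset σ hx)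
  obtain ⟨V, hV⟩ := key 1 (by norm_num)
  obtain ⟨W, hW⟩ := key (-1) (by norm_num)
  have hopen : IsOpen {x : Fin 4 → ℝ | x 0 ^ 2 < x 2 ^ 2 + x 3 ^ 2} :=
    isOpen_lt (by fun_prop) (by fun_prop)
  have hd : ∀ x ∈ {x : Fin 4 → ℝ | x 0 ^ 2 < x 2 ^ 2 + x 3 ^ 2},
      HasFDerivAt (fun y => V y - W y) (0 : (Fin 4 → ℝ) →L[ℝ] ℝ) x := fun x hx =>
    ((hV x (Or.inr hx)).sub (hW x (Or.inr hx))).congr_fderiv (sub_self _)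
  -- Since the overlap is connected, the two primitives differ there by a single constant, and can
  -- be glued.
  obtain ⟨k, hk⟩ := hopen.exists_is_const_of_fderiv_eq_zero isPreconnected_sideCone
    (fun x hx => (hd x hx).differentiableAt.differentiableWithinAt) fun x hx => (hd x hx).fderiv
  classical
  refine ⟨fun x => if x ∈ halfCone 1 then V x else W x + k, fun x hx => ?_⟩
  by_cases h1 : x ∈ halfCone 1
  · refine (hV x h1).congr_of_eventuallyEq ?_
    filter_upwards [(isOpen_halfCone 1).mem_nhds h1] with y hy
    rw [if_pos hy]
  · have h2 : x ∈ halfCone (-1) := by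
      have hx : 0 < mink x x := hx
      simp only [halfCone, mem_union, mem_ofPred_eq, not_or, not_and] at h1 ⊢
      rcases lt_trichotomy (x 1) 0 with h | h | h
      · left; exact ⟨by linarith, hx⟩
      · right
        rw [mink_self, h] at hx
        linarith
      · exact absurd hx (h1.1 (by linarith))
    refine ((hW x h2).add_const k).congr_of_eventuallyEq ?_
    filter_upwards [(isOpen_halfCone (-1)).mem_nhds h2] with y hy
    split_ifs with hy1
    · have hs : y ∈ {x : Fin 4 → ℝ | x 0 ^ 2 < x 2 ^ 2 + x 3 ^ 2} := by
        rcases hy with ⟨ha, -⟩ | h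
        · rcases hy1 with ⟨hb, -⟩ | h
          · exfalso; linarith
          · exact h
        · exact h
      have := hk y hs
      linarith
    · rfl

/-- The converse of Euler's relation: along a ray, c⁻¹ f(cx) has zero derivative in c. -/
theorem homDeg_one_of_euler {f : (Fin 4 → ℝ) → ℝ} (hf : ConeSmooth f)
    (h : ∀ x ∈ spacelike, ∑ a, x a * D a f x = f x) : HomDeg 1 f := by
  intro x hx c hc
  have hd : ∀ c ∈ Ioi (0 : ℝ), HasDerivAt (fun c : ℝ => c⁻¹ * f (c • x)) 0 c := by
    intro c hc
    have hc0 : c ≠ 0 := ne_of_gt hc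
    have h1 : HasDerivAt (fun c : ℝ => f (c • x)) (fderiv ℝ f (c • x) x) c :=
      (hf.differentiableAt (smul_mem_spacelike hx hc)).hasFDerivAt.comp_hasDerivAt c
        (by simpa using (hasDerivAt_id c).smul_const x)
    refine ((hasDerivAt_inv hc0).mul h1).congr_deriv ?_
    have h2 := h _ (smul_mem_spacelike hx hc)
    rw [← fderiv_eq_sum_D, map_smul, smul_eq_mul] at h2
    rw [← h2]
    field_simp
    ring
  have := (convex_Ioi (0 : ℝ)).is_const_of_fderivWithin_eq_zero (𝕜 := ℝ)
    (f := fun c : ℝ => c⁻¹ * f (c • x))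
    (fun c hc => (hd c hc).differentiableAt.differentiableWithinAt) (fun c hc => by
      rw [fderivWithin_of_isOpen isOpen_Ioi hc]
      ext
      simpa using (hd c hc).deriv) (mem_Ioi.2 hc)
      (mem_Ioi.2 one_pos)
  simp only [inv_one, one_smul, one_mul] at this
  rw [zpow_one, ← this]
  field_simp

theorem ConeTensor.exists_scalar_potential {S : Fin 4 → Fin 4 → (Fin 4 → ℝ) → ℝ}
    (h : ConeTensor S) (hc : curl (restrict S) = 0) :
    ∃ F : (Fin 4 → ℝ) → ℝ, ConeSmooth F ∧ HomDeg 1 F ∧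
      ∀ x ∈ spacelike, ∀ a b, D a (D b F) x = S a b x := by
  have key : ∀ b, ∃ V : (Fin 4 → ℝ) → ℝ, ConeSmooth V ∧
      ∀ x ∈ spacelike, ∀ a, D a V x = S a b x := by
    intro b
    let α : (Fin 4 → ℝ) → (Fin 4 → ℝ) →L[ℝ] ℝ := fun x =>
      ∑ a, S a b x • ContinuousLinearMap.proj (R := ℝ) (φ := fun _ : Fin 4 => ℝ) a
    have hα : ContDiffOn ℝ ∞ α spacelike :=
      ContDiffOn.sum fun a _ => ContDiffOn.smul (h.smooth a b) contDiffOn_const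
    have hαd : ∀ x ∈ spacelike, ∀ u v, fderiv ℝ α x u v = ∑ a, ∑ c, v a * u c * D c (S a b) x := by
      intro x hx u v
      have h1 : HasFDerivAt α (∑ a, (fderiv ℝ (S a b) x).smulRight
          (ContinuousLinearMap.proj (R := ℝ) (φ := fun _ : Fin 4 => ℝ) a)) x :=
        HasFDerivAt.fun_sum fun a _ =>
          HasFDerivAt.smul_const (F := (Fin 4 → ℝ) →L[ℝ] ℝ)
            ((h.smooth a b).differentiableAt hx).hasFDerivAt _
      rw [h1.fderiv]
      simp only [sum_apply, ContinuousLinearMap.smulRight_apply,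
        fderiv_eq_sum_D]
      refine Finset.sum_congr rfl fun a _ => ?_
      simp only [smul_apply, ContinuousLinearMap.proj_apply, smul_eq_mul, Finset.sum_mul]
      exact Finset.sum_congr rfl fun c _ => by ring
    obtain ⟨V, hV⟩ := exists_potential_on_spacelike hα (fun x hx u v => by
      rw [hαd x hx, hαd x hx, Finset.sum_comm]
      refine Finset.sum_congr rfl fun c _ => Finset.sum_congr rfl fun a _ => ?_
      rw [h.closed_of_curl_eq_zero hc hx]; ring)
    refine ⟨V, ?_, fun x hx a => ?_⟩
    · refine (contDiffOn_infty_iff_fderiv_of_isOpen isOpen_spacelike).2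
        ⟨fun x hx => (hV x hx).differentiableAt.differentiableWithinAt, ?_⟩
      exact hα.congr fun x hx => (hV x hx).fderiv
    · rw [D, (hV x hx).fderiv]
      simp [α, Pi.single_apply]
  choose V hVs hV using key
  -- The potential is ∑ x_b V_b: its a-th derivative is V_a plus ∑ x_b S_ab, which vanishes by
  -- tangency. The same identity, contracted with x, is Euler's relation of degree one.
  have hs : ConeSmooth fun x => ∑ b, x b * V b x :=
    ConeSmooth.sum fun b _ => (ConeSmooth.coord b).mul (hVs b)
  have hD : ∀ x ∈ spacelike, ∀ a, D a (fun x => ∑ b, x b * V b x) x = V a x := by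
    intro x hx a
    rw [D_sum (fun b _ => (ConeSmooth.coord b).mul (hVs b)) hx]
    simp only [D_coord_mul (hVs _) hx, hV _ x hx, Finset.sum_add_distrib, h.tangent x hx]
    simp
  refine ⟨_, hs, homDeg_one_of_euler hs fun x hx => ?_, fun x hx a b => ?_⟩
  · exact Finset.sum_congr rfl fun a _ => by rw [hD x hx]
  · rw [D_congr (fun y hy => hD y hy b) hx, hV b x hx]

/-- A smooth symmetric traceless curl-free tensor on the hyperboloid has a scalar potential. -/
theorem exists_scalarTensor_eq {T : dS3 → Fin 4 → Fin 4 → ℝ} (hT : IsSDT T) (hc : curl T = 0) :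
    ∃ w : dS3 → ℝ, Smooth w ∧ (∀ x, box w x + 3 * w x = 0) ∧ T = scalarTensor w := by
  have h := coneTensor_lift hT.smooth hT.tangent hT.symm
  obtain ⟨F, hF, h1, hS⟩ := h.exists_scalar_potential (by rwa [restrict_lift])
  have e : scalarTensor (fun x => F x.1) = T := by
    rw [scalarTensor_restrict hF h1, ← restrict_lift T]
    funext x a b
    exact hS x.1 (mem_spacelike_of_mem x.2) a b
  refine ⟨fun x => F x.1, smooth_restrict hF, fun x => ?_, e.symm⟩
  rw [box_restrict hF h1, ← hT.traceless x, ← e, scalarTensor_restrict hF h1]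
  rfl

/-! ### Integration over the unit sphere -/

/-- The point of the unit sphere in `{x₀ = 0}` with polar angles `θ, φ`. -/
noncomputable def sphPt (θ φ : ℝ) : Fin 4 → ℝ :=
  ![0, Real.sin θ * Real.cos φ, Real.sin θ * Real.sin φ, Real.cos θ]

/-- The unit sphere in `{x₀ = 0}`. -/
def unitSph : Set (Fin 4 → ℝ) := {y | y 0 = 0 ∧ y 1 ^ 2 + y 2 ^ 2 + y 3 ^ 2 = 1}

theorem sphPt_mem (θ φ : ℝ) : sphPt θ φ ∈ unitSph := by
  refine ⟨rfl, ?_⟩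
  simp only [sphPt, Matrix.cons_val]
  linear_combination Real.sin_sq_add_cos_sq θ + Real.sin θ ^ 2 * Real.sin_sq_add_cos_sq φ

theorem contDiff_sphPt : ContDiff ℝ ∞ fun p : ℝ × ℝ => sphPt p.1 p.2 := by
  rw [contDiff_pi]
  intro i
  fin_cases i <;> simp only [sphPt] <;> simp <;> fun_prop

theorem continuous_sphPt : Continuous fun p : ℝ × ℝ => sphPt p.1 p.2 := contDiff_sphPt.continuous

/-- The integral over the unit sphere. -/
noncomputable def sphInt (k : (Fin 4 → ℝ) → ℝ) : ℝ :=
  ∫ θ in (0 : ℝ)..Real.pi, ∫ φ in (0 : ℝ)..(2 * Real.pi), k (sphPt θ φ) * Real.sin θ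

theorem sphInt_congr {k l : (Fin 4 → ℝ) → ℝ} (h : ∀ y ∈ unitSph, k y = l y) :
    sphInt k = sphInt l := by
  unfold sphInt
  simp only [h _ (sphPt_mem _ _)]

theorem continuous_comp_sphPt {k : (Fin 4 → ℝ) → ℝ} (hk : ContinuousOn k unitSph) :
    Continuous fun p : ℝ × ℝ => k (sphPt p.1 p.2) :=
  hk.comp_continuous continuous_sphPt fun p => sphPt_mem p.1 p.2

theorem continuous_integral_right {g : ℝ × ℝ → ℝ} (hg : Continuous g) (a b : ℝ) :
    Continuous fun θ => ∫ φ in a..b, g (θ, φ) :=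
  intervalIntegral.continuous_parametric_intervalIntegral_of_continuous' (f := fun θ φ => g (θ, φ))
    hg a b

theorem integral_integral_add {f g : ℝ × ℝ → ℝ} (hf : Continuous f) (hg : Continuous g)
    (a b c d : ℝ) : ∫ θ in a..b, ∫ φ in c..d, f (θ, φ) + g (θ, φ) =
      (∫ θ in a..b, ∫ φ in c..d, f (θ, φ)) + ∫ θ in a..b, ∫ φ in c..d, g (θ, φ) := by
  rw [← intervalIntegral.integral_add
    ((continuous_integral_right hf c d).intervalIntegrable _ _)
    ((continuous_integral_right hg c d).intervalIntegrable _ _)]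
  congr 1
  funext θ
  exact intervalIntegral.integral_add
    ((hf.comp (Continuous.prodMk_right θ)).intervalIntegrable _ _)
    ((hg.comp (Continuous.prodMk_right θ)).intervalIntegrable _ _)

theorem continuous_sphInt_integrand {k : (Fin 4 → ℝ) → ℝ} (hk : ContinuousOn k unitSph) :
    Continuous fun p : ℝ × ℝ => k (sphPt p.1 p.2) * Real.sin p.1 :=
  (continuous_comp_sphPt hk).mul (by fun_prop)

theorem sphInt_add {k l : (Fin 4 → ℝ) → ℝ} (hk : ContinuousOn k unitSph)
    (hl : ContinuousOn l unitSph) : sphInt (fun y => k y + l y) = sphInt k + sphInt l := by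
  unfold sphInt
  simp only [add_mul]
  exact integral_integral_add (continuous_sphInt_integrand hk) (continuous_sphInt_integrand hl) ..

theorem sphInt_const_mul (c : ℝ) (k : (Fin 4 → ℝ) → ℝ) :
    sphInt (fun y => c * k y) = c * sphInt k := by
  unfold sphInt
  simp only [mul_assoc, intervalIntegral.integral_const_mul]

theorem sphInt_sub {k l : (Fin 4 → ℝ) → ℝ} (hk : ContinuousOn k unitSph)
    (hl : ContinuousOn l unitSph) : sphInt (fun y => k y - l y) = sphInt k - sphInt l := by
  have := sphInt_add (l := fun y => (-1) * l y) hk (continuousOn_const.mul hl)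
  rw [sphInt_const_mul] at this
  simpa [sub_eq_add_neg] using this

theorem sphInt_const (c : ℝ) : sphInt (fun _ => c) = 4 * Real.pi * c := by
  simp [sphInt, intervalIntegral.integral_const_mul]
  ring

theorem sphInt_sum {ι : Type} {s : Finset ι} {k : ι → (Fin 4 → ℝ) → ℝ}
    (hk : ∀ i ∈ s, ContinuousOn (k i) unitSph) :
    sphInt (fun y => ∑ i ∈ s, k i y) = ∑ i ∈ s, sphInt (k i) := by
  classical
  induction s using Finset.induction_on with
  | empty => simpa using sphInt_const 0
  | insert i s hi ih =>
    simp only [Finset.sum_insert hi]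
    rw [sphInt_add (hk i (Finset.mem_insert_self _ _))
      (continuousOn_finsetSum _ fun j hj => hk j (Finset.mem_insert_of_mem hj)),
      ih fun j hj => hk j (Finset.mem_insert_of_mem hj)]

/-- The generators of the rotations about the three spatial axes. -/
def rotGen (i : Fin 4) (x : Fin 4 → ℝ) : Fin 4 → ℝ :=
  ![0, ![0, 0, x 3, -x 2] i, ![0, -x 3, 0, x 1] i, ![0, x 2, -x 1, 0] i]

/-- The index 0 is a placeholder with zero generator, so that rotations and tensor slots share the
index set `Fin 4`. -/
theorem rotGen_zero (x : Fin 4 → ℝ) : rotGen 0 x = 0 := by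
  ext i; fin_cases i <;> simp [rotGen]

/-- The derivative `L_i f` along the `i`-th rotation. -/
noncomputable def angDeriv (i : Fin 4) (f : (Fin 4 → ℝ) → ℝ) (x : Fin 4 → ℝ) : ℝ :=
  fderiv ℝ f x (rotGen i x)

theorem continuous_rotGen (i : Fin 4) : Continuous (rotGen i) := by
  refine continuous_pi fun a => ?_
  fin_cases a <;> fin_cases i <;> simp [rotGen] <;> fun_prop

theorem integral_swap_of_continuous {G : ℝ × ℝ → ℝ} (hG : Continuous G) (a b c d : ℝ) :
    ∫ θ in a..b, ∫ φ in c..d, G (θ, φ) = ∫ φ in c..d, ∫ θ in a..b, G (θ, φ) :=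
  MeasureTheory.intervalIntegral_intervalIntegral_swap (F := fun θ φ => G (θ, φ))
    ((hG.continuousOn.integrableOn_compact (isCompact_uIcc.prod isCompact_uIcc)).mono_set
      (prod_mono uIoc_subset_uIcc uIoc_subset_uIcc))

theorem integral_integral_deriv_left {g G : ℝ × ℝ → ℝ} (hG : Continuous G)
    (hd : ∀ θ φ, HasDerivAt (fun θ => g (θ, φ)) (G (θ, φ)) θ) {a b : ℝ}
    (hab : ∀ φ, g (b, φ) = g (a, φ)) (c d : ℝ) : ∫ θ in a..b, ∫ φ in c..d, G (θ, φ) = 0 := by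
  rw [integral_swap_of_continuous hG]
  have : ∀ φ, ∫ θ in a..b, G (θ, φ) = 0 := by
    intro φ
    rw [intervalIntegral.integral_eq_sub_of_hasDerivAt (fun θ _ => hd θ φ)
      ((hG.comp (Continuous.prodMk_left φ)).intervalIntegrable _ _), hab, sub_self]
  simp [this]

theorem integral_integral_deriv_right {g G : ℝ × ℝ → ℝ} (hG : Continuous G)
    (hd : ∀ θ φ, HasDerivAt (fun φ => g (θ, φ)) (G (θ, φ)) φ) {c d : ℝ}
    (hcd : ∀ θ, g (θ, d) = g (θ, c)) (a b : ℝ) : ∫ θ in a..b, ∫ φ in c..d, G (θ, φ) = 0 := by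
  have : ∀ θ, ∫ φ in c..d, G (θ, φ) = 0 := by
    intro θ
    rw [intervalIntegral.integral_eq_sub_of_hasDerivAt (fun φ _ => hd θ φ)
      ((hG.comp (Continuous.prodMk_right θ)).intervalIntegrable _ _), hcd, sub_self]
  simp [this]

/-- The `θ`-derivative of `sphPt`. -/
noncomputable def sphPtθ (θ φ : ℝ) : Fin 4 → ℝ :=
  ![0, Real.cos θ * Real.cos φ, Real.cos θ * Real.sin φ, -Real.sin θ]

/-- The `φ`-derivative of `sphPt`. -/
noncomputable def sphPtφ (θ φ : ℝ) : Fin 4 → ℝ :=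
  ![0, -(Real.sin θ * Real.sin φ), Real.sin θ * Real.cos φ, 0]

theorem hasDerivAt_sphPt_left (θ φ : ℝ) :
    HasDerivAt (fun θ => sphPt θ φ) (sphPtθ θ φ) θ := by
  rw [hasDerivAt_pi]
  intro i
  fin_cases i
  · simpa [sphPt, sphPtθ] using hasDerivAt_const θ (0 : ℝ)
  · simpa [sphPt, sphPtθ] using (Real.hasDerivAt_sin θ).mul_const (Real.cos φ)
  · simpa [sphPt, sphPtθ] using (Real.hasDerivAt_sin θ).mul_const (Real.sin φ)
  · simpa [sphPt, sphPtθ] using Real.hasDerivAt_cos θ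

theorem hasDerivAt_sphPt_right (θ φ : ℝ) :
    HasDerivAt (fun φ => sphPt θ φ) (sphPtφ θ φ) φ := by
  rw [hasDerivAt_pi]
  intro i
  fin_cases i
  · simpa [sphPt, sphPtφ] using hasDerivAt_const φ (0 : ℝ)
  · simpa [sphPt, sphPtφ] using (Real.hasDerivAt_cos φ).const_mul (Real.sin θ)
  · simpa [sphPt, sphPtφ] using (Real.hasDerivAt_sin φ).const_mul (Real.sin θ)
  · simpa [sphPt, sphPtφ] using hasDerivAt_const φ (Real.cos θ)

theorem sphPt_periodic (θ : ℝ) : sphPt θ (2 * Real.pi) = sphPt θ 0 := by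
  simp [sphPt]

/-- The integral over the sphere of the derivative along a rotation vanishes. -/
theorem sphInt_angDeriv {k : (Fin 4 → ℝ) → ℝ} {U : Set (Fin 4 → ℝ)} (hU : IsOpen U)
    (hS : unitSph ⊆ U) (hk : ContDiffOn ℝ 1 k U) (i : Fin 4) : sphInt (angDeriv i k) = 0 := by
  have hk' : ContinuousOn (fderiv ℝ k) U := hk.continuousOn_fderiv_of_isOpen hU le_rfl
  have hc : Continuous fun p : ℝ × ℝ => k (sphPt p.1 p.2) :=
    continuous_comp_sphPt (hk.continuousOn.mono hS)
  have hc' : Continuous fun p : ℝ × ℝ => fderiv ℝ k (sphPt p.1 p.2) :=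
    (hk'.mono hS).comp_continuous continuous_sphPt fun p => sphPt_mem p.1 p.2
  have hθc : Continuous fun p : ℝ × ℝ => sphPtθ p.1 p.2 := by
    refine continuous_pi fun i => ?_
    fin_cases i <;> simp [sphPtθ] <;> fun_prop
  have hφc : Continuous fun p : ℝ × ℝ => sphPtφ p.1 p.2 := by
    refine continuous_pi fun i => ?_
    fin_cases i <;> simp [sphPtφ] <;> fun_prop
  have hcθ := hc'.clm_apply hθc
  have hcφ := hc'.clm_apply hφc
  have hkd : ∀ θ φ, HasFDerivAt k (fderiv ℝ k (sphPt θ φ)) (sphPt θ φ) := fun θ φ =>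
    ((hk.differentiableOn one_ne_zero).differentiableAt
      (hU.mem_nhds (hS (sphPt_mem θ φ)))).hasFDerivAt
  have hdθ : ∀ θ φ, HasDerivAt (fun θ => k (sphPt θ φ)) (fderiv ℝ k (sphPt θ φ) (sphPtθ θ φ)) θ :=
    fun θ φ => (hkd θ φ).comp_hasDerivAt θ (hasDerivAt_sphPt_left θ φ)
  have hdφ : ∀ θ φ, HasDerivAt (fun φ => k (sphPt θ φ)) (fderiv ℝ k (sphPt θ φ) (sphPtφ θ φ)) φ :=
    fun θ φ => (hkd θ φ).comp_hasDerivAt φ (hasDerivAt_sphPt_right θ φ)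
  -- In polar angles, sin θ · L_i k is the divergence ∂_θ(sin θ p k) + ∂_φ(q r k); the condition on
  -- cos θ p + q r' says that the generator preserves area. The boundary terms vanish because sin θ
  -- = 0 at the poles and everything is 2π-periodic in φ.
  have key : ∀ p q r : ℝ → ℝ, ∀ r' : ℝ → ℝ, Continuous p → Continuous q → Continuous r →
      Continuous r' → (∀ φ, HasDerivAt r (r' φ) φ) → r (2 * Real.pi) = r 0 →
      (∀ θ φ, Real.cos θ * p φ + q θ * r' φ = 0) →
      (∀ θ φ, Real.sin θ • rotGen i (sphPt θ φ)
        = (Real.sin θ * p φ) • sphPtθ θ φ + (q θ * r φ) • sphPtφ θ φ) →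
      sphInt (angDeriv i k) = 0 := by
    intro p q r r' hp hq hr hr' hdr hper h0 hJ
    have e : ∀ θ φ, angDeriv i k (sphPt θ φ) * Real.sin θ =
        (Real.cos θ * p φ * k (sphPt θ φ)
          + Real.sin θ * p φ * fderiv ℝ k (sphPt θ φ) (sphPtθ θ φ))
        + (q θ * r' φ * k (sphPt θ φ) + q θ * r φ * fderiv ℝ k (sphPt θ φ) (sphPtφ θ φ)) := by
      intro θ φ
      have h1 := congrArg (fderiv ℝ k (sphPt θ φ)) (hJ θ φ)
      simp only [map_smul, map_add, smul_eq_mul] at h1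
      rw [angDeriv, mul_comm, h1]
      linear_combination -k (sphPt θ φ) * h0 θ φ
    unfold sphInt
    simp only [e]
    have c1 : Continuous fun P : ℝ × ℝ => Real.cos P.1 * p P.2 * k (sphPt P.1 P.2)
          + Real.sin P.1 * p P.2 * fderiv ℝ k (sphPt P.1 P.2) (sphPtθ P.1 P.2) :=
      ((by fun_prop : Continuous fun P : ℝ × ℝ => Real.cos P.1 * p P.2).mul hc).add
        ((by fun_prop : Continuous fun P : ℝ × ℝ => Real.sin P.1 * p P.2).mul hcθ)
    have c2 : Continuous fun P : ℝ × ℝ => q P.1 * r' P.2 * k (sphPt P.1 P.2)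
          + q P.1 * r P.2 * fderiv ℝ k (sphPt P.1 P.2) (sphPtφ P.1 P.2) :=
      ((by fun_prop : Continuous fun P : ℝ × ℝ => q P.1 * r' P.2).mul hc).add
        ((by fun_prop : Continuous fun P : ℝ × ℝ => q P.1 * r P.2).mul hcφ)
    rw [integral_integral_add c1 c2,
      integral_integral_deriv_left (g := fun P => Real.sin P.1 * p P.2 * k (sphPt P.1 P.2)) c1
        (fun θ φ => ((Real.hasDerivAt_sin θ).mul_const (p φ)).mul (hdθ θ φ)) (by simp),
      integral_integral_deriv_right (g := fun P => q P.1 * r P.2 * k (sphPt P.1 P.2)) c2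
        (fun θ φ => ((hdr φ).const_mul (q θ)).mul (hdφ θ φ))
        (fun θ => by simp [hper, sphPt_periodic]), add_zero]
  have hi : ∀ i : Fin 4, i = 0 ∨ i = 1 ∨ i = 2 ∨ i = 3 := by decide
  rcases hi i with rfl | rfl | rfl | rfl
  · refine key (fun _ => 0) (fun _ => 0) (fun _ => 0) (fun _ => 0) (by fun_prop) (by fun_prop)
      (by fun_prop) (by fun_prop) (fun φ => hasDerivAt_const φ 0) rfl (by simp) fun θ φ => ?_
    simp [rotGen_zero]
  -- L_1 = -sin φ ∂_θ - cot θ cos φ ∂_φ. The next two cases are L_2 = cos φ ∂_θ - cot θ sin φ ∂_φ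
  -- and L_3 = ∂_φ.
  · refine key (fun φ => -Real.sin φ) (fun θ => -Real.cos θ) Real.cos (fun φ => -Real.sin φ)
      (by fun_prop) (by fun_prop) (by fun_prop) (by fun_prop) Real.hasDerivAt_cos (by simp)
      (fun θ φ => by ring) fun θ φ => ?_
    have h := Real.sin_sq_add_cos_sq φ
    ext a
    fin_cases a <;> simp [rotGen, sphPt, sphPtθ, sphPtφ] <;> try ring1
    linear_combination Real.sin θ * Real.cos θ * h
  · refine key Real.cos (fun θ => -Real.cos θ) Real.sin Real.cos
      (by fun_prop) (by fun_prop) (by fun_prop) (by fun_prop) Real.hasDerivAt_sin (by simp)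
      (fun θ φ => by ring) fun θ φ => ?_
    have h := Real.sin_sq_add_cos_sq φ
    ext a
    fin_cases a <;> simp [rotGen, sphPt, sphPtθ, sphPtφ] <;> try ring1
    linear_combination -Real.sin θ * Real.cos θ * h
  · refine key (fun _ => 0) Real.sin (fun _ => 1) (fun _ => 0)
      (by fun_prop) (by fun_prop) (by fun_prop) (by fun_prop) (fun φ => hasDerivAt_const φ 1) rfl
      (fun θ φ => by ring) fun θ φ => ?_
    ext a
    fin_cases a <;> simp [rotGen, sphPt, sphPtφ]

theorem fderiv_intervalIntegral_apply {E : Type} [NormedAddCommGroup E]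
    [NormedSpace ℝ E] [FiniteDimensional ℝ E] {a b : ℝ} {U : Set E}
    (hU : IsOpen U) {O : Set (ℝ × E)} (hO : IsOpen O) (hsub : ∀ s ∈ uIcc a b, ∀ x ∈ U, (s, x) ∈ O)
    {f : ℝ × E → ℝ} (hf : ContDiffOn ℝ ∞ f O) {x : E} (hx : x ∈ U) (v : E) :
    fderiv ℝ (fun y => ∫ s in a..b, f (s, y)) x v = ∫ s in a..b, fderiv ℝ f (s, x) (0, v) := by
  rw [(hasFDerivAt_intervalIntegral_of_contDiffOn hU hO hsub (hf.of_le (by simp)) hx).fderiv,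
    ContinuousLinearMap.intervalIntegral_apply]
  · rfl
  · refine ContinuousOn.intervalIntegrable (ContinuousOn.clm_comp ?_ continuousOn_const)
    exact (hf.continuousOn_fderiv_of_isOpen hO (by simp)).comp
      (Continuous.prodMk continuous_id continuous_const).continuousOn (fun s hs => hsub s hs x hx)

/-! ### Smooth dependence of spherical integrals on parameters. -/

section Parametric

set_option linter.unusedSectionVars false

variable {E : Type} [NormedAddCommGroup E] [NormedSpace ℝ E]
  {U : Set E} {O : Set ((Fin 4 → ℝ) × E)} {f : (Fin 4 → ℝ) × E → ℝ}

/-- The integrand of a parametric integral over the sphere, in polar angles. -/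
noncomputable def sphIntegrand (f : (Fin 4 → ℝ) × E → ℝ) (p : ℝ × ℝ × E) : ℝ :=
  f (sphPt p.2.1 p.1, p.2.2) * Real.sin p.2.1

theorem contDiffOn_sphIntegrand (hf : ContDiffOn ℝ ∞ f O) :
    ContDiffOn ℝ ∞ (sphIntegrand f) {p | (sphPt p.2.1 p.1, p.2.2) ∈ O} := by
  have h1 : ContDiff ℝ ∞ fun p : ℝ × ℝ × E => (sphPt p.2.1 p.1, p.2.2) :=
    (contDiff_sphPt.comp (by fun_prop : ContDiff ℝ ∞ fun p : ℝ × ℝ × E => (p.2.1, p.1))).prodMk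
      (by fun_prop)
  exact (hf.comp h1.contDiffOn fun p hp => hp).mul (by fun_prop)

theorem isOpen_sphIntegrand_domain (hO : IsOpen O) :
    IsOpen {p : ℝ × ℝ × E | (sphPt p.2.1 p.1, p.2.2) ∈ O} :=
  hO.preimage ((continuous_sphPt.comp
    (by fun_prop : Continuous fun p : ℝ × ℝ × E => (p.2.1, p.1))).prodMk (by fun_prop))

theorem sphIntegrand_domain_mem (hsub : ∀ y ∈ unitSph, ∀ x ∈ U, (y, x) ∈ O) {a b : ℝ} :
    ∀ φ ∈ uIcc a b, ∀ q ∈ (univ ×ˢ U : Set (ℝ × E)),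
      (φ, q) ∈ {p : ℝ × ℝ × E | (sphPt p.2.1 p.1, p.2.2) ∈ O} :=
  fun _ _ _ hq => hsub _ (sphPt_mem _ _) _ hq.2

theorem contDiffOn_integral_sphIntegrand [FiniteDimensional ℝ E] (hU : IsOpen U) (hO : IsOpen O)
    (hsub : ∀ y ∈ unitSph, ∀ x ∈ U, (y, x) ∈ O) (hf : ContDiffOn ℝ ∞ f O) :
    ContDiffOn ℝ ∞ (fun q : ℝ × E => ∫ φ in (0 : ℝ)..(2 * Real.pi), sphIntegrand f (φ, q))
      (univ ×ˢ U) :=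
  contDiffOn_intervalIntegral (E := ℝ × E) (F := ℝ) (f := sphIntegrand f) (isOpen_univ.prod hU)
    (isOpen_sphIntegrand_domain hO) (sphIntegrand_domain_mem hsub) (contDiffOn_sphIntegrand hf)

theorem mem_univ_prod {a b : ℝ} : ∀ θ ∈ uIcc a b, ∀ x ∈ U, (θ, x) ∈ (univ ×ˢ U : Set (ℝ × E)) :=
  fun _ _ _ hx => ⟨trivial, hx⟩

theorem contDiffOn_sphInt [FiniteDimensional ℝ E] (hU : IsOpen U) (hO : IsOpen O)
    (hsub : ∀ y ∈ unitSph, ∀ x ∈ U, (y, x) ∈ O) (hf : ContDiffOn ℝ ∞ f O) :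
    ContDiffOn ℝ ∞ (fun x => sphInt fun y => f (y, x)) U :=
  contDiffOn_intervalIntegral (E := E) (F := ℝ) (a := 0) (b := Real.pi)
    (f := fun q : ℝ × E => ∫ φ in (0 : ℝ)..(2 * Real.pi), sphIntegrand f (φ, q)) hU
    (isOpen_univ.prod hU) mem_univ_prod (contDiffOn_integral_sphIntegrand hU hO hsub hf)

theorem fderiv_sphIntegrand_apply (hO : IsOpen O) (hf : ContDiffOn ℝ ∞ f O) {θ φ : ℝ} {x : E}
    (hmem : (sphPt θ φ, x) ∈ O) (v : E) :
    fderiv ℝ (sphIntegrand f) (φ, θ, x) (0, 0, v)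
      = fderiv ℝ f (sphPt θ φ, x) (0, v) * Real.sin θ := by
  have hn : {p : ℝ × ℝ × E | (sphPt p.2.1 p.1, p.2.2) ∈ O} ∈ nhds (φ, θ, x) :=
    (isOpen_sphIntegrand_domain hO).mem_nhds hmem
  have hdo : DifferentiableOn ℝ (sphIntegrand f)
      {p : ℝ × ℝ × E | (sphPt p.2.1 p.1, p.2.2) ∈ O} :=
    (contDiffOn_sphIntegrand hf).differentiableOn (by simp)
  have hd : HasFDerivAt (sphIntegrand f) (fderiv ℝ (sphIntegrand f) (φ, θ, x)) (φ, θ, x) :=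
    (hdo.differentiableAt hn).hasFDerivAt
  have hfd : HasFDerivAt f (fderiv ℝ f (sphPt θ φ, x)) (sphPt θ φ, x) :=
    ((hf.differentiableOn (by simp)).differentiableAt (hO.mem_nhds hmem)).hasFDerivAt
  have l1 : HasDerivAt (fun s : ℝ => x + s • v) v 0 := by
    simpa using ((hasDerivAt_id (0 : ℝ)).smul_const v).const_add x
  have l2 : HasDerivAt (fun s : ℝ => (φ, θ, x + s • v)) (0, 0, v) 0 :=
    (hasDerivAt_const _ φ).prodMk ((hasDerivAt_const _ θ).prodMk l1)
  have l3 : HasDerivAt (fun s : ℝ => (sphPt θ φ, x + s • v)) (0, v) 0 :=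
    (hasDerivAt_const _ _).prodMk l1
  have e1 : HasDerivAt (fun s : ℝ => sphIntegrand f (φ, θ, x + s • v))
      (fderiv ℝ (sphIntegrand f) (φ, θ, x) (0, 0, v)) 0 :=
    HasFDerivAt.comp_hasDerivAt_of_eq (l := sphIntegrand f) 0 hd l2 (by simp)
  have e2 : HasDerivAt (fun s : ℝ => sphIntegrand f (φ, θ, x + s • v))
      (fderiv ℝ f (sphPt θ φ, x) (0, v) * Real.sin θ) 0 :=
    (HasFDerivAt.comp_hasDerivAt_of_eq (l := f) 0 hfd l3 (by simp)).mul_const (Real.sin θ)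
  exact e1.unique e2

theorem fderiv_sphInt_apply [FiniteDimensional ℝ E] (hU : IsOpen U) (hO : IsOpen O)
    (hsub : ∀ y ∈ unitSph, ∀ x ∈ U, (y, x) ∈ O) (hf : ContDiffOn ℝ ∞ f O) {x : E} (hx : x ∈ U)
    (v : E) : fderiv ℝ (fun x => sphInt fun y => f (y, x)) x v
      = sphInt fun y => fderiv ℝ f (y, x) (0, v) := by
  have h2 := fderiv_intervalIntegral_apply (E := E) (a := 0) (b := Real.pi)
    (f := fun q : ℝ × E => ∫ φ in (0 : ℝ)..(2 * Real.pi), sphIntegrand f (φ, q)) hU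
    (isOpen_univ.prod hU) mem_univ_prod (contDiffOn_integral_sphIntegrand hU hO hsub hf) hx v
  have h3 : ∀ θ : ℝ, fderiv ℝ (fun q : ℝ × E => ∫ φ in (0 : ℝ)..(2 * Real.pi),
      sphIntegrand f (φ, q)) (θ, x) (0, v)
      = ∫ φ in (0 : ℝ)..(2 * Real.pi), fderiv ℝ f (sphPt θ φ, x) (0, v) * Real.sin θ := by
    intro θ
    have hx' : (θ, x) ∈ (univ ×ˢ U : Set (ℝ × E)) := ⟨trivial, hx⟩
    have h4 := fderiv_intervalIntegral_apply (E := ℝ × E) (a := 0) (b := 2 * Real.pi)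
      (f := sphIntegrand f) (isOpen_univ.prod hU) (isOpen_sphIntegrand_domain hO)
      (sphIntegrand_domain_mem hsub) (contDiffOn_sphIntegrand hf) hx' (0, v)
    rw [h4]
    simp only [fderiv_sphIntegrand_apply hO hf (hsub _ (sphPt_mem _ _) x hx)]
  unfold sphInt
  simp only [← h3]
  exact h2

end Parametric

/-! ### Averages over the rotation group -/

/-- The unit quaternions. -/
def unitQuat : Set (Fin 4 → ℝ) := {q | q 0 ^ 2 + q 1 ^ 2 + q 2 ^ 2 + q 3 ^ 2 = 1}

/-- The action `x ↦ q x q̄` of a quaternion on the spatial part of `x`. -/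
def rot (q x : Fin 4 → ℝ) : Fin 4 → ℝ :=
  ![x 0,
    (q 0 ^ 2 - q 1 ^ 2 - q 2 ^ 2 - q 3 ^ 2) * x 1 + 2 * q 1 * (q 1 * x 1 + q 2 * x 2 + q 3 * x 3)
      + 2 * q 0 * (q 2 * x 3 - q 3 * x 2),
    (q 0 ^ 2 - q 1 ^ 2 - q 2 ^ 2 - q 3 ^ 2) * x 2 + 2 * q 2 * (q 1 * x 1 + q 2 * x 2 + q 3 * x 3)
      + 2 * q 0 * (q 3 * x 1 - q 1 * x 3),
    (q 0 ^ 2 - q 1 ^ 2 - q 2 ^ 2 - q 3 ^ 2) * x 3 + 2 * q 3 * (q 1 * x 1 + q 2 * x 2 + q 3 * x 3)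
      + 2 * q 0 * (q 1 * x 2 - q 2 * x 1)]

theorem contDiff_rot : ContDiff ℝ ∞ fun p : (Fin 4 → ℝ) × (Fin 4 → ℝ) => rot p.1 p.2 := by
  rw [contDiff_pi]
  intro i
  fin_cases i <;> simp only [rot] <;> simp <;> fun_prop

theorem mink_rot {q : Fin 4 → ℝ} (hq : q ∈ unitQuat) (x : Fin 4 → ℝ) :
    mink (rot q x) (rot q x) = mink x x := by
  have h : q 0 ^ 2 + q 1 ^ 2 + q 2 ^ 2 + q 3 ^ 2 = 1 := hq
  rw [mink_self, mink_self]
  simp only [rot, Matrix.cons_val]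
  linear_combination (q 0 ^ 2 + q 1 ^ 2 + q 2 ^ 2 + q 3 ^ 2 + 1) *
    (x 1 ^ 2 + x 2 ^ 2 + x 3 ^ 2) * h

theorem rot_mem_spacelike {q x : Fin 4 → ℝ} (hq : q ∈ unitQuat) (hx : x ∈ spacelike) :
    rot q x ∈ spacelike := by
  show 0 < mink _ _
  rw [mink_rot hq]; exact hx

theorem rot_add_smul (q x v : Fin 4 → ℝ) (s : ℝ) : rot q (x + s • v) = rot q x + s • rot q v := by
  ext i
  fin_cases i <;> simp [rot] <;> ring

theorem rot_smul (q x : Fin 4 → ℝ) (s : ℝ) : rot q (s • x) = s • rot q x := by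
  ext i
  fin_cases i <;> simp [rot] <;> ring

theorem funext_fin_four {u v : Fin 4 → ℝ} (h0 : u 0 = v 0) (h1 : u 1 = v 1) (h2 : u 2 = v 2)
    (h3 : u 3 = v 3) : u = v := by
  ext a
  fin_cases a <;> assumption

theorem fin_four_cases (i : Fin 4) : i = 0 ∨ i = 1 ∨ i = 2 ∨ i = 3 := by
  revert i; decide

/-- Left multiplication of a quaternion by the `i`-th imaginary unit. -/
def quatL (i : Fin 4) (q : Fin 4 → ℝ) : Fin 4 → ℝ :=
  -q i • Pi.single 0 1 + q 0 • Pi.single i 1 + rotGen i q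

/-- Right multiplication of a quaternion by the `i`-th imaginary unit. -/
def quatR (i : Fin 4) (q : Fin 4 → ℝ) : Fin 4 → ℝ :=
  -q i • Pi.single 0 1 + q 0 • Pi.single i 1 - rotGen i q

/-- To first order (1 + s e_i) acts by the commutator [e_i, ·], which is twice the cross product
with e_i. The subtraction in the quadratic term is needed because `rot` leaves the time component
fixed instead of scaling it by |q|². -/
theorem rot_quatL (i : Fin 4) (q x : Fin 4 → ℝ) (s : ℝ) :
    rot (q + s • quatL i q) x = rot q x + s • (2 : ℝ) • rotGen i (rot q x)
      + s ^ 2 • (rot (quatL i q) x - x 0 • Pi.single 0 1) := by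
  rcases fin_four_cases i with rfl | rfl | rfl | rfl <;> apply funext_fin_four <;>
    simp only [rot, quatL, rotGen, Pi.add_apply, Pi.sub_apply, Pi.smul_apply, smul_eq_mul,
      Pi.single_apply, Matrix.cons_val, Fin.reduceEq, if_true, if_false] <;> ring

/-- For right multiplication the infinitesimal rotation acts on x before q does. -/
theorem rot_quatR (i : Fin 4) (q x : Fin 4 → ℝ) (s : ℝ) :
    rot (q + s • quatR i q) x = rot q x + s • (2 : ℝ) • rot q (rotGen i x)
      + s ^ 2 • (rot (quatR i q) x - x 0 • Pi.single 0 1) := by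
  rcases fin_four_cases i with rfl | rfl | rfl | rfl <;> apply funext_fin_four <;>
    simp only [rot, quatR, rotGen, Pi.add_apply, Pi.sub_apply, Pi.smul_apply, smul_eq_mul,
      Pi.single_apply, Matrix.cons_val, Fin.reduceEq, if_true, if_false] <;> ring

theorem hasDerivAt_quadratic {E : Type} [NormedAddCommGroup E] [NormedSpace ℝ E] (u v w : E) :
    HasDerivAt (fun s : ℝ => u + s • v + s ^ 2 • w) v 0 := by
  have h1 : HasDerivAt (fun s : ℝ => s • v) v 0 := by
    simpa using (hasDerivAt_id (0 : ℝ)).smul_const v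
  have h2 : HasDerivAt (fun s : ℝ => s ^ 2 • w) 0 0 := by
    simpa using (hasDerivAt_pow 2 (0 : ℝ)).smul_const w
  exact ((h1.const_add u).add h2).congr_deriv (add_zero v)

/-- Used to compare directional derivatives of a composite and of its outer function by following
one curve, without an expression for the full differential of the inner map. -/
theorem fderiv_eq_of_curve {E F : Type} [NormedAddCommGroup E] [NormedSpace ℝ E]
    [NormedAddCommGroup F] [NormedSpace ℝ F] {f : E → ℝ} {g : F → ℝ} {γ : ℝ → E} {δ : ℝ → F}
    {x : E} {y : F} {v : E} {w : F} (hf : DifferentiableAt ℝ f x) (hg : DifferentiableAt ℝ g y)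
    (hγ : HasDerivAt γ v 0) (hδ : HasDerivAt δ w 0) (hx : γ 0 = x) (hy : δ 0 = y)
    (h : ∀ s, f (γ s) = g (δ s)) : fderiv ℝ f x v = fderiv ℝ g y w := by
  have h1 := hf.hasFDerivAt.comp_hasDerivAt_of_eq 0 hγ hx.symm
  have h2 := hg.hasFDerivAt.comp_hasDerivAt_of_eq 0 hδ hy.symm
  have e : f ∘ γ = g ∘ δ := funext h
  rw [e] at h1
  exact h1.unique h2

/-- The quaternion `cos χ + y sin χ`. -/
noncomputable def slicePt (χ : ℝ) (y : Fin 4 → ℝ) : Fin 4 → ℝ :=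
  Real.cos χ • Pi.single 0 1 + Real.sin χ • y

/-- The `χ`-derivative of `slicePt`. -/
noncomputable def slicePt' (χ : ℝ) (y : Fin 4 → ℝ) : Fin 4 → ℝ :=
  -Real.sin χ • Pi.single 0 1 + Real.cos χ • y

theorem hasDerivAt_slicePt (χ : ℝ) (y : Fin 4 → ℝ) :
    HasDerivAt (fun χ => slicePt χ y) (slicePt' χ y) χ :=
  ((Real.hasDerivAt_cos χ).smul_const _).add ((Real.hasDerivAt_sin χ).smul_const _)

theorem contDiff_slicePt :
    ContDiff ℝ ∞ fun p : ℝ × (Fin 4 → ℝ) => slicePt p.1 p.2 := by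
  unfold slicePt
  fun_prop

theorem slicePt_mem (χ : ℝ) {y : Fin 4 → ℝ} (hy : y ∈ unitSph) : slicePt χ y ∈ unitQuat := by
  obtain ⟨h0, h1⟩ := hy
  show _ = _
  simp [slicePt, h0]
  linear_combination Real.sin_sq_add_cos_sq χ + Real.sin χ ^ 2 * h1

theorem rotGen_slicePt (i : Fin 4) (χ : ℝ) (y : Fin 4 → ℝ) :
    rotGen i (slicePt χ y) = Real.sin χ • rotGen i y := by
  ext a
  fin_cases a <;> fin_cases i <;> simp [rotGen, slicePt]

/-! ### Integration by parts on the conjugacy classes of the unit quaternions. -/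

section Slice

variable {O : Set (Fin 4 → ℝ)} {H : (Fin 4 → ℝ) → ℝ} {k : (Fin 4 → ℝ) → ℝ}

theorem isOpen_slice_preimage (hO : IsOpen O) (χ : ℝ) : IsOpen {y | slicePt χ y ∈ O} :=
  hO.preimage (contDiff_slicePt.continuous.comp (Continuous.prodMk_right χ))

theorem contDiffOn_slice (hH : ContDiffOn ℝ ∞ H O) (χ : ℝ) :
    ContDiffOn ℝ ∞ (fun y => H (slicePt χ y)) {y | slicePt χ y ∈ O} := by
  have h1 : ContDiff ℝ ∞ (slicePt χ) := by unfold slicePt; fun_prop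
  have h2 : MapsTo (slicePt χ) {y | slicePt χ y ∈ O} O := fun _ h => h
  exact ContDiffOn.comp (g := H) (f := slicePt χ) hH h1.contDiffOn h2

theorem unitSph_subset_slice (hQ : unitQuat ⊆ O) (χ : ℝ) : unitSph ⊆ {y | slicePt χ y ∈ O} :=
  fun _ hy => hQ (slicePt_mem χ hy)

theorem continuousOn_slice_fderiv (hO : IsOpen O) (hQ : unitQuat ⊆ O) (hH : ContDiffOn ℝ ∞ H O)
    (χ : ℝ) {v : (Fin 4 → ℝ) → Fin 4 → ℝ} (hv : Continuous v) :
    ContinuousOn (fun y => fderiv ℝ H (slicePt χ y) (v y)) unitSph :=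
  ((hH.continuousOn_fderiv_of_isOpen hO (by simp)).comp
    (contDiff_slicePt.continuous.comp (Continuous.prodMk_right χ)).continuousOn
    (unitSph_subset_slice hQ χ)).clm_apply hv.continuousOn

theorem continuousOn_slice (hQ : unitQuat ⊆ O) (hH : ContDiffOn ℝ ∞ H O) (χ : ℝ) :
    ContinuousOn (fun y => H (slicePt χ y)) unitSph :=
  (contDiffOn_slice hH χ).continuousOn.mono (unitSph_subset_slice hQ χ)

theorem sliceAvg_aux (hk : ContDiff ℝ ∞ k) (hO : IsOpen O) (hQ : unitQuat ⊆ O)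
    (hH : ContDiffOn ℝ ∞ H O) :
    ContDiff ℝ ∞ (fun χ => sphInt fun y => k y * H (slicePt χ y)) ∧
    ∀ χ, deriv (fun χ => sphInt fun y => k y * H (slicePt χ y)) χ
      = sphInt fun y => k y * fderiv ℝ H (slicePt χ y) (slicePt' χ y) := by
  have hm : ContDiff ℝ ∞ fun p : (Fin 4 → ℝ) × ℝ => slicePt p.2 p.1 := by
    unfold slicePt
    fun_prop
  have hO' : IsOpen {p : (Fin 4 → ℝ) × ℝ | slicePt p.2 p.1 ∈ O} := hO.preimage hm.continuous
  have hf : ContDiffOn ℝ ∞ (fun p : (Fin 4 → ℝ) × ℝ => k p.1 * H (slicePt p.2 p.1))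
      {p : (Fin 4 → ℝ) × ℝ | slicePt p.2 p.1 ∈ O} :=
    (hk.comp contDiff_fst).contDiffOn.mul (hH.comp hm.contDiffOn fun _ h => h)
  have hsub : ∀ y ∈ unitSph, ∀ χ ∈ (univ : Set ℝ),
      (y, χ) ∈ {p : (Fin 4 → ℝ) × ℝ | slicePt p.2 p.1 ∈ O} :=
    fun y hy χ _ => hQ (slicePt_mem χ hy)
  refine ⟨contDiffOn_univ.1 (contDiffOn_sphInt isOpen_univ hO' hsub hf), fun χ => ?_⟩
  rw [← fderiv_apply_one_eq_deriv, fderiv_sphInt_apply isOpen_univ hO' hsub hf (mem_univ χ) 1]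
  refine sphInt_congr fun y hy => ?_
  have hd : DifferentiableAt ℝ (fun p : (Fin 4 → ℝ) × ℝ => k p.1 * H (slicePt p.2 p.1)) (y, χ) :=
    (hf.differentiableOn (by simp)).differentiableAt (hO'.mem_nhds (hsub y hy χ trivial))
  have hHd : DifferentiableAt ℝ H (slicePt χ y) :=
    (hH.differentiableOn (by simp)).differentiableAt (hO.mem_nhds (hQ (slicePt_mem χ hy)))
  have h1 : HasDerivAt (fun s : ℝ => (y, s)) (0, 1) χ :=
    (hasDerivAt_const χ y).prodMk (hasDerivAt_id χ)
  have h2 := hd.hasFDerivAt.comp_hasDerivAt χ h1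
  have h3 := (hHd.hasFDerivAt.comp_hasDerivAt χ (hasDerivAt_slicePt χ y)).const_mul (k y)
  exact h2.unique h3

theorem contDiff_sliceAvg (hk : ContDiff ℝ ∞ k) (hO : IsOpen O) (hQ : unitQuat ⊆ O)
    (hH : ContDiffOn ℝ ∞ H O) :
    ContDiff ℝ ∞ fun χ => sphInt fun y => k y * H (slicePt χ y) := (sliceAvg_aux hk hO hQ hH).1

theorem deriv_sliceAvg (hk : ContDiff ℝ ∞ k) (hO : IsOpen O) (hQ : unitQuat ⊆ O)
    (hH : ContDiffOn ℝ ∞ H O) (χ : ℝ) :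
    deriv (fun χ => sphInt fun y => k y * H (slicePt χ y)) χ
      = sphInt fun y => k y * fderiv ℝ H (slicePt χ y) (slicePt' χ y) :=
  (sliceAvg_aux hk hO hQ hH).2 χ

theorem fderiv_slice_rotGen (hO : IsOpen O) (hQ : unitQuat ⊆ O) (hH : ContDiffOn ℝ ∞ H O)
    (i : Fin 4) (χ : ℝ) {y : Fin 4 → ℝ} (hy : y ∈ unitSph) :
    angDeriv i (fun y => H (slicePt χ y)) y
      = Real.sin χ * fderiv ℝ H (slicePt χ y) (rotGen i y) := by
  have hHd : DifferentiableAt ℝ H (slicePt χ y) :=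
    (hH.differentiableOn (by simp)).differentiableAt (hO.mem_nhds (hQ (slicePt_mem χ hy)))
  have h1 : HasFDerivAt (fun y => slicePt χ y) (Real.sin χ • ContinuousLinearMap.id ℝ _) y :=
    ((hasFDerivAt_id y).const_smul (Real.sin χ)).const_add _
  have h2 : HasFDerivAt (fun y => H (slicePt χ y)) _ y := hHd.hasFDerivAt.comp y h1
  rw [angDeriv, h2.fderiv]
  simp

/-- The direction e_i × y is tangent to the conjugacy class, so this is the integral of a rotation
derivative. The factor sin χ comes from the chain rule and cannot be divided out where it vanishes.
-/
theorem sphInt_fderiv_rotGen (hO : IsOpen O) (hQ : unitQuat ⊆ O) (hH : ContDiffOn ℝ ∞ H O)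
    (i : Fin 4) (χ : ℝ) :
    sphInt (fun y => Real.sin χ * fderiv ℝ H (slicePt χ y) (rotGen i y)) = 0 := by
  rw [← sphInt_angDeriv (isOpen_slice_preimage hO χ) (unitSph_subset_slice hQ χ)
    ((contDiffOn_slice hH χ).of_le (by simp)) i]
  exact sphInt_congr fun y hy => (fderiv_slice_rotGen hO hQ hH i χ hy).symm

theorem sphInt_coord_mul_fderiv_rotGen (hO : IsOpen O) (hQ : unitQuat ⊆ O)
    (hH : ContDiffOn ℝ ∞ H O) (j k : Fin 4) (χ : ℝ) :
    sphInt (fun y => rotGen k y j * H (slicePt χ y)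
      + Real.sin χ * (y j * fderiv ℝ H (slicePt χ y) (rotGen k y))) = 0 := by
  have hc : ContDiffOn ℝ ∞ (fun y : Fin 4 → ℝ => y j * H (slicePt χ y)) {y | slicePt χ y ∈ O} :=
    (by fun_prop : ContDiff ℝ ∞ fun y : Fin 4 → ℝ => y j).contDiffOn.mul (contDiffOn_slice hH χ)
  rw [← sphInt_angDeriv (isOpen_slice_preimage hO χ) (unitSph_subset_slice hQ χ)
    (hc.of_le (by simp)) k]
  refine sphInt_congr fun y hy => ?_
  have hd : DifferentiableAt ℝ (fun y => H (slicePt χ y)) y :=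
    ((contDiffOn_slice hH χ).differentiableOn (by simp)).differentiableAt
      ((isOpen_slice_preimage hO χ).mem_nhds (unitSph_subset_slice hQ χ hy))
  have h1 : HasFDerivAt (fun y : Fin 4 → ℝ => y j)
      (ContinuousLinearMap.proj (R := ℝ) (φ := fun _ : Fin 4 => ℝ) j) y :=
    (ContinuousLinearMap.proj (R := ℝ) (φ := fun _ : Fin 4 => ℝ) j).hasFDerivAt
  have h2 := fderiv_slice_rotGen hO hQ hH k χ hy
  rw [angDeriv] at h2 ⊢
  have h3 : HasFDerivAt (fun y : Fin 4 → ℝ => y j * H (slicePt χ y)) _ y := h1.mul hd.hasFDerivAt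
  rw [h3.fderiv]
  simp only [add_apply, smul_apply, smul_eq_mul, h2, ContinuousLinearMap.proj_apply]
  ring

/-- On the sphere the tangential part of e_i is -(y_j L_k - y_k L_j); integrating both rotation
derivatives by parts gives y_i twice. Equivalently, the divergence of this field on the sphere is -2
y_i. -/
theorem sphInt_tangential_of_cyclic (hO : IsOpen O) (hQ : unitQuat ⊆ O) (hH : ContDiffOn ℝ ∞ H O)
    {i j k : Fin 4} (hjk : ∀ y, rotGen k y j = y i) (hkj : ∀ y, rotGen j y k = -y i)
    (hv : ∀ y ∈ unitSph, Pi.single i 1 - y i • y = -(y j • rotGen k y - y k • rotGen j y)) (χ : ℝ) :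
    sphInt (fun y => Real.sin χ * fderiv ℝ H (slicePt χ y) (Pi.single i 1 - y i • y))
      = 2 * sphInt fun y => y i * H (slicePt χ y) := by
  have h1 := sphInt_coord_mul_fderiv_rotGen hO hQ hH j k χ
  have h2 := sphInt_coord_mul_fderiv_rotGen hO hQ hH k j χ
  have cH := continuousOn_slice hQ hH χ
  have c1 := continuousOn_slice_fderiv hO hQ hH χ (continuous_rotGen k)
  have c2 := continuousOn_slice_fderiv hO hQ hH χ (continuous_rotGen j)
  have cc : ∀ l : Fin 4, ContinuousOn (fun y : Fin 4 → ℝ => y l) unitSph := fun l => by fun_prop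
  have c3 : ContinuousOn (fun y => rotGen k y j * H (slicePt χ y)
      + Real.sin χ * (y j * fderiv ℝ H (slicePt χ y) (rotGen k y))) unitSph := by
    simp only [hjk]
    exact ((cc i).mul cH).add (continuousOn_const.mul ((cc j).mul c1))
  have c4 : ContinuousOn (fun y => rotGen j y k * H (slicePt χ y)
      + Real.sin χ * (y k * fderiv ℝ H (slicePt χ y) (rotGen j y))) unitSph := by
    simp only [hkj]
    exact ((cc i).neg.mul cH).add (continuousOn_const.mul ((cc k).mul c2))
  have c5 : ContinuousOn (fun y => 2 * (y i * H (slicePt χ y))) unitSph :=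
    continuousOn_const.mul ((cc i).mul cH)
  have h4 := sphInt_sub c3 c4
  rw [h1, h2, sub_zero] at h4
  have h3 := sphInt_sub c5 (c3.fun_sub c4 : ContinuousOn (fun y => (rotGen k y j * H (slicePt χ y)
      + Real.sin χ * (y j * fderiv ℝ H (slicePt χ y) (rotGen k y)))
      - (rotGen j y k * H (slicePt χ y)
      + Real.sin χ * (y k * fderiv ℝ H (slicePt χ y) (rotGen j y)))) unitSph)
  rw [h4, sub_zero, sphInt_const_mul] at h3
  rw [← h3]
  refine sphInt_congr fun y hy => ?_
  rw [hv y hy]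
  simp only [map_neg, map_sub, map_smul, smul_eq_mul, hjk, hkj]
  ring

theorem sphInt_tangential (hO : IsOpen O) (hQ : unitQuat ⊆ O) (hH : ContDiffOn ℝ ∞ H O)
    {i : Fin 4} (hi : i ≠ 0) (χ : ℝ) :
    sphInt (fun y => Real.sin χ * fderiv ℝ H (slicePt χ y) (Pi.single i 1 - y i • y))
      = 2 * sphInt fun y => y i * H (slicePt χ y) := by
  have hi : i = 1 ∨ i = 2 ∨ i = 3 := by revert i; decide
  rcases hi with rfl | rfl | rfl
  · refine sphInt_tangential_of_cyclic hO hQ hH (j := 2) (k := 3) (fun y => rfl) (fun y => rfl)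
      (fun y hy => ?_) χ
    obtain ⟨h0, h1⟩ := hy
    ext a
    fin_cases a <;> simp [rotGen, h0] <;> linarith
  · refine sphInt_tangential_of_cyclic hO hQ hH (j := 3) (k := 1) (fun y => rfl) (fun y => rfl)
      (fun y hy => ?_) χ
    obtain ⟨h0, h1⟩ := hy
    ext a
    fin_cases a <;> simp [rotGen, h0] <;> linarith
  · refine sphInt_tangential_of_cyclic hO hQ hH (j := 1) (k := 2) (fun y => rfl) (fun y => rfl)
      (fun y hy => ?_) χ
    obtain ⟨h0, h1⟩ := hy
    ext a
    fin_cases a <;> simp [rotGen, h0] <;> linarith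

/-- The mean over a conjugacy class of the derivative along a left-translation of the
rotation group. -/
theorem sin_mul_sphInt_quatL (hO : IsOpen O) (hQ : unitQuat ⊆ O) (hH : ContDiffOn ℝ ∞ H O)
    (i : Fin 4) (χ : ℝ) :
    Real.sin χ * sphInt (fun y => fderiv ℝ H (slicePt χ y) (quatL i (slicePt χ y)))
      = Real.sin χ * deriv (fun χ => sphInt fun y => y i * H (slicePt χ y)) χ
        + 2 * Real.cos χ * sphInt fun y => y i * H (slicePt χ y) := by
  by_cases hi : i = 0
  · subst hi
    have e1 : sphInt (fun y => fderiv ℝ H (slicePt χ y) (quatL 0 (slicePt χ y))) = 0 := by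
      rw [sphInt_congr (l := fun _ => 0)]
      · simpa using sphInt_const 0
      · intro y _
        simp [quatL, rotGen_zero]
    have e2 : ∀ χ, sphInt (fun y => y 0 * H (slicePt χ y)) = 0 := by
      intro χ
      rw [sphInt_congr (l := fun _ => 0)]
      · simpa using sphInt_const 0
      · intro y hy
        simp [hy.1]
    simp [e1, e2]
  · rw [deriv_sliceAvg (by fun_prop) hO hQ hH]
    have ht := sphInt_tangential hO hQ hH hi χ
    have hr := sphInt_fderiv_rotGen hO hQ hH i χ
    have c0 := continuousOn_slice_fderiv hO hQ hH χ
      (continuous_const : Continuous fun _ => (Pi.single 0 1 : Fin 4 → ℝ))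
    have ci := continuousOn_slice_fderiv hO hQ hH χ
      (continuous_const : Continuous fun _ => (Pi.single i 1 : Fin 4 → ℝ))
    have cy := continuousOn_slice_fderiv hO hQ hH χ (continuous_id : Continuous fun y => y)
    have cr := continuousOn_slice_fderiv hO hQ hH χ (continuous_rotGen i)
    have cc : ContinuousOn (fun y : Fin 4 → ℝ => y i) unitSph := by fun_prop
    have k0 : ∀ c : ℝ, ContinuousOn
        (fun y => c * (y i * fderiv ℝ H (slicePt χ y) (Pi.single 0 1))) unitSph :=
      fun c => continuousOn_const.mul (cc.mul c0)
    have ki : ∀ c : ℝ, ContinuousOn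
        (fun y => c * fderiv ℝ H (slicePt χ y) (Pi.single i 1)) unitSph :=
      fun c => continuousOn_const.mul ci
    have ky : ∀ c : ℝ, ContinuousOn
        (fun y => c * (y i * fderiv ℝ H (slicePt χ y) y)) unitSph :=
      fun c => continuousOn_const.mul (cc.mul cy)
    have kr : ContinuousOn
        (fun y => Real.sin χ * fderiv ℝ H (slicePt χ y) (rotGen i y)) unitSph :=
      continuousOn_const.mul cr
    -- At q = cos χ + y sin χ one has e_i q = -y_i sin χ + cos χ e_i + sin χ e_i × y, and the last
    -- term integrates to zero.
    have e1 : sphInt (fun y => fderiv ℝ H (slicePt χ y) (quatL i (slicePt χ y)))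
        = -Real.sin χ * sphInt (fun y => y i * fderiv ℝ H (slicePt χ y) (Pi.single 0 1))
          + Real.cos χ * sphInt (fun y => fderiv ℝ H (slicePt χ y) (Pi.single i 1)) := by
      have e : ∀ y ∈ unitSph, fderiv ℝ H (slicePt χ y) (quatL i (slicePt χ y))
          = (-Real.sin χ * (y i * fderiv ℝ H (slicePt χ y) (Pi.single 0 1))
            + Real.cos χ * fderiv ℝ H (slicePt χ y) (Pi.single i 1))
            + Real.sin χ * fderiv ℝ H (slicePt χ y) (rotGen i y) := by
        intro y hy
        have s0 : slicePt χ y 0 = Real.cos χ := by simp [slicePt, hy.1]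
        have si : slicePt χ y i = Real.sin χ * y i := by simp [slicePt, hi]
        rw [quatL, rotGen_slicePt, s0, si]
        simp only [map_add, map_smul, smul_eq_mul]
        ring
      rw [sphInt_congr e, sphInt_add ((k0 _).fun_add (ki _)) kr, hr, add_zero,
        sphInt_add (k0 _) (ki _), sphInt_const_mul, sphInt_const_mul]
    have e2 : sphInt (fun y => y i * fderiv ℝ H (slicePt χ y) (slicePt' χ y))
        = -Real.sin χ * sphInt (fun y => y i * fderiv ℝ H (slicePt χ y) (Pi.single 0 1))
          + Real.cos χ * sphInt (fun y => y i * fderiv ℝ H (slicePt χ y) y) := by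
      rw [← sphInt_const_mul, ← sphInt_const_mul, ← sphInt_add (k0 _) (ky _)]
      refine sphInt_congr fun y _ => ?_
      simp only [slicePt', map_add, map_smul, smul_eq_mul]
      ring
    have e3 : sphInt (fun y => Real.sin χ * fderiv ℝ H (slicePt χ y) (Pi.single i 1 - y i • y))
        = Real.sin χ * sphInt (fun y => fderiv ℝ H (slicePt χ y) (Pi.single i 1))
          - Real.sin χ * sphInt (fun y => y i * fderiv ℝ H (slicePt χ y) y) := by
      rw [← sphInt_const_mul, ← sphInt_const_mul, ← sphInt_sub (ki _) (ky _)]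
      refine sphInt_congr fun y _ => ?_
      simp only [map_sub, map_smul, smul_eq_mul]
      ring
    -- The tangential part of e_i supplies the term with 2 cos χ; its radial part recombines with
    -- -y_i sin χ into y_i times the χ-derivative of q.
    rw [e3] at ht
    rw [e1, e2]
    linear_combination Real.cos χ * ht

end Slice

/-! ### Rotation derivatives along the orbits of the quaternion action. -/

section Orbit

variable {W : (Fin 4 → ℝ) → ℝ} {x q : Fin 4 → ℝ}

theorem isOpen_orbit_preimage (x : Fin 4 → ℝ) : IsOpen {q | rot q x ∈ spacelike} :=
  isOpen_spacelike.preimage (contDiff_rot.continuous.comp (Continuous.prodMk_left x))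

theorem unitQuat_subset_orbit (hx : x ∈ spacelike) : unitQuat ⊆ {q | rot q x ∈ spacelike} :=
  fun _ hq => rot_mem_spacelike hq hx

theorem contDiffOn_orbit (hW : ConeSmooth W) (x : Fin 4 → ℝ) :
    ContDiffOn ℝ ∞ (fun q => W (rot q x)) {q | rot q x ∈ spacelike} := by
  have h : ContDiff ℝ ∞ fun q => rot q x :=
    contDiff_rot.comp (contDiff_id.prodMk contDiff_const)
  exact ContDiffOn.comp hW h.contDiffOn fun _ h => h

theorem differentiableAt_orbit (hW : ConeSmooth W) (hx : x ∈ spacelike) (hq : q ∈ unitQuat) :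
    DifferentiableAt ℝ (fun q => W (rot q x)) q :=
  ((contDiffOn_orbit hW x).differentiableOn (by simp)).differentiableAt
    ((isOpen_orbit_preimage x).mem_nhds (unitQuat_subset_orbit hx hq))

/-- The factor 2 is the doubling of angles in the covering of the rotation group by the unit
quaternions. -/
theorem fderiv_orbit_quatL (hW : ConeSmooth W) (hx : x ∈ spacelike) (hq : q ∈ unitQuat)
    (i : Fin 4) :
    fderiv ℝ (fun q => W (rot q x)) q (quatL i q) = 2 * angDeriv i W (rot q x) := by
  have h := fderiv_eq_of_curve (γ := fun s : ℝ => q + s • quatL i q)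
    (differentiableAt_orbit hW hx hq)
    (hW.differentiableAt (rot_mem_spacelike hq hx))
    (by simpa using hasDerivAt_quadratic q (quatL i q) 0) (hasDerivAt_quadratic _ _ _)
    (by simp) (by simp) fun s => congrArg W (rot_quatL i q x s)
  rw [h, map_smul, smul_eq_mul, angDeriv]

theorem fderiv_orbit_quatR (hW : ConeSmooth W) (hx : x ∈ spacelike) (hq : q ∈ unitQuat)
    (i : Fin 4) :
    fderiv ℝ (fun q => W (rot q x)) q (quatR i q)
      = 2 * fderiv ℝ W (rot q x) (rot q (rotGen i x)) := by
  have h := fderiv_eq_of_curve (γ := fun s : ℝ => q + s • quatR i q)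
    (differentiableAt_orbit hW hx hq)
    (hW.differentiableAt (rot_mem_spacelike hq hx))
    (by simpa using hasDerivAt_quadratic q (quatR i q) 0) (hasDerivAt_quadratic _ _ _)
    (by simp) (by simp) fun s => congrArg W (rot_quatR i q x s)
  rw [h, map_smul, smul_eq_mul]

theorem continuousOn_orbit_slice (hW : ConeSmooth W) (hx : x ∈ spacelike) (χ : ℝ) :
    ContinuousOn (fun y => W (rot (slicePt χ y) x)) unitSph :=
  continuousOn_slice (unitQuat_subset_orbit hx) (contDiffOn_orbit hW x) χ

theorem coneSmooth_fderiv_apply (hW : ConeSmooth W) {v : (Fin 4 → ℝ) → Fin 4 → ℝ}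
    (hv : ContDiff ℝ ∞ v) : ConeSmooth fun x => fderiv ℝ W x (v x) :=
  (ContDiffOn.fderiv_of_isOpen hW isOpen_spacelike (by simp)).clm_apply hv.contDiffOn

theorem contDiff_rotGen (i : Fin 4) : ContDiff ℝ ∞ (rotGen i) := by
  rw [contDiff_pi]
  intro a
  fin_cases a <;> fin_cases i <;> simp [rotGen] <;> fun_prop

theorem ConeSmooth.angDeriv (hW : ConeSmooth W) (i : Fin 4) : ConeSmooth (angDeriv i W) :=
  coneSmooth_fderiv_apply hW (contDiff_rotGen i)

/-- The mean over a conjugacy class of rotations of the derivative along a rotation. -/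
theorem sin_mul_sphInt_angDeriv (hW : ConeSmooth W) (hx : x ∈ spacelike) (i : Fin 4) (χ : ℝ) :
    Real.sin χ * sphInt (fun y => angDeriv i W (rot (slicePt χ y) x))
      = 1 / 2 * (Real.sin χ * deriv (fun χ => sphInt fun y => y i * W (rot (slicePt χ y) x)) χ
        + 2 * Real.cos χ * sphInt fun y => y i * W (rot (slicePt χ y) x)) := by
  rw [← sin_mul_sphInt_quatL (isOpen_orbit_preimage x) (unitQuat_subset_orbit hx)
    (contDiffOn_orbit hW x) i χ, sphInt_congr fun y hy =>
      fderiv_orbit_quatL hW hx (slicePt_mem χ hy) i, sphInt_const_mul]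
  ring

/-- The two sides are derivatives along q e_i and along e_i q. These directions differ by 2 sin χ
e_i × y, tangent to the conjugacy class, so the means agree. -/
theorem sphInt_angDeriv_rot (hW : ConeSmooth W) (hx : x ∈ spacelike) (i : Fin 4) (χ : ℝ) :
    sphInt (fun y => fderiv ℝ W (rot (slicePt χ y) x) (rot (slicePt χ y) (rotGen i x)))
      = sphInt fun y => angDeriv i W (rot (slicePt χ y) x) := by
  have h0 := sphInt_fderiv_rotGen (isOpen_orbit_preimage x) (unitQuat_subset_orbit hx)
    (contDiffOn_orbit hW x) i χ
  have e : ∀ y ∈ unitSph,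
      fderiv ℝ W (rot (slicePt χ y) x) (rot (slicePt χ y) (rotGen i x))
        = angDeriv i W (rot (slicePt χ y) x)
          - Real.sin χ * fderiv ℝ (fun q => W (rot q x)) (slicePt χ y) (rotGen i y) := by
    intro y hy
    have hL := fderiv_orbit_quatL hW hx (slicePt_mem χ hy) i
    have hR := fderiv_orbit_quatR hW hx (slicePt_mem χ hy) i
    have hs : quatL i (slicePt χ y) - quatR i (slicePt χ y)
        = (2 * Real.sin χ) • rotGen i y := by
      rw [quatL, quatR, rotGen_slicePt]
      module
    have h := congrArg (fderiv ℝ (fun q => W (rot q x)) (slicePt χ y)) hs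
    rw [map_sub, map_smul, hL, hR, smul_eq_mul] at h
    linarith
  have c := continuousOn_slice_fderiv (isOpen_orbit_preimage x) (unitQuat_subset_orbit hx)
    (contDiffOn_orbit hW x) χ (continuous_rotGen i)
  rw [sphInt_congr e, sphInt_sub (continuousOn_orbit_slice (hW.angDeriv i) hx χ)
    (continuousOn_const.fun_mul c), h0, sub_zero]

/-- The mean of the radial component of the gradient over a conjugacy class of rotations. -/
theorem sum_sphInt_coord_mul_angDeriv (hW : ConeSmooth W) (hx : x ∈ spacelike) (χ : ℝ) :
    ∑ i, sphInt (fun y => y i * angDeriv i W (rot (slicePt χ y) x))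
      = 1 / 2 * deriv (fun χ => sphInt fun y => W (rot (slicePt χ y) x)) χ := by
  have hd := deriv_sliceAvg (k := fun _ => 1) contDiff_const (isOpen_orbit_preimage x)
    (unitQuat_subset_orbit hx) (contDiffOn_orbit hW x) χ
  simp only [one_mul] at hd
  rw [hd, ← sphInt_sum fun i _ => (by fun_prop : ContinuousOn (fun y : Fin 4 → ℝ => y i)
    unitSph).fun_mul (continuousOn_orbit_slice (hW.angDeriv i) hx χ), ← sphInt_const_mul]
  refine sphInt_congr fun y hy => ?_
  -- Since y² = -1, the χ-derivative of cos χ + y sin χ is the quaternion product y q.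
  have hs : slicePt' χ y = ∑ i, y i • quatL i (slicePt χ y) := by
    have h2 : y 1 ^ 2 + y 2 ^ 2 + y 3 ^ 2 = 1 := hy.2
    apply funext_fin_four <;>
      simp only [slicePt', slicePt, quatL, rotGen, Fin.sum_univ_four, hy.1, Pi.add_apply,
        Pi.smul_apply, smul_eq_mul, Pi.single_apply, Matrix.cons_val, Fin.reduceEq, if_true,
        if_false]
    · linear_combination Real.sin χ * h2
    all_goals ring1
  rw [hs, map_sum, Finset.mul_sum]
  refine Finset.sum_congr rfl fun i _ => ?_
  rw [map_smul, fderiv_orbit_quatL hW hx (slicePt_mem χ hy), smul_eq_mul]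
  ring

end Orbit

/-! ### Weighted averages over rotations -/

/-- The average of `W` over rotations, with a weight depending on the rotation angle. -/
noncomputable def wAvg (w : ℝ → ℝ) (W : (Fin 4 → ℝ) → ℝ) (x : Fin 4 → ℝ) : ℝ :=
  ∫ χ in (0 : ℝ)..Real.pi, sphInt fun y => w χ * W (rot (slicePt χ y) x)

section WAvg

variable {w : ℝ → ℝ} {W W' : (Fin 4 → ℝ) → ℝ} {x : Fin 4 → ℝ}

/-- The integrand of `wAvg`. -/
noncomputable def wIntegrand (w : ℝ → ℝ) (W : (Fin 4 → ℝ) → ℝ)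
    (p : (Fin 4 → ℝ) × ℝ × (Fin 4 → ℝ)) : ℝ := w p.2.1 * W (rot (slicePt p.2.1 p.1) p.2.2)

/-- The domain of `wIntegrand`. -/
def wDomain : Set ((Fin 4 → ℝ) × ℝ × (Fin 4 → ℝ)) :=
  {p | rot (slicePt p.2.1 p.1) p.2.2 ∈ spacelike}

theorem contDiff_rot_slicePt : ContDiff ℝ ∞ fun p : (Fin 4 → ℝ) × ℝ × (Fin 4 → ℝ) =>
    rot (slicePt p.2.1 p.1) p.2.2 := by
  have h : ContDiff ℝ ∞ fun p : (Fin 4 → ℝ) × ℝ × (Fin 4 → ℝ) => slicePt p.2.1 p.1 := by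
    unfold slicePt; fun_prop
  exact contDiff_rot.comp (h.prodMk (by fun_prop))

theorem isOpen_wDomain : IsOpen wDomain :=
  isOpen_spacelike.preimage contDiff_rot_slicePt.continuous

theorem mem_wDomain : ∀ y ∈ unitSph, ∀ p ∈ (univ ×ˢ spacelike : Set (ℝ × (Fin 4 → ℝ))),
    (y, p) ∈ wDomain :=
  fun _ hy p hp => rot_mem_spacelike (slicePt_mem p.1 hy) hp.2

theorem contDiffOn_wIntegrand (hw : ContDiff ℝ ∞ w) (hW : ConeSmooth W) :
    ContDiffOn ℝ ∞ (wIntegrand w W) wDomain := by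
  have h : ContDiff ℝ ∞ fun p : (Fin 4 → ℝ) × ℝ × (Fin 4 → ℝ) => w p.2.1 :=
    hw.comp (by fun_prop)
  exact h.contDiffOn.mul (ContDiffOn.comp hW contDiff_rot_slicePt.contDiffOn fun _ h => h)

theorem contDiffOn_sphInt_wIntegrand (hw : ContDiff ℝ ∞ w) (hW : ConeSmooth W) :
    ContDiffOn ℝ ∞ (fun p : ℝ × (Fin 4 → ℝ) => sphInt fun y => wIntegrand w W (y, p))
      (univ ×ˢ spacelike) :=
  contDiffOn_sphInt (isOpen_univ.prod isOpen_spacelike) isOpen_wDomain mem_wDomain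
    (contDiffOn_wIntegrand hw hW)

theorem coneSmooth_wAvg (hw : ContDiff ℝ ∞ w) (hW : ConeSmooth W) : ConeSmooth (wAvg w W) :=
  contDiffOn_intervalIntegral (E := Fin 4 → ℝ) (F := ℝ) (a := 0) (b := Real.pi)
    (f := fun p : ℝ × (Fin 4 → ℝ) => sphInt fun y => wIntegrand w W (y, p)) isOpen_spacelike
    (isOpen_univ.prod isOpen_spacelike) (fun _ _ _ hx => ⟨trivial, hx⟩)
    (contDiffOn_sphInt_wIntegrand hw hW)

theorem fderiv_wIntegrand (hW : ConeSmooth W) (hw : ContDiff ℝ ∞ w) (hx : x ∈ spacelike)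
    {y : Fin 4 → ℝ} (hy : y ∈ unitSph) (χ : ℝ) (v : Fin 4 → ℝ) :
    fderiv ℝ (wIntegrand w W) (y, χ, x) (0, 0, v)
      = w χ * fderiv ℝ W (rot (slicePt χ y) x) (rot (slicePt χ y) v) := by
  have hm : rot (slicePt χ y) x ∈ spacelike := rot_mem_spacelike (slicePt_mem χ hy) hx
  have hd : DifferentiableAt ℝ (wIntegrand w W) (y, χ, x) :=
    ((contDiffOn_wIntegrand hw hW).differentiableOn (by simp)).differentiableAt
      (isOpen_wDomain.mem_nhds hm)
  have h1 : HasDerivAt (fun s : ℝ => (y, χ, x + s • v)) ((0 : Fin 4 → ℝ), (0 : ℝ), v) 0 :=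
    (hasDerivAt_const 0 y).prodMk ((hasDerivAt_const 0 χ).prodMk
      (by simpa using hasDerivAt_quadratic x v 0))
  have h := fderiv_eq_of_curve (g := fun z => w χ * W z)
    (δ := fun s : ℝ => rot (slicePt χ y) x + s • rot (slicePt χ y) v)
    hd ((hW.differentiableAt hm).const_mul (w χ)) h1
    (by simpa using hasDerivAt_quadratic (rot (slicePt χ y) x) (rot (slicePt χ y) v) 0)
    (by simp) (by simp) fun s => by
      show w χ * W (rot (slicePt χ y) (x + s • v)) = _
      rw [rot_add_smul]
  rw [h, fderiv_const_mul (hW.differentiableAt hm)]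
  simp

theorem fderiv_wAvg (hw : ContDiff ℝ ∞ w) (hW : ConeSmooth W) (hx : x ∈ spacelike)
    (v : Fin 4 → ℝ) : fderiv ℝ (wAvg w W) x v = ∫ χ in (0 : ℝ)..Real.pi,
      sphInt fun y => w χ * fderiv ℝ W (rot (slicePt χ y) x) (rot (slicePt χ y) v) := by
  have h := fderiv_intervalIntegral_apply (a := 0) (b := Real.pi)
    (f := fun p : ℝ × (Fin 4 → ℝ) => sphInt fun y => wIntegrand w W (y, p)) isOpen_spacelike
    (isOpen_univ.prod isOpen_spacelike) (fun _ _ _ hx => ⟨trivial, hx⟩)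
    (contDiffOn_sphInt_wIntegrand hw hW) hx v
  refine h.trans (intervalIntegral.integral_congr fun χ _ => ?_)
  refine (fderiv_sphInt_apply (isOpen_univ.prod isOpen_spacelike) isOpen_wDomain mem_wDomain
    (contDiffOn_wIntegrand hw hW) (x := (χ, x)) ⟨trivial, hx⟩ (0, v)).trans ?_
  exact sphInt_congr fun y hy => fderiv_wIntegrand hW hw hx hy χ v

theorem wAvg_congr (h : ∀ y ∈ spacelike, W y = W' y) (hx : x ∈ spacelike) :
    wAvg w W x = wAvg w W' x :=
  intervalIntegral.integral_congr fun χ _ => sphInt_congr fun y hy => by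
    rw [h _ (rot_mem_spacelike (slicePt_mem χ hy) hx)]

theorem wAvg_mul_of_invariant {c : (Fin 4 → ℝ) → ℝ} (hc : ∀ q ∈ unitQuat, c (rot q x) = c x) :
    wAvg w (fun y => c y * W y) x = c x * wAvg w W x := by
  rw [wAvg, wAvg, ← intervalIntegral.integral_const_mul]
  refine intervalIntegral.integral_congr fun χ _ => ?_
  show _ = c x * sphInt _
  rw [← sphInt_const_mul]
  refine sphInt_congr fun y hy => ?_
  rw [hc _ (slicePt_mem χ hy)]
  ring

theorem HomDeg.wAvg {k : ℤ} (h : HomDeg k W) : HomDeg k (wAvg w W) := by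
  intro x hx c hc
  rw [DeSitter.wAvg, DeSitter.wAvg, ← intervalIntegral.integral_const_mul]
  refine intervalIntegral.integral_congr fun χ _ => ?_
  show _ = c ^ k * sphInt _
  rw [← sphInt_const_mul]
  refine sphInt_congr fun y hy => ?_
  rw [rot_smul, h _ (rot_mem_spacelike (slicePt_mem χ hy) hx) c hc]
  ring

theorem rot_single_zero {q : Fin 4 → ℝ} : rot q (Pi.single 0 1) = Pi.single 0 1 := by
  apply funext_fin_four <;> simp [rot]

/-- Rotations fix the time axis. -/
theorem D_zero_wAvg (hw : ContDiff ℝ ∞ w) (hW : ConeSmooth W) (hx : x ∈ spacelike) :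
    D 0 (wAvg w W) x = wAvg w (D 0 W) x := by
  rw [D, fderiv_wAvg hw hW hx]
  simp only [rot_single_zero]
  rfl

/-- The weight depends on the rotation angle only, so the average runs over whole conjugacy classes
and commutes with rotations. -/
theorem angDeriv_wAvg (hw : ContDiff ℝ ∞ w) (hW : ConeSmooth W) (hx : x ∈ spacelike)
    (i : Fin 4) : angDeriv i (wAvg w W) x = wAvg w (angDeriv i W) x := by
  rw [angDeriv, fderiv_wAvg hw hW hx]
  refine intervalIntegral.integral_congr fun χ _ => ?_
  simp only [sphInt_const_mul]
  rw [sphInt_angDeriv_rot hW hx]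

theorem intervalIntegrable_wAvg (hw : ContDiff ℝ ∞ w) (hW : ConeSmooth W) (hx : x ∈ spacelike)
    {a b : ℝ} : IntervalIntegrable
      (fun χ => sphInt fun y => w χ * W (rot (slicePt χ y) x)) volume a b :=
  ContinuousOn.intervalIntegrable <| (contDiffOn_sphInt_wIntegrand hw hW).continuousOn.comp
    (f := fun χ => (χ, x)) (by fun_prop) fun _ _ => ⟨trivial, hx⟩

theorem wAvg_sum {F : Fin 4 → (Fin 4 → ℝ) → ℝ} (hw : ContDiff ℝ ∞ w)
    (hF : ∀ i, ConeSmooth (F i)) (hx : x ∈ spacelike) :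
    wAvg w (fun y => ∑ i, F i y) x = ∑ i, wAvg w (F i) x := by
  simp only [wAvg]
  rw [← intervalIntegral.integral_finsetSum fun i _ => intervalIntegrable_wAvg hw (hF i) hx]
  refine intervalIntegral.integral_congr fun χ _ => ?_
  simp only [sphInt_const_mul]
  rw [← Finset.mul_sum, sphInt_sum fun i _ => continuousOn_orbit_slice (hF i) hx χ]

end WAvg

/-! ### Inversion of the Laplacian of the sphere -/

section Parts

variable {a : ℝ → ℝ}

/-- The difference of the integrands is the derivative of (π - χ) cos χ sin χ · a, which vanishes at
both ends. -/
theorem integral_conj_weight (ha : ContDiff ℝ ∞ a) :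
    ∫ χ in (0 : ℝ)..Real.pi, (Real.pi - χ) * Real.cos χ *
        (Real.sin χ * deriv a χ + 2 * Real.cos χ * a χ)
      = ∫ χ in (0 : ℝ)..Real.pi, (Real.pi - χ + Real.cos χ * Real.sin χ) * a χ := by
  have hc : Continuous a := ha.continuous
  have hc' : Continuous (deriv a) := ha.continuous_deriv (by simp)
  have hd : ∀ χ, HasDerivAt a (deriv a χ) χ := fun χ =>
    (ha.differentiable (by simp)).differentiableAt.hasDerivAt
  have h := intervalIntegral.integral_eq_sub_of_hasDerivAt (a := 0) (b := Real.pi)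
    (f := fun χ => (Real.pi - χ) * Real.cos χ * Real.sin χ * a χ) (fun χ _ =>
      (((((hasDerivAt_id χ).const_sub Real.pi).mul (Real.hasDerivAt_cos χ)).mul
        (Real.hasDerivAt_sin χ)).mul (hd χ))) (by
      apply Continuous.intervalIntegrable
      simp only [Pi.mul_apply]
      fun_prop)
  rw [← sub_eq_zero, ← intervalIntegral.integral_sub (by
    apply Continuous.intervalIntegrable; fun_prop) (by
    apply Continuous.intervalIntegrable; fun_prop)]
  refine Eq.trans ?_ (h.trans (by simp))
  refine intervalIntegral.integral_congr fun χ _ => ?_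
  have := Real.sin_sq_add_cos_sq χ
  simp only [Pi.mul_apply, id]
  linear_combination (Real.pi - χ) * a χ * this

/-- The weight has derivative -2 sin² χ, vanishes at π and equals π at 0. The resulting boundary
term at χ = 0 plays the role of the delta function of the Green kernel. -/
theorem integral_weight_deriv (ha : ContDiff ℝ ∞ a) :
    ∫ χ in (0 : ℝ)..Real.pi, (Real.pi - χ + Real.cos χ * Real.sin χ) * deriv a χ
      = -Real.pi * a 0 + 2 * ∫ χ in (0 : ℝ)..Real.pi, Real.sin χ ^ 2 * a χ := by
  have hc : Continuous a := ha.continuous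
  have hc' : Continuous (deriv a) := ha.continuous_deriv (by simp)
  have hd : ∀ χ, HasDerivAt a (deriv a χ) χ := fun χ =>
    (ha.differentiable (by simp)).differentiableAt.hasDerivAt
  have h := intervalIntegral.integral_eq_sub_of_hasDerivAt (a := 0) (b := Real.pi)
    (f := fun χ => (Real.pi - χ + Real.cos χ * Real.sin χ) * a χ)
    (f' := fun χ => (Real.pi - χ + Real.cos χ * Real.sin χ) * deriv a χ
      - 2 * (Real.sin χ ^ 2 * a χ)) (fun χ _ => by
      have := ((((hasDerivAt_id χ).const_sub Real.pi).add ((Real.hasDerivAt_cos χ).mul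
        (Real.hasDerivAt_sin χ))).mul (hd χ))
      refine this.congr_deriv ?_
      have := Real.sin_sq_add_cos_sq χ
      simp only [Pi.mul_apply, Pi.add_apply, id]
      linear_combination a χ * this) (by
      apply Continuous.intervalIntegrable; fun_prop)
  rw [intervalIntegral.integral_sub (by apply Continuous.intervalIntegrable; fun_prop) (by
    apply Continuous.intervalIntegrable; fun_prop), intervalIntegral.integral_const_mul] at h
  simp at h
  linarith

/-- The integrand is the derivative of sin² χ · a. -/
theorem integral_sin_conj (ha : ContDiff ℝ ∞ a) :
    ∫ χ in (0 : ℝ)..Real.pi, Real.sin χ *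
        (Real.sin χ * deriv a χ + 2 * Real.cos χ * a χ) = 0 := by
  have hc : Continuous a := ha.continuous
  have hc' : Continuous (deriv a) := ha.continuous_deriv (by simp)
  have hd : ∀ χ, HasDerivAt a (deriv a χ) χ := fun χ =>
    (ha.differentiable (by simp)).differentiableAt.hasDerivAt
  have h := intervalIntegral.integral_eq_sub_of_hasDerivAt (a := 0) (b := Real.pi)
    (f := fun χ => Real.sin χ * Real.sin χ * a χ)
    (f' := fun χ => Real.sin χ * (Real.sin χ * deriv a χ + 2 * Real.cos χ * a χ)) (fun χ _ => by
      have := ((Real.hasDerivAt_sin χ).mul (Real.hasDerivAt_sin χ)).mul (hd χ)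
      refine this.congr_deriv ?_
      simp only [Pi.mul_apply]
      ring) (by apply Continuous.intervalIntegrable; fun_prop)
  simpa using h

end Parts

section Laplacian

variable {V W : (Fin 4 → ℝ) → ℝ} {x : Fin 4 → ℝ}

theorem angDeriv_congr (h : ∀ y ∈ spacelike, V y = W y) (hx : x ∈ spacelike) (i : Fin 4) :
    angDeriv i V x = angDeriv i W x := by
  unfold angDeriv
  rw [Filter.EventuallyEq.fderiv_eq]
  filter_upwards [isOpen_spacelike.mem_nhds hx] with y hy using h y hy

/-- The Laplacian of the spheres, `∑ L_i L_i`. -/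
noncomputable def angLap (V : (Fin 4 → ℝ) → ℝ) (x : Fin 4 → ℝ) : ℝ :=
  ∑ i, angDeriv i (angDeriv i V) x

/-- The Haar mean over the rotation group. -/
noncomputable def haarAvg (V : (Fin 4 → ℝ) → ℝ) : (Fin 4 → ℝ) → ℝ :=
  wAvg (fun χ => Real.sin χ ^ 2) V

/-- The parametrix of `angLap` with kernel proportional to `(π - χ) cot χ` in terms of Haar
measure. -/
noncomputable def greenAvg (V : (Fin 4 → ℝ) → ℝ) : (Fin 4 → ℝ) → ℝ :=
  wAvg (fun χ => (Real.pi - χ) * Real.cos χ * Real.sin χ) V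

theorem contDiff_greenWeight :
    ContDiff ℝ ∞ fun χ => (Real.pi - χ) * Real.cos χ * Real.sin χ := by fun_prop

theorem coneSmooth_greenAvg (hV : ConeSmooth V) : ConeSmooth (greenAvg V) :=
  coneSmooth_wAvg contDiff_greenWeight hV

theorem contDiff_orbitAvg (hV : ConeSmooth V) (hx : x ∈ spacelike) {k : (Fin 4 → ℝ) → ℝ}
    (hk : ContDiff ℝ ∞ k) :
    ContDiff ℝ ∞ fun χ => sphInt fun y => k y * V (rot (slicePt χ y) x) :=
  contDiff_sliceAvg hk (isOpen_orbit_preimage x) (unitQuat_subset_orbit hx)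
    (contDiffOn_orbit hV x)

/-- Invariance of Haar measure: with the weight sin² χ, the mean of a rotation derivative becomes
the integral of an exact χ-derivative. -/
theorem angDeriv_haarAvg (hV : ConeSmooth V) (hx : x ∈ spacelike) (i : Fin 4) :
    angDeriv i (haarAvg V) x = 0 := by
  rw [haarAvg, angDeriv_wAvg (by fun_prop) hV hx, wAvg]
  have h := integral_sin_conj
    (contDiff_orbitAvg hV hx (by fun_prop : ContDiff ℝ ∞ fun y : Fin 4 → ℝ => y i))
  refine Eq.trans ?_ ((congrArg (1 / 2 * ·) h).trans (mul_zero _))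
  rw [← intervalIntegral.integral_const_mul]
  refine intervalIntegral.integral_congr fun χ _ => ?_
  have := sin_mul_sphInt_angDeriv hV hx i χ
  simp only [sphInt_const_mul]
  linear_combination Real.sin χ * this

theorem greenAvg_angDeriv (hV : ConeSmooth V) (hx : x ∈ spacelike) (i : Fin 4) :
    greenAvg (angDeriv i V) x = 1 / 2 * ∫ χ in (0 : ℝ)..Real.pi,
      (Real.pi - χ + Real.cos χ * Real.sin χ) *
        sphInt fun y => y i * V (rot (slicePt χ y) x) := by
  rw [greenAvg, wAvg, ← integral_conj_weight
    (contDiff_orbitAvg hV hx (by fun_prop : ContDiff ℝ ∞ fun y : Fin 4 → ℝ => y i)),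
    ← intervalIntegral.integral_const_mul]
  refine intervalIntegral.integral_congr fun χ _ => ?_
  have := sin_mul_sphInt_angDeriv hV hx i χ
  simp only [sphInt_const_mul]
  linear_combination (Real.pi - χ) * Real.cos χ * this

theorem rot_slicePt_zero (y x : Fin 4 → ℝ) : rot (slicePt 0 y) x = x := by
  apply funext_fin_four <;> simp [rot, slicePt]

/-- Each integration by parts contributes a factor 1/2. The boundary term sits at the identity
rotation, where the slice integral is 4π V(x), which gives -π² V; the bulk term carries the Haar
weight sin² χ. -/
theorem sum_greenAvg_angDeriv_angDeriv (hV : ConeSmooth V) (hx : x ∈ spacelike) :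
    ∑ i, greenAvg (angDeriv i (angDeriv i V)) x
      = -Real.pi ^ 2 * V x + 1 / 2 * haarAvg V x := by
  have hN := contDiff_orbitAvg hV hx (contDiff_const (c := (1 : ℝ)))
  simp only [one_mul] at hN
  have h := integral_weight_deriv hN
  simp only [rot_slicePt_zero, sphInt_const] at h
  rw [haarAvg, wAvg]
  simp only [sphInt_const_mul]
  have e : ∑ i, greenAvg (angDeriv i (angDeriv i V)) x = 1 / 4 * ∫ χ in (0 : ℝ)..Real.pi,
      (Real.pi - χ + Real.cos χ * Real.sin χ) *
        deriv (fun χ => sphInt fun y => V (rot (slicePt χ y) x)) χ := by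
    rw [Finset.sum_congr rfl fun i _ => greenAvg_angDeriv (hV.angDeriv i) hx i,
      ← Finset.mul_sum, ← intervalIntegral.integral_finsetSum fun i _ => by
        have := (contDiff_orbitAvg (hV.angDeriv i) hx
          (by fun_prop : ContDiff ℝ ∞ fun y : Fin 4 → ℝ => y i)).continuous
        apply Continuous.intervalIntegrable
        fun_prop]
    rw [← intervalIntegral.integral_const_mul, ← intervalIntegral.integral_const_mul]
    refine intervalIntegral.integral_congr fun χ _ => ?_
    rw [← Finset.mul_sum, sum_sphInt_coord_mul_angDeriv hV hx χ]
    ring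
  rw [e, h]
  ring

theorem angLap_greenAvg (hV : ConeSmooth V) (hx : x ∈ spacelike) :
    angLap (greenAvg V) x = -Real.pi ^ 2 * V x + 1 / 2 * haarAvg V x := by
  rw [← sum_greenAvg_angDeriv_angDeriv hV hx]
  refine Finset.sum_congr rfl fun i _ => ?_
  rw [greenAvg, angDeriv_congr (fun y hy => angDeriv_wAvg contDiff_greenWeight hV hy i) hx,
    angDeriv_wAvg contDiff_greenWeight (hV.angDeriv i) hx]
  rfl

/-- The point of the sphere `{x₀ = t, |x⃗| = ρ}` in the direction `y`. -/
def sphAt (t ρ : ℝ) (y : Fin 4 → ℝ) : Fin 4 → ℝ := t • Pi.single 0 1 + ρ • y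

theorem sphAt_mem {t ρ : ℝ} (h : |t| < ρ) {y : Fin 4 → ℝ} (hy : y ∈ unitSph) :
    sphAt t ρ y ∈ spacelike := by
  show 0 < mink _ _
  have h2 : t ^ 2 < ρ ^ 2 := sq_lt_sq' (by linarith [neg_abs_le t]) (lt_of_abs_lt h)
  have h3 : mink (sphAt t ρ y) (sphAt t ρ y) = ρ ^ 2 - t ^ 2 := by
    rw [mink_self]
    simp [sphAt, hy.1]
    linear_combination ρ ^ 2 * hy.2
  linarith

theorem contDiff_sphAt (t ρ : ℝ) : ContDiff ℝ ∞ (sphAt t ρ) := by unfold sphAt; fun_prop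

theorem contDiffOn_comp_sphAt (hV : ConeSmooth V) (t ρ : ℝ) :
    ContDiffOn ℝ ∞ (fun y => V (sphAt t ρ y)) {y | sphAt t ρ y ∈ spacelike} :=
  ContDiffOn.comp hV (contDiff_sphAt t ρ).contDiffOn fun _ h => h

theorem isOpen_sphAt_preimage (t ρ : ℝ) : IsOpen {y | sphAt t ρ y ∈ spacelike} :=
  isOpen_spacelike.preimage (contDiff_sphAt t ρ).continuous

theorem continuousOn_comp_sphAt (hV : ConeSmooth V) {t ρ : ℝ} (h : |t| < ρ) :
    ContinuousOn (fun y => V (sphAt t ρ y)) unitSph :=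
  (contDiffOn_comp_sphAt hV t ρ).continuousOn.mono fun _ hy => sphAt_mem h hy

theorem angDeriv_comp_sphAt (hV : ConeSmooth V) {t ρ : ℝ} {y : Fin 4 → ℝ}
    (hy : sphAt t ρ y ∈ spacelike) (i : Fin 4) :
    angDeriv i (fun y => V (sphAt t ρ y)) y = angDeriv i V (sphAt t ρ y) := by
  have hr : rotGen i (sphAt t ρ y) = ρ • rotGen i y := by
    ext a
    fin_cases a <;> fin_cases i <;> simp [rotGen, sphAt]
  have hd : DifferentiableAt ℝ (fun y => V (sphAt t ρ y)) y :=
    ((contDiffOn_comp_sphAt hV t ρ).differentiableOn (by simp)).differentiableAt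
      ((isOpen_sphAt_preimage t ρ).mem_nhds hy)
  rw [angDeriv, angDeriv, hr]
  exact fderiv_eq_of_curve (γ := fun s : ℝ => y + s • rotGen i y)
    (δ := fun s : ℝ => sphAt t ρ y + s • ρ • rotGen i y) hd (hV.differentiableAt hy)
    (by simpa using hasDerivAt_quadratic y (rotGen i y) 0)
    (by simpa using hasDerivAt_quadratic (sphAt t ρ y) (ρ • rotGen i y) 0)
    (by simp) (by simp) fun s => by
      refine congrArg V ?_
      unfold sphAt
      module

theorem sphInt_angDeriv_sphAt (hV : ConeSmooth V) {t ρ : ℝ} (h : |t| < ρ) (i : Fin 4) :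
    sphInt (fun y => angDeriv i V (sphAt t ρ y)) = 0 := by
  rw [← sphInt_angDeriv (isOpen_sphAt_preimage t ρ) (fun _ hy => sphAt_mem h hy)
    ((contDiffOn_comp_sphAt hV t ρ).of_le (by simp)) i]
  exact sphInt_congr fun y hy => (angDeriv_comp_sphAt hV (sphAt_mem h hy) i).symm

/-- The coordinate fields are combinations of the generators: ∂_φ = L_3 and ∂_θ = -sin φ L_1 + cos φ
L_2. -/
theorem eq_of_angDeriv_eq_zero {f : (Fin 4 → ℝ) → ℝ}
    (hf : ∀ y ∈ unitSph, DifferentiableAt ℝ f y) (h : ∀ y ∈ unitSph, ∀ i, angDeriv i f y = 0)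
    (θ φ : ℝ) : f (sphPt θ φ) = f (sphPt 0 0) := by
  have hφ : ∀ θ φ, HasDerivAt (fun φ => f (sphPt θ φ)) 0 φ := by
    intro θ φ
    have h1 := (hf _ (sphPt_mem θ φ)).hasFDerivAt.comp_hasDerivAt φ (hasDerivAt_sphPt_right θ φ)
    refine h1.congr_deriv ?_
    rw [← h _ (sphPt_mem θ φ) 3, angDeriv]
    congr 1
  have hθ : ∀ θ φ, HasDerivAt (fun θ => f (sphPt θ φ)) 0 θ := by
    intro θ φ
    have h1 := (hf _ (sphPt_mem θ φ)).hasFDerivAt.comp_hasDerivAt θ (hasDerivAt_sphPt_left θ φ)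
    refine h1.congr_deriv ?_
    have e : sphPtθ θ φ = -Real.sin φ • rotGen 1 (sphPt θ φ)
        + Real.cos φ • rotGen 2 (sphPt θ φ) := by
      apply funext_fin_four <;> simp [sphPtθ, sphPt, rotGen] <;> try ring1
      linear_combination Real.sin θ * Real.sin_sq_add_cos_sq φ
    have h2 := h _ (sphPt_mem θ φ) 1
    have h3 := h _ (sphPt_mem θ φ) 2
    rw [angDeriv] at h2 h3
    rw [e, map_add, map_smul, map_smul, h2, h3]
    simp
  rw [is_const_of_deriv_eq_zero (fun φ => (hφ θ φ).differentiableAt) (fun φ => (hφ θ φ).deriv) φ 0]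
  exact is_const_of_deriv_eq_zero (f := fun θ => f (sphPt θ 0))
    (fun θ => (hθ θ 0).differentiableAt) (fun θ => (hθ θ 0).deriv) θ 0

theorem exists_eq_sphPt {y : Fin 4 → ℝ} (hy : y ∈ unitSph) : ∃ θ φ, y = sphPt θ φ := by
  obtain ⟨h0, h1⟩ := hy
  have h3 : -1 ≤ y 3 := by nlinarith [sq_nonneg (y 1), sq_nonneg (y 2)]
  have h3' : y 3 ≤ 1 := by nlinarith [sq_nonneg (y 1), sq_nonneg (y 2)]
  have hn : ‖(⟨y 1, y 2⟩ : ℂ)‖ = Real.sin (Real.arccos (y 3)) := by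
    rw [Real.sin_arccos, Complex.norm_def, Complex.normSq_mk]
    congr 1
    linarith
  refine ⟨Real.arccos (y 3), Complex.arg ⟨y 1, y 2⟩, ?_⟩
  apply funext_fin_four
  · simp [sphPt, h0]
  · simp [sphPt, ← hn, Complex.norm_mul_cos_arg]
  · simp [sphPt, ← hn, Complex.norm_mul_sin_arg]
  · simp [sphPt, Real.cos_arccos h3 h3']

theorem exists_eq_sphAt (hx : x ∈ spacelike) :
    ∃ t ρ θ φ, |t| < ρ ∧ x = sphAt t ρ (sphPt θ φ) := by
  have hm : 0 < mink x x := hx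
  rw [mink_self] at hm
  have hp : 0 < x 1 ^ 2 + x 2 ^ 2 + x 3 ^ 2 := by nlinarith [sq_nonneg (x 0)]
  obtain ⟨ρ, hρ⟩ : ∃ ρ, ρ = Real.sqrt (x 1 ^ 2 + x 2 ^ 2 + x 3 ^ 2) := ⟨_, rfl⟩
  have hρ0 : 0 < ρ := hρ ▸ Real.sqrt_pos.2 hp
  have hρ2 : ρ ^ 2 = x 1 ^ 2 + x 2 ^ 2 + x 3 ^ 2 := hρ ▸ Real.sq_sqrt hp.le
  obtain ⟨θ, φ, h⟩ := exists_eq_sphPt (y := ![0, x 1 / ρ, x 2 / ρ, x 3 / ρ]) ⟨rfl, by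
    simp
    field_simp
    linarith⟩
  refine ⟨x 0, ρ, θ, φ, ?_, ?_⟩
  · exact abs_lt_of_sq_lt_sq (by linarith) hρ0.le
  · rw [← h]
    apply funext_fin_four <;> simp [sphAt] <;> field_simp

/-- All spherical means vanish. -/
def MeanZero (V : (Fin 4 → ℝ) → ℝ) : Prop :=
  ∀ t ρ : ℝ, |t| < ρ → sphInt (fun y => V (sphAt t ρ y)) = 0

/-- On functions with vanishing spherical means, `-π⁻² greenAvg` inverts the spherical
Laplacian. -/
theorem angLap_greenAvg_of_meanZero (hV : ConeSmooth V) (h0 : MeanZero V) (hx : x ∈ spacelike) :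
    angLap (greenAvg V) x = -Real.pi ^ 2 * V x := by
  obtain ⟨t, ρ, θ, φ, ht, rfl⟩ := exists_eq_sphAt hx
  have hG := coneSmooth_greenAvg hV
  have hH : ConeSmooth (haarAvg V) := coneSmooth_wAvg (by fun_prop) hV
  have hc : ∀ θ φ, haarAvg V (sphAt t ρ (sphPt θ φ)) = haarAvg V (sphAt t ρ (sphPt 0 0)) := by
    refine eq_of_angDeriv_eq_zero (f := fun y => haarAvg V (sphAt t ρ y)) (fun y hy => ?_)
      fun y hy i => ?_
    · exact ((contDiffOn_comp_sphAt hH t ρ).differentiableOn (by simp)).differentiableAt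
        ((isOpen_sphAt_preimage t ρ).mem_nhds (sphAt_mem ht hy))
    · rw [angDeriv_comp_sphAt hH (sphAt_mem ht hy), angDeriv_haarAvg hV (sphAt_mem ht hy)]
  -- The Haar mean is constant on each sphere. Integrating the identity of `angLap_greenAvg` over
  -- the sphere, where the left side and the mean of V vanish, forces that constant to be zero.
  have h1 : sphInt (fun y => angLap (greenAvg V) (sphAt t ρ y)) = 0 := by
    unfold angLap
    rw [sphInt_sum fun i _ => continuousOn_comp_sphAt ((hG.angDeriv i).angDeriv i) ht]
    exact Finset.sum_eq_zero fun i _ => sphInt_angDeriv_sphAt (hG.angDeriv i) ht i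
  rw [sphInt_congr fun y hy => angLap_greenAvg hV (sphAt_mem ht hy),
    sphInt_add (continuousOn_const.fun_mul (continuousOn_comp_sphAt hV ht))
      (continuousOn_const.fun_mul (continuousOn_comp_sphAt hH ht)), sphInt_const_mul,
    sphInt_const_mul, h0 t ρ ht, mul_zero, zero_add] at h1
  have h2 : sphInt (fun y => haarAvg V (sphAt t ρ y))
      = 4 * Real.pi * haarAvg V (sphAt t ρ (sphPt 0 0)) := by
    rw [← sphInt_const]
    refine sphInt_congr fun y hy => ?_
    obtain ⟨θ, φ, rfl⟩ := exists_eq_sphPt hy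
    exact hc θ φ
  rw [angLap_greenAvg hV hx, hc]
  have hpi := Real.pi_pos
  have h3 : haarAvg V (sphAt t ρ (sphPt 0 0)) = 0 := by
    rw [h2] at h1
    have : 4 * Real.pi ≠ 0 := by positivity
    simpa [this, hpi.ne'] using h1
  rw [h3]
  ring

end Laplacian

/-! ### Angular derivatives in coordinates -/

section Angular

variable {V : (Fin 4 → ℝ) → ℝ} {x : Fin 4 → ℝ}

theorem angDeriv_zero (V : (Fin 4 → ℝ) → ℝ) : angDeriv 0 V = fun _ => 0 := by
  funext x
  simp [angDeriv, rotGen_zero]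

theorem angDeriv_one (V : (Fin 4 → ℝ) → ℝ) :
    angDeriv 1 V = fun x => x 2 * D 3 V x - x 3 * D 2 V x := by
  funext x
  rw [angDeriv, fderiv_eq_sum_D, Fin.sum_univ_four]
  simp [rotGen]
  ring

theorem angDeriv_two (V : (Fin 4 → ℝ) → ℝ) :
    angDeriv 2 V = fun x => x 3 * D 1 V x - x 1 * D 3 V x := by
  funext x
  rw [angDeriv, fderiv_eq_sum_D, Fin.sum_univ_four]
  simp [rotGen]
  ring

theorem angDeriv_three (V : (Fin 4 → ℝ) → ℝ) :
    angDeriv 3 V = fun x => x 1 * D 2 V x - x 2 * D 1 V x := by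
  funext x
  rw [angDeriv, fderiv_eq_sum_D, Fin.sum_univ_four]
  simp [rotGen]
  ring

theorem D_coord_mul_sub (hV : ConeSmooth V) (hx : x ∈ spacelike) (a i j k l : Fin 4) :
    D a (fun x => x i * D j V x - x k * D l V x) x
      = ((if a = i then D j V x else 0) + x i * D a (D j V) x)
        - ((if a = k then D l V x else 0) + x k * D a (D l V) x) := by
  rw [D_sub ((ConeSmooth.coord i).mul (hV.D j)) ((ConeSmooth.coord k).mul (hV.D l)) hx,
    D_coord_mul (hV.D j) hx, D_coord_mul (hV.D l) hx]

theorem HomDeg.angDeriv {k : ℤ} (h : HomDeg k V) (hV : ConeSmooth V) (i : Fin 4) :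
    HomDeg k (angDeriv i V) := by
  have e : ∀ a b : Fin 4, HomDeg k fun y => y a * DeSitter.D b V y := fun a b => by
    have := (HomDeg.coord a).mul (h.D hV b)
    rwa [show 1 + (k - 1) = k by ring] at this
  rcases fin_four_cases i with rfl | rfl | rfl | rfl
  · rw [angDeriv_zero]
    intro x _ c _
    simp
  · rw [angDeriv_one]; exact (e _ _).sub (e _ _)
  · rw [angDeriv_two]; exact (e _ _).sub (e _ _)
  · rw [angDeriv_three]; exact (e _ _).sub (e _ _)

theorem sum_coord_mul_angDeriv (V : (Fin 4 → ℝ) → ℝ) (x : Fin 4 → ℝ) :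
    ∑ a, x a * angDeriv a V x = 0 := by
  rw [Fin.sum_univ_four, angDeriv_zero, angDeriv_one, angDeriv_two, angDeriv_three]
  ring

theorem sum_sgn_D_angDeriv (hV : ConeSmooth V) (hx : x ∈ spacelike) :
    ∑ a, sgn a * D a (angDeriv a V) x = 0 := by
  rw [Fin.sum_univ_four, angDeriv_zero, angDeriv_one, angDeriv_two, angDeriv_three, D_const]
  simp only [D_coord_mul_sub hV hx]
  simp [sgn, D_comm hV hx 2 1, D_comm hV hx 3 1, D_comm hV hx 3 2]

/-- With E = ∑ x_i ∂_i over the spatial indices, this is |x⃗|² Δ - E² - E written out. -/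
theorem angLap_eq (hV : ConeSmooth V) (hx : x ∈ spacelike) :
    angLap V x = (x 1 ^ 2 + x 2 ^ 2 + x 3 ^ 2)
        * (D 1 (D 1 V) x + D 2 (D 2 V) x + D 3 (D 3 V) x)
      - (x 1 ^ 2 * D 1 (D 1 V) x + x 2 ^ 2 * D 2 (D 2 V) x + x 3 ^ 2 * D 3 (D 3 V) x
        + 2 * x 1 * x 2 * D 1 (D 2 V) x + 2 * x 1 * x 3 * D 1 (D 3 V) x
        + 2 * x 2 * x 3 * D 2 (D 3 V) x)
      - 2 * (x 1 * D 1 V x + x 2 * D 2 V x + x 3 * D 3 V x) := by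
  rw [angLap, Fin.sum_univ_four, angDeriv_zero, angDeriv_one V, angDeriv_two V, angDeriv_three V,
    angDeriv_one, angDeriv_two, angDeriv_three]
  simp only [D_coord_mul_sub hV hx]
  simp [D_comm hV hx 2 1, D_comm hV hx 3 1, D_comm hV hx 3 2]
  ring

/-- The wave equation in terms of `∂₀` and the Laplacian of the spheres, for homogeneous
functions. -/
theorem mink_mul_D_zero_D_zero {k : ℤ} (hV : ConeSmooth V) (hk : HomDeg k V) (hw : wave V x = 0)
    (hx : x ∈ spacelike) : mink x x * D 0 (D 0 V) x
      = angLap V x + k * (k + 1) * V x - 2 * k * x 0 * D 0 V x := by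
  have e := hk.euler hV hx
  have e2 : ∀ a, ∑ b, x b * D b (D a V) x = (k - 1) * D a V x := fun a => by
    rw [(hk.D hV a).euler (hV.D a) hx]; push_cast; ring
  have e20 := e2 0
  have e21 := e2 1
  have e22 := e2 2
  have e23 := e2 3
  rw [wave] at hw
  rw [angLap_eq hV hx, mink_self]
  simp only [Fin.sum_univ_four] at e e20 e21 e22 e23 hw
  simp [sgn] at hw
  rw [D_comm hV hx 1 0, D_comm hV hx 2 0, D_comm hV hx 3 0] at e20
  rw [D_comm hV hx 2 1, D_comm hV hx 3 1] at e21
  rw [D_comm hV hx 3 2] at e22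
  linear_combination (-(x 1 ^ 2 + x 2 ^ 2 + x 3 ^ 2)) * hw + x 1 * e21 + x 2 * e22 + x 3 * e23
    - x 0 * e20 + (k + 1) * e

end Angular

/-! ### A curl potential -/

/-- Homogeneous data `Z` on the cone from which a curl potential of the Hessian of `F` is
built. -/
structure CurlData (F : (Fin 4 → ℝ) → ℝ) (Z : Fin 4 → (Fin 4 → ℝ) → ℝ) : Prop where
  smooth : ConeSmooth F
  hom : HomDeg 1 F
  wave : ∀ x ∈ spacelike, wave F x = 0
  smoothZ : ∀ b, ConeSmooth (Z b)
  homZ : ∀ b, HomDeg (-1) (Z b)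
  time : ∀ x ∈ spacelike, ∀ b, mink x x * D 0 (Z b) x = D b F x
  lap : ∀ x ∈ spacelike, ∀ b, angLap (Z b) x = D 0 (D b F) x
  transverse : ∀ x ∈ spacelike, ∑ b, angDeriv b (Z b) x = 0

/-- The gauge part `∑ x_c L_b Z_c`. -/
noncomputable def curlGauge (Z : Fin 4 → (Fin 4 → ℝ) → ℝ) (b : Fin 4) (x : Fin 4 → ℝ) : ℝ :=
  ∑ c, x c * angDeriv b (Z c) x

/-- The curl potential built from `Z`. -/
noncomputable def curlPotential (Z : Fin 4 → (Fin 4 → ℝ) → ℝ) (a b : Fin 4) (x : Fin 4 → ℝ) : ℝ :=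
  angDeriv a (Z b) x + D a (curlGauge Z b) x

namespace CurlData

variable {F : (Fin 4 → ℝ) → ℝ} {Z : Fin 4 → (Fin 4 → ℝ) → ℝ} {x : Fin 4 → ℝ}

theorem D_time (h : CurlData F Z) (hx : x ∈ spacelike) (a b : Fin 4) :
    mink x x * D a (D 0 (Z b)) x + 2 * (sgn a * x a) * D 0 (Z b) x = D a (D b F) x := by
  rw [← D_congr (fun y hy => h.time y hy b) hx a,
    D_mul contDiff_mink.contDiffOn ((h.smoothZ b).D 0) hx, D_mink a hx]
  ring

/-- Differentiating the time equation once more in x₀ and inserting the Laplace equation gives the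
wave equation in the form it takes for functions of degree -1. -/
theorem waveZ (h : CurlData F Z) (hx : x ∈ spacelike) (b : Fin 4) :
    D 1 (D 1 (Z b)) x + D 2 (D 2 (Z b)) x + D 3 (D 3 (Z b)) x = D 0 (D 0 (Z b)) x := by
  have hV := h.smoothZ b
  have e : ∑ a, x a * D a (Z b) x = -Z b x := by
    rw [(h.homZ b).euler hV hx]; simp
  have e2 : ∀ a, ∑ c, x c * D c (D a (Z b)) x = -2 * D a (Z b) x := fun a => by
    rw [((h.homZ b).D hV a).euler (hV.D a) hx]; norm_num
  have e20 := e2 0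
  have e21 := e2 1
  have e22 := e2 2
  have e23 := e2 3
  have t := h.D_time hx 0 b
  rw [← h.lap x hx b, angLap_eq hV hx, mink_self] at t
  simp only [Fin.sum_univ_four] at e e20 e21 e22 e23
  simp [sgn] at t
  rw [D_comm hV hx 1 0, D_comm hV hx 2 0, D_comm hV hx 3 0] at e20
  rw [D_comm hV hx 2 1, D_comm hV hx 3 1] at e21
  rw [D_comm hV hx 3 2] at e22
  have hm : 0 < mink x x := hx
  rw [mink_self] at hm
  -- A spacelike vector has nonzero spatial part, so the factor |x⃗|² can be cancelled.
  have hr : x 1 ^ 2 + x 2 ^ 2 + x 3 ^ 2 ≠ 0 := by nlinarith [sq_nonneg (x 0)]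
  refine mul_left_cancel₀ hr ?_
  linear_combination -t + x 1 * e21 + x 2 * e22 + x 3 * e23 - x 0 * e20

/-- With V = ∂_b F, the 1-form L_a Z_b is a vector potential for the dual of dV. Its electric part
comes from the time equation; its magnetic part also uses the wave equation for Z_b and Euler's
relation. -/
theorem rot_D (h : CurlData F Z) (hx : x ∈ spacelike) (b : Fin 4) :
    (∀ i, mink x x * (D 0 (angDeriv i (Z b)) x - D i (angDeriv 0 (Z b)) x)
      = angDeriv i (D b F) x) ∧
    mink x x * (D 2 (angDeriv 3 (Z b)) x - D 3 (angDeriv 2 (Z b)) x)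
      = x 1 * D 0 (D b F) x + x 0 * D 1 (D b F) x ∧
    mink x x * (D 3 (angDeriv 1 (Z b)) x - D 1 (angDeriv 3 (Z b)) x)
      = x 2 * D 0 (D b F) x + x 0 * D 2 (D b F) x ∧
    mink x x * (D 1 (angDeriv 2 (Z b)) x - D 2 (angDeriv 1 (Z b)) x)
      = x 3 * D 0 (D b F) x + x 0 * D 3 (D b F) x := by
  have hV := h.smoothZ b
  have w := h.waveZ hx b
  have e2 : ∀ a, ∑ c, x c * D c (D a (Z b)) x = -2 * D a (Z b) x := fun a => by
    rw [((h.homZ b).D hV a).euler (hV.D a) hx]; norm_num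
  have e21 := e2 1
  have e22 := e2 2
  have e23 := e2 3
  have t0 := h.D_time hx 0 b
  have t1 := h.D_time hx 1 b
  have t2 := h.D_time hx 2 b
  have t3 := h.D_time hx 3 b
  simp only [Fin.sum_univ_four] at e21 e22 e23
  rw [D_comm hV hx 2 1, D_comm hV hx 3 1, D_comm hV hx 0 1] at e21
  rw [D_comm hV hx 3 2, D_comm hV hx 0 2] at e22
  rw [D_comm hV hx 0 3] at e23
  simp [sgn] at t0 t1 t2 t3
  refine ⟨fun i => ?_, ?_, ?_, ?_⟩
  · rcases fin_four_cases i with rfl | rfl | rfl | rfl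
    · simp [angDeriv_zero]
    all_goals
      simp only [angDeriv_zero, angDeriv_one, angDeriv_two, angDeriv_three, D_const,
        D_coord_mul_sub hV hx, D_comm hV hx 0 1, D_comm hV hx 0 2, D_comm hV hx 0 3,
        Fin.reduceEq, if_false]
    · linear_combination x 2 * t3 - x 3 * t2
    · linear_combination x 3 * t1 - x 1 * t3
    · linear_combination x 1 * t2 - x 2 * t1
  all_goals
    simp only [angDeriv_one, angDeriv_two, angDeriv_three, D_coord_mul_sub hV hx,
      D_comm hV hx 2 1, D_comm hV hx 3 1, D_comm hV hx 3 2, Fin.reduceEq, if_true, if_false]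
  · linear_combination mink x x * x 1 * w - mink x x * e21 + x 1 * t0 + x 0 * t1
  · linear_combination mink x x * x 2 * w - mink x x * e22 + x 2 * t0 + x 0 * t2
  · linear_combination mink x x * x 3 * w - mink x x * e23 + x 3 * t0 + x 0 * t3

theorem smooth_gauge (h : CurlData F Z) (b : Fin 4) : ConeSmooth (curlGauge Z b) :=
  ConeSmooth.sum fun c _ => (ConeSmooth.coord c).mul ((h.smoothZ c).angDeriv b)

theorem hom_gauge (h : CurlData F Z) (b : Fin 4) : HomDeg 0 (curlGauge Z b) :=
  HomDeg.sum fun c _ => by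
    simpa using (HomDeg.coord c).mul ((h.homZ c).angDeriv (h.smoothZ c) b)

theorem smooth_potential (h : CurlData F Z) (a b : Fin 4) : ConeSmooth (curlPotential Z a b) :=
  ((h.smoothZ b).angDeriv a).add ((h.smooth_gauge b).D a)

theorem hom_potential (h : CurlData F Z) (a b : Fin 4) : HomDeg (-1) (curlPotential Z a b) :=
  ((h.homZ b).angDeriv (h.smoothZ b) a).add (by
    simpa using (h.hom_gauge b).D (h.smooth_gauge b) a)

theorem sum_coord_mul_gauge (Z : Fin 4 → (Fin 4 → ℝ) → ℝ) (x : Fin 4 → ℝ) :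
    ∑ b, x b * curlGauge Z b x = 0 := by
  simp only [curlGauge, Finset.mul_sum]
  rw [Finset.sum_comm]
  refine Finset.sum_eq_zero fun c _ => ?_
  rw [← mul_zero (x c), ← sum_coord_mul_angDeriv (Z c) x, Finset.mul_sum]
  exact Finset.sum_congr rfl fun b _ => by ring

/-- This is the purpose of the gauge term: ∑ x_b L_a Z_b is the gauge function with index a, and
differentiating `sum_coord_mul_gauge` shows that the gradient term contributes its negative. -/
theorem tangent (h : CurlData F Z) (hx : x ∈ spacelike) (a : Fin 4) :
    ∑ b, x b * curlPotential Z a b x = 0 := by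
  have h1 := D_congr (f := fun y => ∑ b, y b * curlGauge Z b y) (g := fun _ => 0)
    (fun y _ => sum_coord_mul_gauge Z y) hx a
  rw [D_const, D_sum (fun b _ => (ConeSmooth.coord b).mul (h.smooth_gauge b)) hx] at h1
  simp only [D_coord_mul (h.smooth_gauge _) hx, Finset.sum_add_distrib, Finset.sum_ite_eq,
    Finset.mem_univ, if_true] at h1
  simp only [curlPotential, mul_add, Finset.sum_add_distrib]
  exact h1

theorem tangent_D (h : CurlData F Z) (hx : x ∈ spacelike) (c a : Fin 4) :
    ∑ b, x b * D c (curlPotential Z a b) x = -curlPotential Z a c x := by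
  have h1 := D_congr (f := fun y => ∑ b, y b * curlPotential Z a b y) (g := fun _ => 0)
    (fun y hy => h.tangent hy a) hx c
  rw [D_const, D_sum (fun b _ => (ConeSmooth.coord b).mul (h.smooth_potential a b)) hx] at h1
  simp only [D_coord_mul (h.smooth_potential a _) hx, Finset.sum_add_distrib, Finset.sum_ite_eq,
    Finset.mem_univ, if_true] at h1
  linarith

/-- In the first slot the gauge term is a gradient, hence invisible to antisymmetrized derivatives.
-/
theorem D_potential (h : CurlData F Z) (hx : x ∈ spacelike) (c d b : Fin 4) :
    D c (curlPotential Z d b) x - D d (curlPotential Z c b) x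
      = D c (angDeriv d (Z b)) x - D d (angDeriv c (Z b)) x := by
  have e : ∀ c d, D c (curlPotential Z d b) x
      = D c (angDeriv d (Z b)) x + D c (D d (curlGauge Z b)) x := fun c d =>
    D_add ((h.smoothZ b).angDeriv d) ((h.smooth_gauge b).D d) hx c
  rw [e, e, D_comm (h.smooth_gauge b) hx c d]
  ring

theorem curl_table (h : CurlData F Z) (hx : x ∈ spacelike) (b : Fin 4) :
    (∀ i, mink x x * (D 0 (curlPotential Z i b) x - D i (curlPotential Z 0 b) x)
      = angDeriv i (D b F) x) ∧
    mink x x * (D 2 (curlPotential Z 3 b) x - D 3 (curlPotential Z 2 b) x)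
      = x 1 * D 0 (D b F) x + x 0 * D 1 (D b F) x ∧
    mink x x * (D 3 (curlPotential Z 1 b) x - D 1 (curlPotential Z 3 b) x)
      = x 2 * D 0 (D b F) x + x 0 * D 2 (D b F) x ∧
    mink x x * (D 1 (curlPotential Z 2 b) x - D 2 (curlPotential Z 1 b) x)
      = x 3 * D 0 (D b F) x + x 0 * D 3 (D b F) x := by
  simp only [h.D_potential hx]
  exact h.rot_D hx b

theorem sum_coord_mul_hessian (h : CurlData F Z) (hx : x ∈ spacelike) (a : Fin 4) :
    ∑ b, x b * D a (D b F) x = 0 :=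
  (coneTensor_hessian h.smooth h.hom).tangent x hx a

/-- Contract the antisymmetrized derivatives of P with x in the free slot. By differentiated
tangency this is the antisymmetric part of P; by the curl table it is a combination of contractions
of the Hessian of F with x, which vanish. -/
theorem symm (h : CurlData F Z) (hx : x ∈ spacelike) (c d : Fin 4) :
    curlPotential Z c d x = curlPotential Z d c x := by
  have hm : mink x x ≠ 0 := ne_of_gt hx
  have swap : ∀ c d, ∑ b, x b * (mink x x *
      (D c (curlPotential Z d b) x - D d (curlPotential Z c b) x)) = 0 →
      ∑ b, x b * (mink x x *
        (D d (curlPotential Z c b) x - D c (curlPotential Z d b) x)) = 0 := by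
    intro c d hcd
    rw [← neg_eq_zero, ← hcd, ← Finset.sum_neg_distrib]
    exact Finset.sum_congr rfl fun b _ => by ring
  have t := h.sum_coord_mul_hessian hx
  have t0 := t 0
  have t1 := t 1
  have t2 := t 2
  have t3 := t 3
  simp only [Fin.sum_univ_four] at t0 t1 t2 t3
  have time : ∀ i, ∑ b, x b * (mink x x *
      (D 0 (curlPotential Z i b) x - D i (curlPotential Z 0 b) x)) = 0 := by
    intro i
    simp only [(h.curl_table hx _).1]
    rcases fin_four_cases i with rfl | rfl | rfl | rfl
    · simp [angDeriv_zero]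
    all_goals simp only [angDeriv_one, angDeriv_two, angDeriv_three, Fin.sum_univ_four]
    · linear_combination x 2 * t3 - x 3 * t2
    · linear_combination x 3 * t1 - x 1 * t3
    · linear_combination x 1 * t2 - x 2 * t1
  have s23 : ∑ b, x b * (mink x x *
      (D 2 (curlPotential Z 3 b) x - D 3 (curlPotential Z 2 b) x)) = 0 := by
    simp only [(h.curl_table hx _).2.1, Fin.sum_univ_four]
    linear_combination x 1 * t0 + x 0 * t1
  have s31 : ∑ b, x b * (mink x x *
      (D 3 (curlPotential Z 1 b) x - D 1 (curlPotential Z 3 b) x)) = 0 := by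
    simp only [(h.curl_table hx _).2.2.1, Fin.sum_univ_four]
    linear_combination x 2 * t0 + x 0 * t2
  have s12 : ∑ b, x b * (mink x x *
      (D 1 (curlPotential Z 2 b) x - D 2 (curlPotential Z 1 b) x)) = 0 := by
    simp only [(h.curl_table hx _).2.2.2, Fin.sum_univ_four]
    linear_combination x 3 * t0 + x 0 * t3
  have key : ∑ b, x b * (mink x x *
      (D c (curlPotential Z d b) x - D d (curlPotential Z c b) x)) = 0 := by
    have diag : ∀ c, ∑ b, x b * (mink x x *
        (D c (curlPotential Z c b) x - D c (curlPotential Z c b) x)) = 0 := by simp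
    rcases fin_four_cases c with rfl | rfl | rfl | rfl
    · exact time d
    all_goals rcases fin_four_cases d with rfl | rfl | rfl | rfl
    · exact swap _ _ (time 1)
    · exact diag 1
    · exact s12
    · exact swap _ _ s31
    · exact swap _ _ (time 2)
    · exact swap _ _ s12
    · exact diag 2
    · exact s23
    · exact swap _ _ (time 3)
    · exact s31
    · exact swap _ _ s23
    · exact diag 3
  have e : ∑ b, x b * (mink x x * (D c (curlPotential Z d b) x - D d (curlPotential Z c b) x))
      = mink x x * (curlPotential Z c d x - curlPotential Z d c x) := by
    have h1 := h.tangent_D hx c d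
    have h2 := h.tangent_D hx d c
    rw [show curlPotential Z c d x - curlPotential Z d c x = ∑ b, x b * D c (curlPotential Z d b) x
      - ∑ b, x b * D d (curlPotential Z c b) x by rw [h1, h2]; ring, ← Finset.sum_sub_distrib,
      Finset.mul_sum]
    exact Finset.sum_congr rfl fun b _ => by ring
  rw [e] at key
  exact sub_eq_zero.1 ((mul_eq_zero.1 key).resolve_left hm)

theorem coneTensor (h : CurlData F Z) : ConeTensor (curlPotential Z) where
  smooth := h.smooth_potential
  hom := h.hom_potential
  tangent _ hx a := h.tangent hx a
  symm _ hx a b := h.symm hx a b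

/-- The L_b Z_b cancel by transversality, and what is left of the gauge term vanishes because each
rotation generator is a divergence-free field. -/
theorem trace_eq_zero (h : CurlData F Z) (hx : x ∈ spacelike) :
    ∑ b, sgn b * curlPotential Z b b x = 0 := by
  have e1 : ∑ b, sgn b * angDeriv b (Z b) x = 0 := by
    have := h.transverse x hx
    rw [Fin.sum_univ_four, angDeriv_zero] at this ⊢
    simpa [sgn] using this
  have e2 : ∑ b, sgn b * D b (curlGauge Z b) x = 0 := by
    have e : ∀ b, D b (curlGauge Z b) x
        = angDeriv b (Z b) x + ∑ c, x c * D b (angDeriv b (Z c)) x := by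
      intro b
      unfold curlGauge
      rw [D_sum (fun c _ => (ConeSmooth.coord c).mul ((h.smoothZ c).angDeriv b)) hx]
      simp only [D_coord_mul ((h.smoothZ _).angDeriv b) hx, Finset.sum_add_distrib,
        Finset.sum_ite_eq, Finset.mem_univ, if_true]
    simp only [e, mul_add, Finset.sum_add_distrib, e1, zero_add, Finset.mul_sum]
    rw [Finset.sum_comm]
    refine Finset.sum_eq_zero fun c _ => ?_
    rw [← mul_zero (x c), ← sum_sgn_D_angDeriv (h.smoothZ c) hx, Finset.mul_sum]
    exact Finset.sum_congr rfl fun b _ => by ring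
  simp only [curlPotential, mul_add, Finset.sum_add_distrib, e1, e2, zero_add]

/-- Subtracting the derivative of the zero trace leaves only antisymmetrized derivatives. By the
curl table these are second derivatives of F, which cancel by symmetry and the wave equation. -/
theorem div_eq_zero (h : CurlData F Z) (hx : x ∈ spacelike) (a : Fin 4) :
    ∑ b, sgn b * D b (curlPotential Z a b) x = 0 := by
  have hm : mink x x ≠ 0 := ne_of_gt hx
  have htr : ∑ b, sgn b * D a (curlPotential Z b b) x = 0 := by
    have h1 := D_congr (g := fun _ => 0) (fun y hy => h.trace_eq_zero hy) hx a
    rw [D_const, D_sum (fun b _ => (h.smooth_potential b b).const_mul _) hx] at h1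
    simpa only [D_const_mul _ (h.smooth_potential _ _) hx] using h1
  have key : ∑ b, sgn b * (mink x x *
      (D b (curlPotential Z a b) x - D a (curlPotential Z b b) x)) = 0 := by
    have w := h.wave x hx
    rw [DeSitter.wave, Fin.sum_univ_four] at w
    have c := fun a b => D_comm h.smooth hx a b
    have anti : ∀ c d b v, mink x x *
        (D d (curlPotential Z c b) x - D c (curlPotential Z d b) x) = v →
        mink x x * (D c (curlPotential Z d b) x - D d (curlPotential Z c b) x) = -v := by
      rintro c d b v rfl
      ring
    have time := fun b => (h.curl_table hx b).1
    have s23 := fun b => (h.curl_table hx b).2.1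
    have s31 := fun b => (h.curl_table hx b).2.2.1
    have s12 := fun b => (h.curl_table hx b).2.2.2
    rw [Fin.sum_univ_four]
    rcases fin_four_cases a with rfl | rfl | rfl | rfl
    · rw [anti 1 0 1 _ (time 1 1), anti 2 0 2 _ (time 2 2), anti 3 0 3 _ (time 3 3)]
      simp only [sub_self, mul_zero, zero_add, angDeriv_one, angDeriv_two, angDeriv_three]
      rw [c 3 1, c 2 1, c 3 2]
      simp [sgn]
    · rw [time 0 1, anti 2 1 2 _ (s12 2), s31 3]
      simp only [sub_self, mul_zero, angDeriv_one]
      simp [sgn, c 2 0, c 3 0, c 3 2]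
      ring1
    · rw [time 0 2, s12 1, anti 3 2 3 _ (s23 3)]
      simp only [sub_self, mul_zero, angDeriv_two]
      simp [sgn, c 1 0, c 3 0, c 3 1]
      ring1
    · rw [time 0 3, anti 1 3 1 _ (s31 1), s23 2]
      simp only [sub_self, mul_zero, angDeriv_three]
      simp [sgn, c 1 0, c 2 0, c 2 1]
      ring1
  have e : ∑ b, sgn b * (mink x x *
      (D b (curlPotential Z a b) x - D a (curlPotential Z b b) x))
      = mink x x * ∑ b, sgn b * D b (curlPotential Z a b) x := by
    rw [← sub_zero (∑ b, sgn b * D b (curlPotential Z a b) x), ← htr, ← Finset.sum_sub_distrib,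
      Finset.mul_sum]
    exact Finset.sum_congr rfl fun b _ => by ring
  exact (mul_eq_zero.1 (e ▸ key)).resolve_left hm

theorem isSDT (h : CurlData F Z) : IsSDT (restrict (curlPotential Z)) :=
  h.coneTensor.isSDT_restrict (fun x => h.trace_eq_zero (mem_spacelike_of_mem x.2))
    fun x a => h.div_eq_zero (mem_spacelike_of_mem x.2) a

/-- Contracting the curl table with ε and x gives (x·x) ∂_a∂_b F up to multiples of the radial
derivative of ∂_b F, which is zero in degree zero. -/
theorem curl_eq (h : CurlData F Z) :
    curl (restrict (curlPotential Z)) = scalarTensor fun x => F x.1 := by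
  rw [scalarTensor_restrict h.smooth h.hom]
  funext x a b
  have hx := mem_spacelike_of_mem x.2
  rw [h.coneTensor.curl_restrict, hodge_eq]
  obtain ⟨k0, k1, k2, k3⟩ := h.curl_table hx b
  have m : mink x.1 x.1 = 1 := x.2
  rw [m] at k0 k1 k2 k3
  simp only [one_mul] at k0 k1 k2 k3
  have e : ∑ c, x.1 c * D c (D b F) x.1 = 0 := by
    rw [(h.hom.D h.smooth b).euler (h.smooth.D b) hx]; simp
  have k01 := k0 1
  have k02 := k0 2
  have k03 := k0 3
  simp only [angDeriv_one, angDeriv_two, angDeriv_three] at k01 k02 k03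
  rw [mink_self] at m
  rw [Fin.sum_univ_four] at e
  show _ = D a (D b F) x.1
  rcases fin_four_cases a with rfl | rfl | rfl | rfl <;>
    simp only [Matrix.cons_val, k1, k2, k3, k01, k02, k03]
  · linear_combination D 0 (D b F) x.1 * m + x.1 0 * e
  · linear_combination D 1 (D b F) x.1 * m - x.1 1 * e
  · linear_combination D 2 (D b F) x.1 * m - x.1 2 * e
  · linear_combination D 3 (D b F) x.1 * m - x.1 3 * e

end CurlData

/-! ### Spherical means -/

section Means

variable {k : (Fin 4 → ℝ) → ℝ} {V F : (Fin 4 → ℝ) → ℝ} {t ρ : ℝ}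

theorem hasDerivAt_sphMean (hk : ContDiff ℝ ∞ k) (hV : ConeSmooth V) (ht : |t| < ρ) :
    HasDerivAt (fun t => sphInt fun y => k y * V (sphAt t ρ y))
      (sphInt fun y => k y * D 0 V (sphAt t ρ y)) t := by
  have hm : ContDiff ℝ ∞ fun p : (Fin 4 → ℝ) × ℝ => sphAt p.2 ρ p.1 := by
    unfold sphAt; fun_prop
  have hO : IsOpen {p : (Fin 4 → ℝ) × ℝ | sphAt p.2 ρ p.1 ∈ spacelike} :=
    isOpen_spacelike.preimage hm.continuous
  have hU : IsOpen {t : ℝ | |t| < ρ} := isOpen_lt continuous_abs continuous_const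
  have hf : ContDiffOn ℝ ∞ (fun p : (Fin 4 → ℝ) × ℝ => k p.1 * V (sphAt p.2 ρ p.1))
      {p : (Fin 4 → ℝ) × ℝ | sphAt p.2 ρ p.1 ∈ spacelike} :=
    (hk.comp contDiff_fst).contDiffOn.mul (ContDiffOn.comp hV hm.contDiffOn fun _ h => h)
  have hsub : ∀ y ∈ unitSph, ∀ s ∈ {t : ℝ | |t| < ρ},
      (y, s) ∈ {p : (Fin 4 → ℝ) × ℝ | sphAt p.2 ρ p.1 ∈ spacelike} :=
    fun y hy s hs => sphAt_mem hs hy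
  have hd : DifferentiableAt ℝ (fun t => sphInt fun y => k y * V (sphAt t ρ y)) t :=
    ((contDiffOn_sphInt hU hO hsub hf).differentiableOn (by simp)).differentiableAt
      (hU.mem_nhds ht)
  refine hd.hasDerivAt.congr_deriv ?_
  rw [← fderiv_apply_one_eq_deriv]
  refine (fderiv_sphInt_apply hU hO hsub hf ht 1).trans (sphInt_congr fun y hy => ?_)
  have hm' := sphAt_mem ht hy
  have hfd : DifferentiableAt ℝ (fun p : (Fin 4 → ℝ) × ℝ => k p.1 * V (sphAt p.2 ρ p.1)) (y, t) :=
    (hf.differentiableOn (by simp)).differentiableAt (hO.mem_nhds hm')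
  have h := fderiv_eq_of_curve (g := fun z => k y * V z) (γ := fun s : ℝ => (y, t + s • (1 : ℝ)))
    (δ := fun s : ℝ => sphAt t ρ y + s • (Pi.single 0 1 : Fin 4 → ℝ)) hfd
    ((hV.differentiableAt hm').const_mul (k y))
    ((hasDerivAt_const 0 y).prodMk (by simpa using hasDerivAt_quadratic t (1 : ℝ) 0))
    (by simpa using hasDerivAt_quadratic (sphAt t ρ y) (Pi.single 0 1 : Fin 4 → ℝ) 0)
    (by simp) (by simp) fun s => by
      refine congrArg (fun z => k y * V z) ?_
      simp only [sphAt, smul_eq_mul, mul_one]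
      module
  rw [h, fderiv_const_mul (hV.differentiableAt hm')]
  rfl

theorem MeanZero.D_zero (h : MeanZero V) (hV : ConeSmooth V) : MeanZero (D 0 V) := by
  intro t ρ ht
  have h1 := hasDerivAt_sphMean (k := fun _ => 1) contDiff_const hV ht
  simp only [one_mul] at h1
  have hU : IsOpen {t : ℝ | |t| < ρ} := isOpen_lt continuous_abs continuous_const
  refine h1.unique ((hasDerivAt_const t (0 : ℝ)).congr_of_eventuallyEq ?_)
  filter_upwards [hU.mem_nhds ht] with s hs using h s ρ hs

theorem angDeriv_const_mul (c : ℝ) (hV : ConeSmooth V) {x : Fin 4 → ℝ} (hx : x ∈ spacelike)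
    (i : Fin 4) : angDeriv i (fun y => c * V y) x = c * angDeriv i V x := by
  rw [angDeriv, fderiv_const_mul (hV.differentiableAt hx)]
  rfl

theorem angLap_const_mul (c : ℝ) (hV : ConeSmooth V) {x : Fin 4 → ℝ} (hx : x ∈ spacelike) :
    angLap (fun y => c * V y) x = c * angLap V x := by
  rw [angLap, angLap, Finset.mul_sum]
  refine Finset.sum_congr rfl fun i _ => ?_
  rw [angDeriv_congr (fun y hy => angDeriv_const_mul c hV hy i) hx,
    angDeriv_const_mul c (hV.angDeriv i) hx]

theorem sum_angDeriv_D (hV : ConeSmooth V) {x : Fin 4 → ℝ} (hx : x ∈ spacelike) :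
    ∑ i, angDeriv i (D i V) x = 0 := by
  rw [Fin.sum_univ_four, angDeriv_zero, angDeriv_one, angDeriv_two, angDeriv_three]
  simp only [D_comm hV hx 2 1, D_comm hV hx 3 1, D_comm hV hx 3 2]
  ring

theorem wave_D (hF : ConeSmooth F) (hw : ∀ x ∈ spacelike, wave F x = 0) (b : Fin 4) :
    ∀ x ∈ spacelike, wave (D b F) x = 0 := by
  intro x hx
  rw [← D_wave hF hx, D_congr hw hx, D_const]

/-- A homogeneous solution of the wave equation all of whose derivatives have vanishing spherical
means has a curl potential. -/
theorem curlData_of_meanZero (hF : ConeSmooth F) (h1 : HomDeg 1 F)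
    (hw : ∀ x ∈ spacelike, wave F x = 0) (hM : ∀ b, MeanZero (D b F)) :
    CurlData F fun b x => -(Real.pi ^ 2)⁻¹ * greenAvg (D 0 (D b F)) x where
  smooth := hF
  hom := h1
  wave := hw
  smoothZ b := (coneSmooth_greenAvg ((hF.D b).D 0)).const_mul _
  homZ b := by
    refine HomDeg.const_mul _ (HomDeg.wAvg ?_)
    simpa using (h1.D hF b).D (hF.D b) 0
  time x hx b := by
    have hV := hF.D b
    have hG := coneSmooth_greenAvg (hV.D 0)
    have h0 : HomDeg 0 (D b F) := by simpa using h1.D hF b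
    have e1 : ∀ y ∈ spacelike, mink y y * D 0 (D 0 (D b F)) y
        = ∑ i, angDeriv i (angDeriv i (D b F)) y := fun y hy => by
      rw [mink_mul_D_zero_D_zero hV h0 (wave_D hF hw b y hy) hy, angLap]
      simp
    -- x·x is rotation invariant and passes through the average. In degree zero the wave equation
    -- reads (x·x) ∂_0² V = ∑ L_i L_i V, so the time equation reduces to the inversion formula for V
    -- itself.
    have e2 : mink x x * D 0 (greenAvg (D 0 (D b F))) x = -Real.pi ^ 2 * D b F x := by
      rw [← angLap_greenAvg_of_meanZero hV (hM b) hx, angLap_greenAvg hV hx,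
        ← sum_greenAvg_angDeriv_angDeriv hV hx, greenAvg,
        D_zero_wAvg contDiff_greenWeight (hV.D 0) hx,
        ← wAvg_mul_of_invariant (c := fun y => mink y y) (x := x) fun q hq => mink_rot hq x,
        wAvg_congr e1 hx, wAvg_sum contDiff_greenWeight (fun i => (hV.angDeriv i).angDeriv i) hx]
      rfl
    rw [D_const_mul _ hG hx]
    have := Real.pi_pos.ne'
    field_simp at e2 ⊢
    linarith
  lap x hx b := by
    have hG := coneSmooth_greenAvg ((hF.D b).D 0)
    rw [angLap_const_mul _ hG hx,
      angLap_greenAvg_of_meanZero ((hF.D b).D 0) ((hM b).D_zero (hF.D b)) hx]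
    have := Real.pi_pos.ne'
    field_simp
  transverse x hx := by
    have hG := fun b => coneSmooth_greenAvg ((hF.D b).D 0)
    have e1 : ∀ y ∈ spacelike, ∑ i, angDeriv i (D 0 (D i F)) y = 0 := fun y hy => by
      rw [← sum_angDeriv_D (hF.D 0) hy]
      exact Finset.sum_congr rfl fun i _ => angDeriv_congr (fun z hz => D_comm hF hz 0 i) hy i
    have e2 : ∑ b, angDeriv b (greenAvg (D 0 (D b F))) x = 0 := by
      unfold greenAvg
      rw [Finset.sum_congr rfl fun b _ =>
        angDeriv_wAvg contDiff_greenWeight ((hF.D b).D 0) hx b,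
        ← wAvg_sum contDiff_greenWeight (fun i => ((hF.D i).D 0).angDeriv i) hx,
        wAvg_congr e1 hx, wAvg]
      simp [sphInt]
    rw [Finset.sum_congr rfl fun b _ => angDeriv_const_mul _ (hG b) hx b, ← Finset.mul_sum, e2,
      mul_zero]

end Means

/-! ### The low harmonics of a solution -/

section LowHarmonics

variable {k : (Fin 4 → ℝ) → ℝ} {V W F : (Fin 4 → ℝ) → ℝ} {t ρ : ℝ}

theorem continuousOn_mul_sphAt (hk : Continuous k) (hV : ConeSmooth V) (ht : |t| < ρ) :
    ContinuousOn (fun y => k y * V (sphAt t ρ y)) unitSph :=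
  hk.continuousOn.fun_mul (continuousOn_comp_sphAt hV ht)

/-- Integration by parts on the sphere. -/
theorem sphInt_mul_angDeriv (hk : ContDiff ℝ ∞ k) (hV : ConeSmooth V) (ht : |t| < ρ)
    (j : Fin 4) : sphInt (fun y => k y * angDeriv j V (sphAt t ρ y))
      = -sphInt fun y => angDeriv j k y * V (sphAt t ρ y) := by
  have hk' : ContDiff ℝ ∞ (angDeriv j k) :=
    (hk.fderiv_right (by simp)).clm_apply (contDiff_rotGen j)
  have hU := isOpen_sphAt_preimage t ρ
  have h := sphInt_angDeriv hU (fun _ hy => sphAt_mem ht hy)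
    ((hk.contDiffOn.mul (contDiffOn_comp_sphAt hV t ρ)).of_le (by simp)) j
  have e : ∀ y ∈ unitSph, angDeriv j (fun y => k y * V (sphAt t ρ y)) y
      = k y * angDeriv j V (sphAt t ρ y) + angDeriv j k y * V (sphAt t ρ y) := by
    intro y hy
    have hd : DifferentiableAt ℝ (fun y => V (sphAt t ρ y)) y :=
      ((contDiffOn_comp_sphAt hV t ρ).differentiableOn (by simp)).differentiableAt
        (hU.mem_nhds (sphAt_mem ht hy))
    rw [← angDeriv_comp_sphAt hV (sphAt_mem ht hy), angDeriv,
      fderiv_fun_mul ((hk.differentiable (by simp)).differentiableAt) hd]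
    simp [angDeriv]
    ring
  rw [sphInt_congr e, sphInt_add (continuousOn_mul_sphAt hk.continuous (hV.angDeriv j) ht)
    (continuousOn_mul_sphAt hk'.continuous hV ht)] at h
  linarith

theorem angDeriv_coord (i j : Fin 4) (y : Fin 4 → ℝ) :
    angDeriv j (fun y => y i) y = rotGen j y i := by
  have : fderiv ℝ (fun y : Fin 4 → ℝ => y i) y = ContinuousLinearMap.proj i :=
    (ContinuousLinearMap.proj (R := ℝ) (φ := fun _ : Fin 4 => ℝ) i).fderiv
  rw [angDeriv, this]
  rfl

theorem contDiff_rotGen_apply (i j : Fin 4) : ContDiff ℝ ∞ fun y => rotGen j y i :=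
  contDiff_pi.1 (contDiff_rotGen j) i

theorem angDeriv_rotGen (i j : Fin 4) (y : Fin 4 → ℝ) :
    angDeriv j (fun y => rotGen j y i) y = rotGen j (rotGen j y) i := by
  have hl : ∀ s : ℝ, rotGen j (y + s • rotGen j y) i
      = rotGen j y i + s • rotGen j (rotGen j y) i := by
    intro s
    fin_cases i <;> fin_cases j <;> simp [rotGen] <;> ring
  have h := fderiv_eq_of_curve (f := fun y => rotGen j y i) (g := fun r : ℝ => r) (x := y)
    (γ := fun s : ℝ => y + s • rotGen j y)
    (δ := fun s : ℝ => rotGen j y i + s • rotGen j (rotGen j y) i)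
    ((contDiff_rotGen_apply i j).differentiable (by simp)).differentiableAt
    differentiableAt_id (by simpa using hasDerivAt_quadratic y (rotGen j y) 0)
    (by simpa using hasDerivAt_quadratic (rotGen j y i) (rotGen j (rotGen j y) i) 0)
    (by simp) (by simp : rotGen j y i + (0 : ℝ) • rotGen j (rotGen j y) i = rotGen j y i) hl
  rw [angDeriv, h]
  simp

theorem sum_rotGen_rotGen {i : Fin 4} (hi : i ≠ 0) (y : Fin 4 → ℝ) :
    ∑ j, rotGen j (rotGen j y) i = -2 * y i := by
  rcases fin_four_cases i with rfl | rfl | rfl | rfl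
  · exact absurd rfl hi
  all_goals
    simp [Fin.sum_univ_four, rotGen]
    ring

/-- After integration by parts this is the eigenvalue equation ∑ L_j L_j y_i = -2 y_i of the l = 1
harmonics. -/
theorem sum_sphInt_rotGen_mul_angDeriv (hV : ConeSmooth V) (ht : |t| < ρ) {i : Fin 4}
    (hi : i ≠ 0) : ∑ j, sphInt (fun y => rotGen j y i * angDeriv j V (sphAt t ρ y))
      = 2 * sphInt fun y => y i * V (sphAt t ρ y) := by
  have e : ∀ j, sphInt (fun y => rotGen j y i * angDeriv j V (sphAt t ρ y))
      = sphInt fun y => -1 * (rotGen j (rotGen j y) i * V (sphAt t ρ y)) := by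
    intro j
    rw [sphInt_mul_angDeriv (contDiff_rotGen_apply i j) hV ht, sphInt_const_mul]
    simp only [angDeriv_rotGen]
    ring
  have hc : ∀ j, Continuous fun y => rotGen j (rotGen j y) i := fun j =>
    (contDiff_rotGen_apply i j).continuous.comp (continuous_rotGen j)
  rw [Finset.sum_congr rfl fun j _ => e j, ← sphInt_sum fun j _ =>
    continuousOn_const.fun_mul (continuousOn_mul_sphAt (hc j) hV ht), ← sphInt_const_mul]
  refine sphInt_congr fun y _ => ?_
  have := sum_rotGen_rotGen hi y
  rw [← Finset.mul_sum, ← Finset.sum_mul, this]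
  ring

theorem sphInt_coord_mul_angLap (hV : ConeSmooth V) (ht : |t| < ρ) {i : Fin 4} (hi : i ≠ 0) :
    sphInt (fun y => y i * angLap V (sphAt t ρ y))
      = -2 * sphInt fun y => y i * V (sphAt t ρ y) := by
  have hci : ContDiff ℝ ∞ fun y : Fin 4 → ℝ => y i := by fun_prop
  have e : ∀ j, sphInt (fun y => y i * angDeriv j (angDeriv j V) (sphAt t ρ y))
      = -sphInt (fun y => rotGen j y i * angDeriv j V (sphAt t ρ y)) := by
    intro j
    rw [sphInt_mul_angDeriv hci (hV.angDeriv j) ht]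
    simp only [angDeriv_coord]
  simp only [angLap, Finset.mul_sum]
  rw [sphInt_sum fun j _ => continuousOn_mul_sphAt hci.continuous ((hV.angDeriv j).angDeriv j) ht,
    Finset.sum_congr rfl fun j _ => e j, Finset.sum_neg_distrib,
    sum_sphInt_rotGen_mul_angDeriv hV ht hi]
  ring

theorem sphInt_angLap (hV : ConeSmooth V) (ht : |t| < ρ) :
    sphInt (fun y => angLap V (sphAt t ρ y)) = 0 := by
  unfold angLap
  rw [sphInt_sum fun i _ => continuousOn_comp_sphAt ((hV.angDeriv i).angDeriv i) ht]
  exact Finset.sum_eq_zero fun i _ => sphInt_angDeriv_sphAt (hV.angDeriv i) ht i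

/-- On the unit sphere ∑ (e_j × y) ⊗ (e_j × y) is the projector onto the tangent plane; the radial
spatial derivative is then rewritten through the Euler field and ∂_0. -/
theorem sum_rotGen_mul_angDeriv {i : Fin 4} (hi : i ≠ 0) {y : Fin 4 → ℝ} (hy : y ∈ unitSph)
    (V : (Fin 4 → ℝ) → ℝ) (t : ℝ) : ∑ j, rotGen j y i * angDeriv j V (sphAt t 1 y)
      = D i V (sphAt t 1 y) - y i * (∑ a, sphAt t 1 y a * D a V (sphAt t 1 y)
        - t * D 0 V (sphAt t 1 y)) := by
  obtain ⟨h0, h2⟩ := hy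
  have s0 : sphAt t 1 y 0 = t := by simp [sphAt, h0]
  have s1 : sphAt t 1 y 1 = y 1 := by simp [sphAt]
  have s2 : sphAt t 1 y 2 = y 2 := by simp [sphAt]
  have s3 : sphAt t 1 y 3 = y 3 := by simp [sphAt]
  simp only [Fin.sum_univ_four, angDeriv_zero, angDeriv_one, angDeriv_two, angDeriv_three, s0, s1,
    s2, s3]
  rcases fin_four_cases i with rfl | rfl | rfl | rfl
  · exact absurd rfl hi
  · simp [rotGen]; linear_combination D 1 V (sphAt t 1 y) * h2
  · simp [rotGen]; linear_combination D 2 V (sphAt t 1 y) * h2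
  · simp [rotGen]; linear_combination D 3 V (sphAt t 1 y) * h2

/-- The mean of a spatial derivative of a homogeneous function. -/
theorem sphInt_D {m : ℤ} (hV : ConeSmooth V) (hm : HomDeg m V) (ht : |t| < 1) {i : Fin 4}
    (hi : i ≠ 0) : sphInt (fun y => D i V (sphAt t 1 y))
      = (m + 2) * sphInt (fun y => y i * V (sphAt t 1 y))
        - t * sphInt (fun y => y i * D 0 V (sphAt t 1 y)) := by
  have hci : Continuous fun y : Fin 4 → ℝ => y i := by fun_prop
  have h := sum_sphInt_rotGen_mul_angDeriv hV ht hi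
  have c1 := continuousOn_comp_sphAt (hV.D i) ht
  have c2 := continuousOn_mul_sphAt hci hV ht
  have c3 := continuousOn_mul_sphAt hci (hV.D 0) ht
  rw [← sphInt_sum fun j _ =>
    continuousOn_mul_sphAt (contDiff_rotGen_apply i j).continuous (hV.angDeriv j) ht,
    sphInt_congr (l := fun y => D i V (sphAt t 1 y) - (m * (y i * V (sphAt t 1 y))
      - t * (y i * D 0 V (sphAt t 1 y)))) fun y hy => by
        rw [sum_rotGen_mul_angDeriv hi hy, hm.euler hV (sphAt_mem ht hy)]; ring,
    sphInt_sub c1 ((continuousOn_const.fun_mul c2).fun_sub (continuousOn_const.fun_mul c3)),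
    sphInt_sub (continuousOn_const.fun_mul c2) (continuousOn_const.fun_mul c3), sphInt_const_mul,
    sphInt_const_mul] at h
  linarith

theorem mink_sphAt {y : Fin 4 → ℝ} (hy : y ∈ unitSph) (t : ℝ) :
    mink (sphAt t 1 y) (sphAt t 1 y) = 1 - t ^ 2 := by
  rw [mink_self]
  simp [sphAt, hy.1]
  linear_combination hy.2

/-- On the slice |x⃗| = 1 the factor x·x is the constant 1 - t², so the wave equation can be tested
against functions of the direction alone. -/
theorem sphInt_wave {m : ℤ} (hV : ConeSmooth V) (hm : HomDeg m V)
    (hw : ∀ x ∈ spacelike, wave V x = 0) (hk : ContDiff ℝ ∞ k) (ht : |t| < 1) :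
    (1 - t ^ 2) * sphInt (fun y => k y * D 0 (D 0 V) (sphAt t 1 y))
      = sphInt (fun y => k y * angLap V (sphAt t 1 y))
        + m * (m + 1) * sphInt (fun y => k y * V (sphAt t 1 y))
        - 2 * m * t * sphInt (fun y => k y * D 0 V (sphAt t 1 y)) := by
  have hL : ConeSmooth (angLap V) := ConeSmooth.sum fun i _ => (hV.angDeriv i).angDeriv i
  have c1 := continuousOn_mul_sphAt hk.continuous hL ht
  have c2 := continuousOn_mul_sphAt hk.continuous hV ht
  have c3 := continuousOn_mul_sphAt hk.continuous (hV.D 0) ht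
  rw [← sphInt_const_mul, ← sphInt_const_mul, ← sphInt_const_mul,
    ← sphInt_add c1 (continuousOn_const.fun_mul c2),
    ← sphInt_sub (c1.fun_add (continuousOn_const.fun_mul c2)) (continuousOn_const.fun_mul c3)]
  refine sphInt_congr fun y hy => ?_
  have hx := sphAt_mem ht hy
  have h := mink_mul_D_zero_D_zero hV hm (hw _ hx) hx
  rw [mink_sphAt hy, show sphAt t 1 y 0 = t by simp [sphAt, hy.1]] at h
  linear_combination k y * h

/-- The spherical means of a solution of degree zero are affine functions of time. -/
theorem exists_affine_mean (hV : ConeSmooth V) (h0 : HomDeg 0 V)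
    (hw : ∀ x ∈ spacelike, wave V x = 0) : ∃ α β : ℝ, ∀ t : ℝ, |t| < 1 →
      sphInt (fun y => V (sphAt t 1 y)) = α + β * t ∧
      sphInt (fun y => D 0 V (sphAt t 1 y)) = β := by
  have hI : IsOpen {t : ℝ | |t| < 1} := isOpen_lt continuous_abs continuous_const
  have hP : IsPreconnected {t : ℝ | |t| < 1} := by
    have : {t : ℝ | |t| < 1} = Ioo (-1) 1 := by ext t; simp [abs_lt]
    rw [this]; exact isPreconnected_Ioo
  have d : ∀ {W : (Fin 4 → ℝ) → ℝ}, ConeSmooth W → ∀ {t : ℝ}, |t| < 1 →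
      HasDerivAt (fun t => sphInt fun y => W (sphAt t 1 y))
        (sphInt fun y => D 0 W (sphAt t 1 y)) t := fun hW t ht => by
    simpa using hasDerivAt_sphMean (k := fun _ => 1) contDiff_const hW ht
  -- In degree zero the lower-order terms of the wave equation vanish and the mean of the Laplacian
  -- is zero, so the mean has zero second time derivative.
  have d2 : ∀ t : ℝ, |t| < 1 → sphInt (fun y => D 0 (D 0 V) (sphAt t 1 y)) = 0 := by
    intro t ht
    have h := sphInt_wave hV h0 hw (k := fun _ => 1) contDiff_const ht
    simp only [one_mul, sphInt_angLap hV ht] at h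
    have ht2 : 1 - t ^ 2 ≠ 0 := by
      have := (sq_lt_one_iff_abs_lt_one t).2 ht
      linarith
    simpa [ht2] using h
  obtain ⟨β, hβ⟩ := hI.exists_is_const_of_deriv_eq_zero hP
    (fun t ht => (d (hV.D 0) ht).differentiableAt.differentiableWithinAt)
    (fun t ht => by rw [(d (hV.D 0) ht).deriv]; exact d2 t ht)
  have d3 : ∀ t : ℝ, |t| < 1 →
      HasDerivAt (fun t => sphInt (fun y => V (sphAt t 1 y)) - β * t) 0 t := by
    intro t ht
    have h := (d hV ht).sub ((hasDerivAt_id t).const_mul β)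
    rw [hβ t ht, mul_one, sub_self] at h
    exact h
  obtain ⟨α, hα⟩ := hI.exists_is_const_of_deriv_eq_zero hP
    (fun t ht => (d3 t ht).differentiableAt.differentiableWithinAt)
    (fun t ht => (d3 t ht).deriv)
  exact ⟨α, β, fun t ht => ⟨by linarith [hα t ht], hβ t ht⟩⟩

/-- No equation is left to solve: the first two time derivatives of the mean are given, and the wave
equation in degree one determines the mean from them algebraically. -/
theorem sphInt_zero_harmonic (hF : ConeSmooth F) (h1 : HomDeg 1 F)
    (hw : ∀ x ∈ spacelike, wave F x = 0) {α β : ℝ} (ht : |t| < 1)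
    (h : sphInt (fun y => D 0 F (sphAt t 1 y)) = α + β * t)
    (h' : sphInt (fun y => D 0 (D 0 F) (sphAt t 1 y)) = β) :
    sphInt (fun y => F (sphAt t 1 y)) = β / 2 * (1 + t ^ 2) + α * t := by
  have e := sphInt_wave hF h1 hw (k := fun _ => 1) contDiff_const ht
  simp only [one_mul, sphInt_angLap hF ht, h, h'] at e
  push_cast at e
  linarith

/-- The moment N = ∫ y_i F and its first two time derivatives satisfy three linear relations: the
wave equation tested against y_i, and `sphInt_D` for F and for ∂_0 F. They give N' = β (1 - t²)/2,
and then N. -/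
theorem sphInt_one_harmonic (hF : ConeSmooth F) (h1 : HomDeg 1 F)
    (hw : ∀ x ∈ spacelike, wave F x = 0) {α β : ℝ} (ht : |t| < 1) {i : Fin 4} (hi : i ≠ 0)
    (h : sphInt (fun y => D i F (sphAt t 1 y)) = α + β * t)
    (h' : sphInt (fun y => D 0 (D i F) (sphAt t 1 y)) = β) :
    sphInt (fun y => y i * F (sphAt t 1 y)) = α / 3 + β / 6 * (3 * t - t ^ 3) := by
  have e := sphInt_wave hF h1 hw (k := fun y => y i) (by fun_prop) ht
  rw [sphInt_coord_mul_angLap hF ht hi] at e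
  have e1 := sphInt_D hF h1 ht hi
  have h0 : HomDeg 0 (D 0 F) := by simpa using h1.D hF 0
  have e2 := sphInt_D (hF.D 0) h0 ht hi
  rw [sphInt_congr fun y hy => D_comm hF (sphAt_mem ht hy) i 0, h'] at e2
  rw [h] at e1
  push_cast at e e1 e2
  linear_combination -(1 / 3) * e1 - t / 6 * (1 - t ^ 2) * e2 + t ^ 2 / 6 * e

end LowHarmonics

/-! ### The even harmonics as the obstruction to constant means. -/

section Harmonics

variable {F : (Fin 4 → ℝ) → ℝ}

theorem abs_tanh_lt_one (τ : ℝ) : |Real.tanh τ| < 1 := by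
  rw [Real.tanh_eq_sinh_div_cosh, abs_div, abs_of_pos (Real.cosh_pos τ),
    div_lt_one (Real.cosh_pos τ)]
  refine abs_lt_of_sq_lt_sq ?_ (Real.cosh_pos τ).le
  linarith [Real.cosh_sq τ]

/-- In the slicing |x⃗| = 1 the time variable is tanh τ, and the point is recovered by scaling with
cosh τ. -/
theorem point_eq (τ θ φ : ℝ) :
    (point τ θ φ).1 = Real.cosh τ • sphAt (Real.tanh τ) 1 (sphPt θ φ) := by
  have := (Real.cosh_pos τ).ne'
  apply funext_fin_four <;>
    simp only [point, sphAt, sphPt, Real.tanh_eq_sinh_div_cosh, Pi.add_apply, Pi.smul_apply,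
      smul_eq_mul, Pi.single_apply, Matrix.cons_val, Fin.reduceEq, if_true, if_false]
  · field_simp
    ring1
  all_goals ring1

theorem apply_point (h1 : HomDeg 1 F) (τ θ φ : ℝ) :
    F (point τ θ φ).1 = Real.cosh τ * F (sphAt (Real.tanh τ) 1 (sphPt θ φ)) := by
  rw [point_eq, h1 _ (sphAt_mem (abs_tanh_lt_one τ) (sphPt_mem θ φ)) _ (Real.cosh_pos τ), zpow_one]

theorem harmCoeff_eq (h1 : HomDeg 1 F) {i : Fin 4} {k : (Fin 4 → ℝ) → ℝ}
    (hk : ∀ θ φ, harm i θ φ = k (sphPt θ φ)) (τ : ℝ) :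
    harmCoeff (fun x => F x.1) i τ = harmNormalization i *
      (Real.cosh τ * sphInt fun y => k y * F (sphAt (Real.tanh τ) 1 y)) := by
  rw [harmCoeff, ← sphInt_const_mul, sphInt]
  congr 1
  refine intervalIntegral.integral_congr fun θ _ => intervalIntegral.integral_congr fun φ _ => ?_
  simp only [apply_point h1, hk]
  ring

/-- The spatial coordinate that restricts to `harm i`. -/
def harmCoord (i : Fin 4) : Fin 4 := ![0, 3, 1, 2] i

theorem harm_eq_coord {i : Fin 4} (hi : i ≠ 0) (θ φ : ℝ) :
    harm i θ φ = sphPt θ φ (harmCoord i) := by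
  rcases fin_four_cases i with rfl | rfl | rfl | rfl
  · exact absurd rfl hi
  all_goals simp [harm, sphPt, harmCoord]

theorem cosh_mul_tanh (τ : ℝ) : Real.cosh τ * Real.tanh τ = Real.sinh τ := by
  rw [Real.tanh_eq_sinh_div_cosh]
  have := (Real.cosh_pos τ).ne'
  field_simp

theorem zetaHat_zero (τ : ℝ) :
    Real.cosh (2 * τ) / Real.cosh τ = Real.cosh τ * (1 + Real.tanh τ ^ 2) := by
  rw [Real.cosh_two_mul, Real.tanh_eq_sinh_div_cosh]
  have := (Real.cosh_pos τ).ne'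
  field_simp

theorem zetaHat_one (τ : ℝ) : 2 * Real.sinh τ + Real.tanh τ / Real.cosh τ
    = Real.cosh τ * (3 * Real.tanh τ - Real.tanh τ ^ 3) := by
  rw [Real.tanh_eq_sinh_div_cosh]
  have := (Real.cosh_pos τ).ne'
  field_simp
  linear_combination (-Real.sinh τ) * Real.cosh_sq τ

/-- If none of the four even harmonics occurs, the spherical means of the derivatives are
constant. -/
theorem exists_const_mean (hF : ConeSmooth F) (h1 : HomDeg 1 F)
    (hw : ∀ x ∈ spacelike, wave F x = 0)
    (hfree : ∀ i, ¬ ContainsZetaHat (fun x => F x.1) i) (b : Fin 4) :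
    ∃ α : ℝ, ∀ t : ℝ, |t| < 1 → sphInt (fun y => D b F (sphAt t 1 y)) = α := by
  have h0 : HomDeg 0 (D b F) := by simpa using h1.D hF b
  obtain ⟨α, β, h⟩ := exists_affine_mean (hF.D b) h0 (wave_D hF hw b)
  have hpi := Real.pi_pos
  suffices hβ : β = 0 by
    refine ⟨α, fun t ht => ?_⟩
    rw [(h t ht).1, hβ]
    ring
  by_contra hβ
  by_cases hb : b = 0
  · subst hb
    -- By the formula for the mean of F, α multiplies the odd harmonic sinh τ and β/2 the even one;
    -- a nonzero β would therefore exhibit the excluded harmonic.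
    refine hfree 0 ⟨1 / (4 * Real.pi) * α, 1 / (4 * Real.pi) * (β / 2), by positivity,
      fun τ => ?_⟩
    have ht := abs_tanh_lt_one τ
    rw [harmCoeff_eq h1 (k := fun _ => 1) (fun _ _ => rfl)]
    simp only [one_mul, zetaProfile, zetaHatProfile, harmNormalization, if_true]
    rw [sphInt_zero_harmonic hF h1 hw ht (h _ ht).1 (h _ ht).2, zetaHat_zero, ← cosh_mul_tanh]
    ring
  · obtain ⟨i, hi, rfl⟩ : ∃ i, i ≠ 0 ∧ b = harmCoord i := by
      clear h h0
      revert b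
      decide
    -- The coordinate moment is α/3 + (β/6)(3t - t³), and cosh τ (3t - t³) at t = tanh τ is the even
    -- profile.
    refine hfree i ⟨3 / (4 * Real.pi) * (α / 3), 3 / (4 * Real.pi) * (β / 6), by positivity,
      fun τ => ?_⟩
    have ht := abs_tanh_lt_one τ
    rw [harmCoeff_eq h1 (harm_eq_coord hi) (k := fun y => y (harmCoord i))]
    simp only [zetaProfile, zetaHatProfile, harmNormalization, if_neg hi]
    rw [sphInt_one_harmonic hF h1 hw ht hb (h _ ht).1 (h _ ht).2, zetaHat_one]
    ring

theorem sphAt_smul (ρ t : ℝ) (y : Fin 4 → ℝ) : ρ • sphAt t 1 y = sphAt (ρ * t) ρ y := by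
  unfold sphAt
  module

/-- In the absence of the four even harmonics, the spherical means of the first derivatives can
be removed by subtracting a linear function. -/
theorem exists_meanZero (hF : ConeSmooth F) (h1 : HomDeg 1 F)
    (hw : ∀ x ∈ spacelike, wave F x = 0)
    (hfree : ∀ i, ¬ ContainsZetaHat (fun x => F x.1) i) :
    ∃ G, ConeSmooth G ∧ HomDeg 1 G ∧ (∀ x ∈ spacelike, wave G x = 0) ∧
      (∀ b, MeanZero (D b G)) ∧ ∀ x ∈ spacelike, ∀ a b, D a (D b G) x = D a (D b F) x := by
  choose α hα using exists_const_mean hF h1 hw hfree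
  -- The sphere has area 4π, so α_b / (4π) is the average of ∂_b F, the slope to be subtracted.
  have hl : ∀ b, ConeSmooth fun x => α b / (4 * Real.pi) * x b := fun b =>
    (ConeSmooth.coord b).const_mul _
  have hL : ConeSmooth fun x => ∑ b, α b / (4 * Real.pi) * x b := ConeSmooth.sum fun b _ => hl b
  have hD : ∀ x ∈ spacelike, ∀ b, D b (fun x => F x - ∑ b, α b / (4 * Real.pi) * x b) x
      = D b F x - α b / (4 * Real.pi) := by
    intro x hx b
    rw [D_sub hF hL hx, D_sum (fun b _ => hl b) hx]
    simp only [D_const_mul _ (ConeSmooth.coord _) hx, D_coord]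
    simp
  have hDD : ∀ x ∈ spacelike, ∀ a b,
      D a (D b (fun x => F x - ∑ b, α b / (4 * Real.pi) * x b)) x = D a (D b F) x := by
    intro x hx a b
    rw [D_congr (fun y hy => hD y hy b) hx, D_sub (hF.D b) (ConeSmooth.const _) hx, D_const,
      sub_zero]
  refine ⟨_, hF.sub hL, h1.sub (HomDeg.sum fun b _ => (HomDeg.coord b).const_mul _),
    fun x hx => ?_, fun b t ρ ht => ?_, hDD⟩
  · rw [← hw x hx]
    exact Finset.sum_congr rfl fun a _ => by rw [hDD x hx]
  -- Homogeneity of degree zero reduces the sphere of radius ρ at time t to the unit sphere at time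
  -- t / ρ.
  · have hρ : 0 < ρ := (abs_nonneg t).trans_lt ht
    have ht' : |t / ρ| < 1 := by rwa [abs_div, abs_of_pos hρ, div_lt_one hρ]
    have h0 : HomDeg 0 (D b F) := by simpa using h1.D hF b
    rw [sphInt_congr fun y hy => hD _ (sphAt_mem ht hy) b,
      sphInt_sub (continuousOn_comp_sphAt (hF.D b) ht) continuousOn_const, sphInt_const,
      sphInt_congr (l := fun y => D b F (sphAt (t / ρ) 1 y)), hα b _ ht']
    · have := Real.pi_pos.ne'
      field_simp
      ring
    · intro y hy
      have h := h0 _ (sphAt_mem ht' hy) ρ hρ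
      rw [sphAt_smul, mul_div_cancel₀ _ hρ.ne'] at h
      simpa using h

end Harmonics

/-! ### Linearity of the curl -/

section Linear

variable {T T' : dS3 → Fin 4 → Fin 4 → ℝ}

theorem ConeTensor.add_const_mul {S S' : Fin 4 → Fin 4 → (Fin 4 → ℝ) → ℝ} (h : ConeTensor S)
    (h' : ConeTensor S') (c : ℝ) : ConeTensor fun a b x => S a b x + c * S' a b x where
  smooth a b := (h.smooth a b).add ((h'.smooth a b).const_mul c)
  hom a b := (h.hom a b).add ((h'.hom a b).const_mul c)
  tangent x hx a := by
    have e : ∀ b, x b * (S a b x + c * S' a b x) = x b * S a b x + c * (x b * S' a b x) :=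
      fun b => by ring
    simp only [e, Finset.sum_add_distrib, ← Finset.mul_sum, h.tangent x hx, h'.tangent x hx]
    ring
  symm x hx a b := by rw [h.symm x hx, h'.symm x hx]

theorem IsSDT.coneTensor_lift (hT : IsSDT T) : ConeTensor (lift T) :=
  DeSitter.coneTensor_lift hT.smooth hT.tangent hT.symm

theorem restrict_add_const_mul (c : ℝ) :
    restrict (fun a b x => lift T a b x + c * lift T' a b x)
      = fun x a b => T x a b + c * T' x a b := by
  conv_rhs => rw [← restrict_lift T, ← restrict_lift T']
  rfl

theorem D_add_const_mul (hT : IsSDT T) (hT' : IsSDT T') (c : ℝ) (x : dS3) (a b d : Fin 4) :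
    D d (fun x => lift T a b x + c * lift T' a b x) x.1
      = D d (lift T a b) x.1 + c * D d (lift T' a b) x.1 := by
  have hx := mem_spacelike_of_mem x.2
  have h := hT.coneTensor_lift.smooth a b
  have h' := hT'.coneTensor_lift.smooth a b
  rw [D_add h (h'.const_mul c) hx, D_const_mul c h' hx]

theorem curl_add_const_mul (hT : IsSDT T) (hT' : IsSDT T') (c : ℝ) :
    curl (fun x a b => T x a b + c * T' x a b) = fun x a b => curl T x a b + c * curl T' x a b := by
  funext x a b
  have e := hT.coneTensor_lift.curl_restrict x a b
  have e' := hT'.coneTensor_lift.curl_restrict x a b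
  rw [restrict_lift] at e e'
  rw [← restrict_add_const_mul,
    (hT.coneTensor_lift.add_const_mul hT'.coneTensor_lift c).curl_restrict, e, e']
  simp only [D_add_const_mul hT hT', hodge, mul_add, Finset.sum_add_distrib, Finset.mul_sum]
  congr 1
  exact Finset.sum_congr rfl fun _ _ => Finset.sum_congr rfl fun _ _ => by ring

theorem IsSDT.trace_lift (hT : IsSDT T) (x : dS3) : ∑ b, sgn b * lift T b b x.1 = 0 := by
  have h := hT.traceless x
  conv at h => lhs; rw [← restrict_lift T]
  exact h

theorem IsSDT.div_lift (hT : IsSDT T) (x : dS3) (a : Fin 4) :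
    ∑ b, sgn b * D b (lift T a b) x.1 = 0 := by
  have h := hT.coneTensor_lift.div_restrict x a
  rw [restrict_lift, hT.divFree, hT.trace_lift] at h
  linarith

/-- One lemma for both directions of the uniqueness claim: c = -1 for the difference of two
potentials, c = 1 for adding a scalar tensor. -/
theorem IsSDT.add_const_mul (hT : IsSDT T) (hT' : IsSDT T') (c : ℝ) :
    IsSDT fun x a b => T x a b + c * T' x a b := by
  rw [← restrict_add_const_mul]
  refine (hT.coneTensor_lift.add_const_mul hT'.coneTensor_lift c).isSDT_restrict
    (fun x => ?_) fun x a => ?_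
  · have e : ∀ b, sgn b * (lift T b b x.1 + c * lift T' b b x.1)
        = sgn b * lift T b b x.1 + c * (sgn b * lift T' b b x.1) := fun b => by ring
    simp only [e, Finset.sum_add_distrib, ← Finset.mul_sum, hT.trace_lift, hT'.trace_lift]
    ring
  · have e : ∀ b, sgn b * (D b (lift T a b) x.1 + c * D b (lift T' a b) x.1)
        = sgn b * D b (lift T a b) x.1 + c * (sgn b * D b (lift T' a b) x.1) := fun b => by ring
    simp only [D_add_const_mul hT hT', e, Finset.sum_add_distrib, ← Finset.mul_sum, hT.div_lift,
      hT'.div_lift]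
    ring

end Linear

/-- A solution of `□f + 3f = 0` without the four even harmonics has a curl potential. -/
theorem exists_curl_eq_scalarTensor {f : dS3 → ℝ} (hf : Smooth f)
    (hb : ∀ x, box f x + 3 * f x = 0) (hfree : ∀ i, ¬ ContainsZetaHat f i) :
    ∃ P, IsSDT P ∧ scalarTensor f = curl P := by
  have hF := coneSmooth_lift₁ hf
  have h1 := homDeg_lift₁ f
  obtain ⟨G, hG, hG1, hGw, hM, hH⟩ := exists_meanZero hF h1 (wave_lift₁ hf hb)
    (by rwa [restrict_lift₁])
  have hd := curlData_of_meanZero hG hG1 hGw hM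
  refine ⟨_, hd.isSDT, ?_⟩
  rw [hd.curl_eq, scalarTensor_restrict hG hG1]
  conv_lhs => rw [← restrict_lift₁ f]
  rw [scalarTensor_restrict hF h1]
  funext x a b
  exact (hH x.1 (mem_spacelike_of_mem x.2) a b).symm

end DeSitter

end

theorem lemma2 (Φ : DeSitter.dS3 → ℝ) (hΦ : DeSitter.Smooth Φ)
    (hbox : ∀ x, DeSitter.box Φ x + 3 * Φ x = 0)
    (hfree : ∀ i : Fin 4, ¬ DeSitter.ContainsZetaHat Φ i) :
    (DeSitter.IsSDT (DeSitter.scalarTensor Φ) ∧ DeSitter.curl (DeSitter.scalarTensor Φ) = 0) ∧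
    (∃ P : DeSitter.dS3 → Fin 4 → Fin 4 → ℝ,
      DeSitter.IsSDT P ∧ DeSitter.scalarTensor Φ = DeSitter.curl P) ∧
    (∀ P : DeSitter.dS3 → Fin 4 → Fin 4 → ℝ,
      DeSitter.IsSDT P → DeSitter.scalarTensor Φ = DeSitter.curl P →
      ∀ P' : DeSitter.dS3 → Fin 4 → Fin 4 → ℝ,
        (DeSitter.IsSDT P' ∧ DeSitter.scalarTensor Φ = DeSitter.curl P') ↔
        ∃ w : DeSitter.dS3 → ℝ, DeSitter.Smooth w ∧
          (∀ x, DeSitter.box w x + 3 * w x = 0) ∧ P' = P + DeSitter.scalarTensor w) := by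
  refine ⟨⟨DeSitter.isSDT_scalarTensor hΦ hbox, DeSitter.curl_scalarTensor hΦ⟩,
    DeSitter.exists_curl_eq_scalarTensor hΦ hbox hfree, fun P hP hc P' => ⟨?_, ?_⟩⟩
  · rintro ⟨hP', hc'⟩
    -- The difference P' - P is curl-free, so it has a scalar potential.
    obtain ⟨w, hw, hwb, e⟩ := DeSitter.exists_scalarTensor_eq (hP'.add_const_mul hP (-1)) (by
      rw [DeSitter.curl_add_const_mul hP' hP, ← hc, ← hc']
      funext x a b
      simp)
    refine ⟨w, hw, hwb, ?_⟩
    rw [← e]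
    funext x a b
    simp
  · rintro ⟨w, hw, hwb, rfl⟩
    have hT := DeSitter.isSDT_scalarTensor hw hwb
    have e : P + DeSitter.scalarTensor w
        = fun x a b => P x a b + 1 * DeSitter.scalarTensor w x a b := by
      funext x a b
      simp
    rw [e]
    refine ⟨hP.add_const_mul hT 1, ?_⟩
    rw [DeSitter.curl_add_const_mul hP hT, DeSitter.curl_scalarTensor hw, hc]
    funext x a b
    simp
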